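/- **Setting.** Let $D\in\mathbb N$, let $\mathscr H_D=\{y\in\mathbb Z^3 \text{ primitive}: \langle y,y\rangle=D\}$ and fix $x\in\mathscr H_D$. Write $\Theta$ for the Cartan involution ${}^\Theta g={}^tg^{-1}$ of $\mathbf{SL}_3$, $\mathbf T=\mathrm{Stab}_{\mathbf{SO}_3}(x)$, $\mathbf H=\mathrm{Stab}_{\mathbf{SL}_3}(x)$, $\hat e=(0,0,1)$, and identify $\mathbf{ASL}_2=\mathbf{SL}_2\ltimes\mathbb G_a^2$ with ${}^\Theta\mathrm{Stab}_{\mathbf{SL}_3}(\hat e)$, the group of matrices in $\mathbf{SL}_3$ with last row $(0,0,1)$. Put $K_\infty=\mathbf{SO}_2(\mathbb R)\subset\mathbf{SL}_2(\mathbb R)\subset\mathbf{ASL}_2(\mathbb R)$ and $[\mathbf M(\mathbb A)]=\mathbf M(\mathbb Q)\backslash\mathbf M(\mathbb A)$. For $y\in\mathscr H_D$ choose $y^1\in\mathbb Z^3$ with $\langle y^1,y\rangle=1$; the coset $y^1+y^\perp(\mathbb Z)$ does not depend on the choice. Let $\mathrm{Grid}(y)$ be the $\mathbf{SO}_2(\mathbb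 R)$-orbit of all lattice cosets $D^{-1/4}g.(y^1-\tfrac yD+y^\perp(\mathbb Z))\subset\hat e^\perp(\mathbb R)$ with $g\in\mathbf{SO}_3(\mathbb R)$, $g.y=D^{1/2}\hat e$. Let $\mathcal L^1_\bullet(\hat e^\perp)$ be the space of cosets of lattices of rank two and covolume $1$ in $\hat e^\perp(\mathbb R)$, and let $\varphi:\mathcal L^1_\bullet(\hat e^\perp)\to\mathbf{ASL}_2(\mathbb Z)\backslash\mathbf{ASL}_2(\mathbb R)$ be the bijection that sends the coset $P+L$ with $\hat e+P+L=a^{-1}.(\hat e+\hat e^\perp(\mathbb Z))$ to the class of $a$. Fix $g_{x\to\hat e}\in\mathbf{SO}_3(\mathbb R)$ with $g_{x\to\hat e}.x=D^{1/2}\hat e$ and let $\mathscr G_D$ be the image of the intersection $[{}^\Theta\mathbf H(\mathbb R)]\cap[\mathbf{SO}_3(\mathbb R)]$ of the two orbits of the identity class in $\mathbf{SL}_3(\mathbb Z)\backslash\mathbf{SL}_3(\mathbb R)$ under the map $$\mathbf{SL}_3(\mathbb Z)h\ \mapsto\ D^{-1/4}g_{x\to\hat e}.\bigl(h^{-1}.(x^1+x^\perp(\mathbb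 Z))-\tfrac xD\bigr)\qquad(h\in{}^\Theta\mathbf H(\mathbb R)).$$ A *$K_\infty$-invariant homogeneous toral set* is a closed subset $\mathcal H=[\mathbf T'(\mathbb A)\xi]$ of $[\mathbf{ASL}_2(\mathbb A)]$, where $\mathbf T'$ is a maximal torus of $\mathbf{ASL}_2$ defined and anisotropic over $\mathbb Q$ and $\xi\in\mathbf{ASL}_2(\mathbb A)$ satisfies $\xi_\infty^{-1}\mathbf T'(\mathbb R)\xi_\infty=K_\infty$. Choose such a presentation with $\mathbf T'<\mathbf{SL}_2$ and write $\xi=(l,\mathrm x)$ with $l\in\mathbf{SL}_2(\mathbb A)$ and $\mathrm x\in\mathbb A^2$. Let $E\subset M_2(\mathbb Q)$ be the quadratic field with $\mathbf T'=\mathbf{SL}_1(E)$. The *discriminant* of $\mathcal H$ is the discriminant of the order $\{a\in E: a\in l_pM_2(\mathbb Z_p)l_p^{-1}\text{ for all primes }p\}$, and the *torsion order* of $\mathcal H$ is the order of $\mathrm x_f$ in $\mathbb A_f^2/l_f\hat{\mathbb Z}^2$. **Proposition.** 1. A rotation $g_{x\to\hat e}$ as above exists, and for each such rotation $\mathscr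 G_D\subset\mathcal L^1_\bullet(\hat e^\perp)$ and $\mathscr G_D=\bigcup_{y\in\mathscr H_D}\mathrm{Grid}(y)$. 2. There is $\delta\in\mathbf{SL}_3(\mathbb Z)$ with $\delta.x=\hat e$. For every such $\delta$ there is $g_\infty\in\mathbf{ASL}_2(\mathbb R)$ with $g_\infty^{-1}\,{}^\Theta\delta\,\mathbf T(\mathbb R)\,({}^\Theta\delta)^{-1}g_\infty=\mathbf{SO}_2(\mathbb R)$. 3. For all such $\delta$ and $g_\infty$ the set $$\mathcal H_D=\bigl[({}^\Theta\delta\,\mathbf T\,({}^\Theta\delta)^{-1})(\mathbb A)\,g_\infty\bigr]\subset[\mathbf{ASL}_2(\mathbb A)]$$ is a $K_\infty$-invariant homogeneous toral set (presented by the torus ${}^\Theta\delta\,\mathbf T\,({}^\Theta\delta)^{-1}$ and $g_\infty$). Its image under the (well-defined) projection $$[\mathbf{ASL}_2(\mathbb A)]\to\mathbf{ASL}_2(\mathbb Q)\backslash\mathbf{ASL}_2(\mathbb A)/\mathbf{ASL}_2(\hat{\mathbb Z})\simeq\mathbf{ASL}_2(\mathbb Z)\backslash\mathbf{ASL}_2(\mathbb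 R)$$ is $\varphi(\mathscr G_D)$. The discriminant of $\mathcal H_D$ is $-4D$ if $D\equiv1,2\bmod 4$ and $-D$ if $D\equiv3\bmod4$. The torsion order of $\mathcal H_D$ is $D$. (The discriminant and the torsion order do not depend on the presentation with torus in $\mathbf{SL}_2$ through which they are computed.) -/

import Mathlib

open Matrix
open scoped MatrixGroups RestrictedProduct

noncomputable section

namespace ToralGrids

/-! ### The ring of adèles of `ℚ` -/

instance primesFact (p : Nat.Primes) : Fact (p : ℕ).Prime := ⟨p.2⟩

/-- The finite adèles: the restricted product of the fields `ℚ_p` with respect to the `ℤ_p`. -/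
abbrev FinAdele : Type := Πʳ p : Nat.Primes, [ℚ_[(p : ℕ)], PadicInt.subring (p : ℕ)]

/-- The adèles of `ℚ`. -/
abbrev Adele : Type := ℝ × FinAdele

theorem rat_integral_cofinite (q : ℚ) :
    ∀ᶠ p : Nat.Primes in Filter.cofinite, (q : ℚ_[(p : ℕ)]) ∈ PadicInt.subring (p : ℕ) := by
  have hfin : {p : Nat.Primes | (p : ℕ) ∣ q.den}.Finite := by
    refine Set.Finite.of_finite_image (f := fun p : Nat.Primes => (p : ℕ)) ?_ ?_
    · refine (Set.finite_Iic q.den).subset ?_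
      rintro _ ⟨p, hp, rfl⟩
      exact Nat.le_of_dvd q.den_pos hp
    · intro a _ b _ h
      exact Subtype.ext h
  refine Filter.eventually_cofinite.2 (hfin.subset ?_)
  intro p hp
  by_contra hdvd
  exact hp (Padic.norm_rat_le_one hdvd)

/-- The diagonal embedding of `ℚ` in the finite adèles. -/
def diagFin : ℚ →+* FinAdele where
  toFun q := ⟨fun p => (q : ℚ_[(p : ℕ)]), rat_integral_cofinite q⟩
  map_one' := RestrictedProduct.ext _ _ fun _ => Rat.cast_one
  map_zero' := RestrictedProduct.ext _ _ fun _ => Rat.cast_zero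
  map_add' a b := RestrictedProduct.ext _ _ fun _ => Rat.cast_add a b
  map_mul' a b := RestrictedProduct.ext _ _ fun _ => Rat.cast_mul a b

instance finAdeleAlgebra : Algebra ℚ FinAdele := diagFin.toAlgebra

/-- The projection of the adèles to `ℚ_p`. -/
def atPrime (p : Nat.Primes) : Adele →+* ℚ_[(p : ℕ)] where
  toFun a := a.2 p
  map_one' := rfl
  map_zero' := rfl
  map_add' _ _ := rfl
  map_mul' _ _ := rfl

/-! ### Linear algebraic groups over `ℚ` -/

/-- A closed `ℚ`-subgroup of `SL_n`, given by its functor of points on `ℚ`-algebras; the points are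
cut out by polynomial equations with rational coefficients in the matrix entries. -/
structure AlgSubgroup (n : ℕ) where
  pts : ∀ (R : Type) [CommRing R] [Algebra ℚ R], Subgroup SL(n, R)
  closed : ∃ F : Set (MvPolynomial (Fin n × Fin n) ℚ),
    ∀ (R : Type) [CommRing R] [Algebra ℚ R] (g : SL(n, R)),
      g ∈ pts R ↔ ∀ f ∈ F, MvPolynomial.aeval (fun ij : Fin n × Fin n => g.1 ij.1 ij.2) f = 0

namespace AlgSubgroup

variable {n : ℕ}

instance : LE (AlgSubgroup n) where
  le S T := ∀ (R : Type) [CommRing R] [Algebra ℚ R], S.pts R ≤ T.pts R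

/-- The orthogonal group intersected with `SL_n`. -/
def SO (n : ℕ) : AlgSubgroup n where
  pts R _ _ :=
    { carrier := {g | g.1ᵀ * g.1 = 1}
      one_mem' := by simp
      mul_mem' := by
        intro a b ha hb
        have ha' : a.1ᵀ * a.1 = 1 := ha
        have hb' : b.1ᵀ * b.1 = 1 := hb
        change (a.1 * b.1)ᵀ * (a.1 * b.1) = 1
        rw [Matrix.transpose_mul, Matrix.mul_assoc, ← Matrix.mul_assoc (a.1ᵀ), ha',
          Matrix.one_mul, hb']
      inv_mem' := by
        intro a ha
        have ha' : a.1ᵀ * a.1 = 1 := ha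
        have h1 : a.1 * a⁻¹.1 = 1 := congrArg Subtype.val (mul_inv_cancel a)
        have h2 : a⁻¹.1 = a.1ᵀ := by
          calc a⁻¹.1 = (a.1ᵀ * a.1) * a⁻¹.1 := by rw [ha', Matrix.one_mul]
            _ = a.1ᵀ := by rw [Matrix.mul_assoc, h1, Matrix.mul_one]
        change (a⁻¹.1)ᵀ * a⁻¹.1 = 1
        have h3 : (a⁻¹.1)ᵀ = a.1 := by rw [h2, Matrix.transpose_transpose]
        rw [h3, h1] }
  closed := by
    refine ⟨Set.range fun ij : Fin n × Fin n =>
      (∑ k, MvPolynomial.X (k, ij.1) * MvPolynomial.X (k, ij.2)) -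
        MvPolynomial.C ((1 : Matrix (Fin n) (Fin n) ℚ) ij.1 ij.2), ?_⟩
    intro R _ _ g
    change g.1ᵀ * g.1 = 1 ↔ _
    rw [← Matrix.ext_iff]
    simp only [Set.forall_mem_range, Prod.forall, map_sub, map_sum, map_mul,
      MvPolynomial.aeval_X, MvPolynomial.aeval_C, sub_eq_zero, Matrix.mul_apply,
      Matrix.transpose_apply, Matrix.one_apply]
    refine forall_congr' fun i => forall_congr' fun j => ?_
    split_ifs <;> simp

/-- The stabilizer in `SL_n` of a rational vector. -/
def stab (x : Fin n → ℚ) : AlgSubgroup n where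
  pts R _ _ :=
    { carrier := {g | g.1 *ᵥ (fun i => algebraMap ℚ R (x i)) = fun i => algebraMap ℚ R (x i)}
      one_mem' := by simp
      mul_mem' := by
        intro a b ha hb
        change (a.1 * b.1) *ᵥ _ = _
        rw [← Matrix.mulVec_mulVec, show b.1 *ᵥ _ = _ from hb, show a.1 *ᵥ _ = _ from ha]
      inv_mem' := by
        intro a ha
        have ha' : a.1 *ᵥ (fun i => algebraMap ℚ R (x i)) = fun i => algebraMap ℚ R (x i) := ha
        have h1 : a⁻¹.1 * a.1 = 1 := congrArg Subtype.val (inv_mul_cancel a)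
        change a⁻¹.1 *ᵥ _ = _
        conv_lhs => rw [← ha']
        rw [Matrix.mulVec_mulVec, h1, Matrix.one_mulVec] }
  closed := by
    refine ⟨Set.range fun i : Fin n =>
      (∑ k, MvPolynomial.X (i, k) * MvPolynomial.C (x k)) - MvPolynomial.C (x i), ?_⟩
    intro R _ _ g
    change g.1 *ᵥ _ = _ ↔ _
    rw [funext_iff]
    simp only [Set.forall_mem_range, map_sub, map_sum, map_mul, MvPolynomial.aeval_X,
      MvPolynomial.aeval_C, sub_eq_zero]
    exact Iff.rfl

instance : Min (AlgSubgroup n) where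
  min S T :=
    { pts := fun R _ _ => S.pts R ⊓ T.pts R
      closed := by
        obtain ⟨F, hF⟩ := S.closed
        obtain ⟨G, hG⟩ := T.closed
        refine ⟨F ∪ G, ?_⟩
        intro R _ _ g
        rw [Subgroup.mem_inf, hF, hG]
        constructor
        · rintro ⟨h1, h2⟩ f (hf | hf)
          exacts [h1 f hf, h2 f hf]
        · exact fun h => ⟨fun f hf => h f (Or.inl hf), fun f hf => h f (Or.inr hf)⟩ }

/-- The conjugate `q M q⁻¹` of a closed subgroup by a rational matrix `q`. -/
def conj (q : SL(n, ℚ)) (M : AlgSubgroup n) : AlgSubgroup n where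
  pts R _ _ := (M.pts R).map
    (MulAut.conj (SpecialLinearGroup.map (algebraMap ℚ R) q)).toMonoidHom
  closed := by
    obtain ⟨F, hF⟩ := M.closed
    refine ⟨(fun f => MvPolynomial.bind₁ (fun ij : Fin n × Fin n =>
      ∑ l, (∑ k, MvPolynomial.C (q⁻¹.1 ij.1 k) * MvPolynomial.X (k, l)) *
        MvPolynomial.C (q.1 l ij.2)) f) '' F, ?_⟩
    intro R _ _ g
    set Q : SL(n, R) := SpecialLinearGroup.map (algebraMap ℚ R) q with hQ
    have hQinv : Q⁻¹ = SpecialLinearGroup.map (algebraMap ℚ R) q⁻¹ := by rw [hQ, map_inv]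
    have key : g ∈ (M.pts R).map (MulAut.conj Q).toMonoidHom ↔ Q⁻¹ * g * Q ∈ M.pts R := by
      constructor
      · rintro ⟨m, hm, rfl⟩
        have : Q⁻¹ * (MulAut.conj Q).toMonoidHom m * Q = m := by
          simp [MulAut.conj_apply, mul_assoc]
        rwa [this]
      · intro h
        exact ⟨_, h, by simp [MulAut.conj_apply, mul_assoc]⟩
    rw [key, hF]
    simp only [Set.forall_mem_image]
    refine forall_congr' fun f => forall_congr' fun _ => ?_
    rw [MvPolynomial.aeval_bind₁]
    have : (fun ij : Fin n × Fin n => (Q⁻¹ * g * Q).1 ij.1 ij.2) =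
        fun ij : Fin n × Fin n => MvPolynomial.aeval (fun ij : Fin n × Fin n => g.1 ij.1 ij.2)
          (∑ l, (∑ k, MvPolynomial.C (q⁻¹.1 ij.1 k) * MvPolynomial.X (k, l)) *
            MvPolynomial.C (q.1 l ij.2) : MvPolynomial (Fin n × Fin n) ℚ) := by
      funext ij
      simp only [map_sum, map_mul, MvPolynomial.aeval_X, MvPolynomial.aeval_C]
      rw [hQinv]
      rfl
    rw [this]

/-- Points over a product ring: the real and the finite components of an adelic point. -/
theorem mem_pts_prod (M : AlgSubgroup n) (g : SL(n, Adele))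
    (h1 : SpecialLinearGroup.map (RingHom.fst ℝ FinAdele) g ∈ M.pts ℝ)
    (h2 : SpecialLinearGroup.map (RingHom.snd ℝ FinAdele) g ∈ M.pts FinAdele) :
    g ∈ M.pts Adele := by
  obtain ⟨F, hF⟩ := M.closed
  rw [hF] at h1 h2 ⊢
  intro f hf
  have e1 := h1 f hf
  have e2 := h2 f hf
  refine Prod.ext ?_ ?_
  · have := MvPolynomial.comp_aeval (fun ij : Fin n × Fin n => g.1 ij.1 ij.2)
      (AlgHom.fst ℚ ℝ FinAdele)
    exact (DFunLike.congr_fun this f).trans e1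
  · have := MvPolynomial.comp_aeval (fun ij : Fin n × Fin n => g.1 ij.1 ij.2)
      (AlgHom.snd ℚ ℝ FinAdele)
    exact (DFunLike.congr_fun this f).trans e2

/-- `T` is a torus: over an algebraic closure `K` of `ℚ` it is isomorphic, as a group scheme, to a
power of the multiplicative group (an isomorphism of functors of points on `K`-algebras). -/
def IsTorus (T : AlgSubgroup n) : Prop :=
  ∃ (r : ℕ) (e : ∀ (R : Type) [CommRing R] [Algebra ℚ R] [Algebra (AlgebraicClosure ℚ) R],
      (Fin r → Rˣ) ≃* T.pts R),
    ∀ (R S : Type) [CommRing R] [Algebra ℚ R] [Algebra (AlgebraicClosure ℚ) R]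
      [CommRing S] [Algebra ℚ S] [Algebra (AlgebraicClosure ℚ) S]
      (f : R →ₐ[AlgebraicClosure ℚ] S) (u : Fin r → Rˣ),
      (e S (fun i => Units.map (f : R →* S) (u i)) : SL(n, S)) =
        SpecialLinearGroup.map (f : R →+* S) (e R u : SL(n, R))

/-- `T` is a maximal torus of `M`. -/
def IsMaximalTorus (M T : AlgSubgroup n) : Prop :=
  T ≤ M ∧ T.IsTorus ∧ ∀ S : AlgSubgroup n, S ≤ M → S.IsTorus → T ≤ S → S ≤ T

/-- `T` is anisotropic over `ℚ`: every homomorphism from the multiplicative group to `T`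
defined over `ℚ` is trivial. -/
def IsAnisotropic (T : AlgSubgroup n) : Prop :=
  ∀ c : (∀ (R : Type) [CommRing R] [Algebra ℚ R], Rˣ →* T.pts R),
    (∀ (R S : Type) [CommRing R] [Algebra ℚ R] [CommRing S] [Algebra ℚ S]
      (f : R →ₐ[ℚ] S) (u : Rˣ),
      (c S (Units.map (f : R →* S) u) : SL(n, S)) =
        SpecialLinearGroup.map (f : R →+* S) (c R u : SL(n, R))) →
    ∀ (R : Type) [CommRing R] [Algebra ℚ R] (u : Rˣ), c R u = 1

/-- The subgroup `M(ℚ)` of `M(𝔸)`. -/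
def rat (M : AlgSubgroup n) : Subgroup (M.pts Adele) :=
  ((M.pts ℚ).map (SpecialLinearGroup.map (algebraMap ℚ Adele))).subgroupOf (M.pts Adele)

/-- The subgroup `M(ℤ) = M(ℝ) ∩ SL_n(ℤ)` of `M(ℝ)`. -/
def int (M : AlgSubgroup n) : Subgroup (M.pts ℝ) :=
  (SpecialLinearGroup.map (n := Fin n) (Int.castRingHom ℝ)).range.subgroupOf (M.pts ℝ)

/-- The adelic space `[M(𝔸)] = M(ℚ)\M(𝔸)`, with the quotient topology. -/
abbrev AdelicSpace (M : AlgSubgroup n) : Type := Quotient (QuotientGroup.rightRel M.rat)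

/-- The real space `M(ℤ)\M(ℝ)`. -/
abbrev RealSpace (M : AlgSubgroup n) : Type := Quotient (QuotientGroup.rightRel M.int)

/-- The class `M(ℚ) g`. -/
def adelicClass (M : AlgSubgroup n) (g : M.pts Adele) : M.AdelicSpace := Quotient.mk _ g

/-- The class `M(ℤ) g`. -/
def realClass (M : AlgSubgroup n) (g : M.pts ℝ) : M.RealSpace := Quotient.mk _ g

/-- The subset `[T(𝔸) g]` of `[M(𝔸)]`, for `T ≤ M`. -/
def adelicOrbit (M T : AlgSubgroup n) (g : M.pts Adele) : Set M.AdelicSpace :=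
  {a | ∃ t : M.pts Adele, (t : SL(n, Adele)) ∈ T.pts Adele ∧ a = M.adelicClass (t * g)}

/-- The adelic point with real component `g` and trivial finite components. -/
def ofReal (M : AlgSubgroup n) (g : M.pts ℝ) : M.pts Adele :=
  ⟨⟨fun i j => (g.1.1 i j, (1 : Matrix (Fin n) (Fin n) FinAdele) i j), by
      refine Prod.ext ?_ ?_
      · exact (RingHom.map_det (RingHom.fst ℝ FinAdele) _).trans g.1.2
      · exact (RingHom.map_det (RingHom.snd ℝ FinAdele) _).trans Matrix.det_one⟩,
    M.mem_pts_prod _ g.2 (one_mem _)⟩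

/-- The compact open subgroup `M(ℤ̂)`, as a set of adelic points with trivial real component. -/
def integral (M : AlgSubgroup n) : Set (M.pts Adele) :=
  {k | ∀ i j, (k.1.1 i j).1 = (1 : Matrix (Fin n) (Fin n) ℝ) i j ∧
    ∀ p : Nat.Primes, (k.1.1 i j).2 p ∈ PadicInt.subring (p : ℕ)}

/-- The graph of the projection `M(ℚ)\M(𝔸) → M(ℚ)\M(𝔸)/M(ℤ̂) ≃ M(ℤ)\M(ℝ)`; the class of `(r, 1)`
on the left projects to the class of `r` on the right. -/
def ProjectsTo (M : AlgSubgroup n) (a : M.AdelicSpace) (b : M.RealSpace) : Prop :=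
  ∃ (r : M.pts ℝ) (k : M.pts Adele), k ∈ M.integral ∧
    a = M.adelicClass (M.ofReal r * k) ∧ b = M.realClass r

end AlgSubgroup

open AlgSubgroup

/-! ### The special affine group of the plane -/

/-- The vector `ê = (0, 0, 1)`. -/
def ehat (R : Type) [CommRing R] : Fin 3 → R := ![0, 0, 1]

/-- The Cartan involution `g ↦ ᵗg⁻¹`. -/
def cartan (R : Type) [CommRing R] : SL(3, R) →* SL(3, R) where
  toFun g := (g⁻¹).transpose
  map_one' := Subtype.ext (by simp [SpecialLinearGroup.transpose])
  map_mul' a b := Subtype.ext (by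
    change ((a * b)⁻¹.1)ᵀ = (a⁻¹.1)ᵀ * (b⁻¹.1)ᵀ
    rw [_root_.mul_inv_rev, ← Matrix.transpose_mul]
    rfl)

/-- `ASL_2`, realised as the group of matrices in `SL_3` with last row `(0, 0, 1)`: the matrix with
linear part `l` and last column `(v, 1)` acts on the plane `ê + ê^⊥` by `w ↦ l w + v`. -/
def ASL2 : AlgSubgroup 3 where
  pts R _ _ :=
    { carrier := {g | g.1 2 = ehat R}
      one_mem' := by
        change (1 : Matrix (Fin 3) (Fin 3) R) 2 = _
        funext j
        fin_cases j
        exacts [rfl, rfl, rfl]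
      mul_mem' := by
        intro a b ha hb
        have ha' : a.1 2 = ehat R := ha
        have hb' : b.1 2 = ehat R := hb
        change (a.1 * b.1) 2 = ehat R
        funext j
        rw [Matrix.mul_apply, Fin.sum_univ_three, ha', hb']
        simp [ehat]
      inv_mem' := by
        intro a ha
        have ha' : a.1 2 = ehat R := ha
        have h1 : a.1 * a⁻¹.1 = 1 := congrArg Subtype.val (mul_inv_cancel a)
        change a⁻¹.1 2 = ehat R
        funext j
        have h2 := congrFun (congrFun h1 2) j
        rw [Matrix.mul_apply, Fin.sum_univ_three, ha'] at h2
        have h3 : a⁻¹.1 2 j = (1 : Matrix (Fin 3) (Fin 3) R) 2 j := by simpa [ehat] using h2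
        rw [h3]
        fin_cases j
        exacts [rfl, rfl, rfl] }
  closed := by
    refine ⟨Set.range fun j : Fin 3 => MvPolynomial.X (2, j) - MvPolynomial.C (ehat ℚ j), ?_⟩
    intro R _ _ g
    change g.1 2 = ehat R ↔ _
    rw [funext_iff]
    simp only [Set.forall_mem_range, map_sub, MvPolynomial.aeval_X, MvPolynomial.aeval_C,
      sub_eq_zero]
    refine forall_congr' fun j => ?_
    fin_cases j <;> simp [ehat]

/-- `SL_2` as the zero section of `ASL_2`: its matrices moreover have last column `(0, 0, 1)`. -/
def SL2 : AlgSubgroup 3 := ASL2 ⊓ stab (ehat ℚ)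

/-- The maximal compact subgroup `K_∞ = SO_2(ℝ)` of `SL_2(ℝ) ⊂ ASL_2(ℝ)`. -/
def Kinf : Subgroup SL(3, ℝ) := (SO 3).pts ℝ ⊓ SL2.pts ℝ

/-- The linear part in `SL_2` of a point of `ASL_2`. -/
def linPart {R : Type} [CommRing R] [Algebra ℚ R] (g : ASL2.pts R) : SL(2, R) :=
  ⟨g.1.1.submatrix Fin.castSucc Fin.castSucc, by
    have h : g.1.1 2 = ehat R := g.2
    have h0 : g.1.1 2 0 = 0 := by rw [h]; rfl
    have h1 : g.1.1 2 1 = 0 := by rw [h]; rfl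
    have h2 : g.1.1 2 2 = 1 := by rw [h]; rfl
    have hd := g.1.2
    rw [Matrix.det_fin_three, h0, h1, h2] at hd
    rw [Matrix.det_fin_two]
    simp only [Matrix.submatrix_apply, Fin.castSucc_zero, Fin.castSucc_one]
    linear_combination hd⟩

/-- The translation part of a point of `ASL_2`. -/
def translPart {R : Type} [CommRing R] [Algebra ℚ R] (g : ASL2.pts R) : Fin 2 → R :=
  fun i => g.1.1 i.castSucc 2

/-! ### Homogeneous toral sets and their invariants -/

/-- `T` and `g` present `ℋ` as a `K_∞`-invariant homogeneous toral set `[T(𝔸) g]`. -/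
structure IsToralPresentation (T : AlgSubgroup 3) (g : ASL2.pts Adele)
    (ℋ : Set ASL2.AdelicSpace) : Prop where
  maximalTorus : IsMaximalTorus ASL2 T
  anisotropic : T.IsAnisotropic
  isClosed : IsClosed ℋ
  eq_orbit : ℋ = ASL2.adelicOrbit T g
  invariant : (T.pts ℝ).map (MulAut.conj
    (SpecialLinearGroup.map (RingHom.fst ℝ FinAdele) (g : SL(3, Adele)))⁻¹).toMonoidHom = Kinf

/-- The quadratic subalgebra `E` of `M_2(ℚ)` with `T = SL_1(E)`, for a maximal torus `T` of
`SL_2` anisotropic over `ℚ`: it is generated by the rational points of `T`. -/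
def torusAlgebra (T : AlgSubgroup 3) : Subalgebra ℚ (Matrix (Fin 2) (Fin 2) ℚ) :=
  Algebra.adjoin ℚ {a | ∃ t : ASL2.pts ℚ, (t : SL(3, ℚ)) ∈ T.pts ℚ ∧ a = (linPart t).1}

/-- The order `Λ` in `E` of all elements that lie in `l_p M_2(ℤ_p) l_p⁻¹` for every prime `p`,
where `l` is the linear part of `g`. -/
def quadOrder (T : AlgSubgroup 3) (g : ASL2.pts Adele) :
    Subring (Matrix (Fin 2) (Fin 2) ℚ) where
  carrier := {a | a ∈ torusAlgebra T ∧ ∀ p : Nat.Primes,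
    ∃ m : Matrix (Fin 2) (Fin 2) ℚ_[(p : ℕ)], (∀ i j, m i j ∈ PadicInt.subring (p : ℕ)) ∧
      (algebraMap ℚ ℚ_[(p : ℕ)]).mapMatrix a =
        (SpecialLinearGroup.map (atPrime p) (linPart g)).1 * m *
          (SpecialLinearGroup.map (atPrime p) (linPart g))⁻¹.1}
  one_mem' := ⟨one_mem _, fun p => ⟨1, by
    intro i j
    rw [Matrix.one_apply]
    split_ifs
    exacts [one_mem _, zero_mem _], by
    rw [map_one, Matrix.mul_one]
    exact (congrArg Subtype.val
      (mul_inv_cancel (SpecialLinearGroup.map (atPrime p) (linPart g)))).symm⟩⟩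
  zero_mem' := ⟨zero_mem _, fun p => ⟨0, fun _ _ => zero_mem _, by simp⟩⟩
  add_mem' := by
    rintro a b ⟨ha, ha'⟩ ⟨hb, hb'⟩
    refine ⟨add_mem ha hb, fun p => ?_⟩
    obtain ⟨m, hm, em⟩ := ha' p
    obtain ⟨k, hk, ek⟩ := hb' p
    exact ⟨m + k, fun i j => add_mem (hm i j) (hk i j), by
      rw [map_add, em, ek, Matrix.mul_add, Matrix.add_mul]⟩
  neg_mem' := by
    rintro a ⟨ha, ha'⟩
    refine ⟨neg_mem ha, fun p => ?_⟩
    obtain ⟨m, hm, em⟩ := ha' p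
    exact ⟨-m, fun i j => neg_mem (hm i j), by
      rw [map_neg, em, Matrix.mul_neg, Matrix.neg_mul]⟩
  mul_mem' := by
    rintro a b ⟨ha, ha'⟩ ⟨hb, hb'⟩
    refine ⟨mul_mem ha hb, fun p => ?_⟩
    obtain ⟨m, hm, em⟩ := ha' p
    obtain ⟨k, hk, ek⟩ := hb' p
    refine ⟨m * k, fun i j => ?_, ?_⟩
    · rw [Matrix.mul_apply]
      exact sum_mem fun l _ => mul_mem (hm i l) (hk l j)
    · rw [map_mul, em, ek]
      set L := SpecialLinearGroup.map (atPrime p) (linPart g)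
      have h : L⁻¹.1 * L.1 = 1 := congrArg Subtype.val (inv_mul_cancel L)
      calc L.1 * m * L⁻¹.1 * (L.1 * k * L⁻¹.1)
          = L.1 * m * (L⁻¹.1 * L.1) * k * L⁻¹.1 := by simp only [Matrix.mul_assoc]
        _ = L.1 * (m * k) * L⁻¹.1 := by rw [h, Matrix.mul_one, Matrix.mul_assoc L.1 m k]

/-- The ring `Λ` is free of rank two over `ℤ`, with discriminant `d`: the determinant of the trace
form in a `ℤ`-basis is `d`. -/
def HasOrderDisc (Λ : Subring (Matrix (Fin 2) (Fin 2) ℚ)) (d : ℤ) : Prop :=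
  ∃ b : Module.Basis (Fin 2) ℤ Λ,
    (Matrix.of fun i j => LinearMap.trace ℤ Λ (LinearMap.mulLeft ℤ (b i * b j))).det = d

/-- The subgroup `l_f ℤ̂²` of `𝔸_f²`, where `l` is the linear part of `g`. -/
def finLattice (g : ASL2.pts Adele) : AddSubgroup (Fin 2 → FinAdele) :=
  AddSubgroup.map
    (Matrix.mulVecLin
      (SpecialLinearGroup.map (RingHom.snd ℝ FinAdele) (linPart g)).1).toAddMonoidHom
    { carrier := {z | ∀ (i : Fin 2) (p : Nat.Primes), z i p ∈ PadicInt.subring (p : ℕ)}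
      zero_mem' := fun _ p => zero_mem (PadicInt.subring (p : ℕ))
      add_mem' := fun ha hb i p => add_mem (ha i p) (hb i p)
      neg_mem' := fun ha i p => neg_mem (ha i p) }

/-- The order of the translation part `x_f` of `g` in `𝔸_f² / l_f ℤ̂²`. -/
def torsionOrder (g : ASL2.pts Adele) : ℕ :=
  addOrderOf (QuotientAddGroup.mk (fun i => (translPart g i).2) :
    (Fin 2 → FinAdele) ⧸ finLattice g)

/-- `ℋ` has discriminant `d`: it has presentations with `T` contained in `SL_2`, and the order
attached to each of them has discriminant `d`. -/
def HasDiscriminant (ℋ : Set ASL2.AdelicSpace) (d : ℤ) : Prop :=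
  (∃ T g, T ≤ SL2 ∧ IsToralPresentation T g ℋ) ∧
    ∀ T g, T ≤ SL2 → IsToralPresentation T g ℋ → HasOrderDisc (quadOrder T g) d

/-- `ℋ` has torsion order `N`: it has presentations with `T` contained in `SL_2`, and the torsion
order of each of them is `N`. -/
def HasTorsionOrder (ℋ : Set ASL2.AdelicSpace) (N : ℕ) : Prop :=
  (∃ T g, T ≤ SL2 ∧ IsToralPresentation T g ℋ) ∧
    ∀ T g, T ≤ SL2 → IsToralPresentation T g ℋ → torsionOrder g = N

/-! ### Lattice cosets in planes -/

/-- A vector with integral coordinates as a real vector. -/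
def toReal (y : Fin 3 → ℤ) : Fin 3 → ℝ := fun i => (y i : ℝ)

/-- The image of a set of vectors under a matrix. -/
def act (g : SL(3, ℝ)) (S : Set (Fin 3 → ℝ)) : Set (Fin 3 → ℝ) := (fun v => g.1 *ᵥ v) '' S

/-- The shift of a set by a vector. -/
def shift (w : Fin 3 → ℝ) (S : Set (Fin 3 → ℝ)) : Set (Fin 3 → ℝ) := (fun v => v + w) '' S

/-- The space of cosets, contained in the plane `y + z^⊥(ℝ)`, of lattices of rank two of covolume
`√d`: the lattice with basis `v, w` has covolume the square root of its Gram determinant. -/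
def latticeCosets (d : ℝ) (y z : Fin 3 → ℝ) : Set (Set (Fin 3 → ℝ)) :=
  {S | ∃ P v w : Fin 3 → ℝ, LinearIndependent ℝ ![v, w] ∧
    (P - y) ⬝ᵥ z = 0 ∧ v ⬝ᵥ z = 0 ∧ w ⬝ᵥ z = 0 ∧
    (!![v ⬝ᵥ v, v ⬝ᵥ w; w ⬝ᵥ v, w ⬝ᵥ w] : Matrix (Fin 2) (Fin 2) ℝ).det = d ∧
    S = {u | ∃ m n : ℤ, u = P + (m : ℝ) • v + (n : ℝ) • w}}

/-- The space of unimodular lattice cosets in `ê^⊥(ℝ)`. -/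
abbrev UnimodularCosets : Set (Set (Fin 3 → ℝ)) := latticeCosets 1 0 (ehat ℝ)

/-- The coset `y¹ + y^⊥(ℤ)`, where `y¹` is any integral vector with `⟨y¹, y⟩ = 1`. -/
def intCoset (y : Fin 3 → ℤ) : Set (Fin 3 → ℝ) := {v | ∃ m : Fin 3 → ℤ, m ⬝ᵥ y = 1 ∧ v = toReal m}

/-- The coset `P + L` in `ê^⊥(ℝ)` with `ê + P + L = a⁻¹ (ê + ê^⊥(ℤ))`. -/
def cosetOfPoint (a : ASL2.pts ℝ) : Set (Fin 3 → ℝ) :=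
  shift (-ehat ℝ) (act (a⁻¹ : ASL2.pts ℝ).1 (intCoset (ehat ℤ)))

theorem mulVec_toReal (g : SL(3, ℤ)) (m : Fin 3 → ℤ) :
    (SpecialLinearGroup.map (Int.castRingHom ℝ) g).1 *ᵥ toReal m = toReal (g.1 *ᵥ m) := by
  funext i
  simp [toReal, Matrix.mulVec, dotProduct]

theorem act_mul (g h : SL(3, ℝ)) (S : Set (Fin 3 → ℝ)) : act (g * h) S = act g (act h S) := by
  simp only [act, Set.image_image]
  refine Set.image_congr' fun v => ?_
  exact (Matrix.mulVec_mulVec v g.1 h.1).symm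

theorem act_one (S : Set (Fin 3 → ℝ)) : act 1 S = S := by
  simp [act]

theorem shift_injective (w : Fin 3 → ℝ) : Function.Injective (shift w) :=
  Set.image_injective.2 (add_left_injective w)

theorem last_coord (a : ASL2.pts ℝ) (v : Fin 3 → ℝ) : (a.1.1 *ᵥ v) 2 = v 2 := by
  have h : a.1.1 2 = ehat ℝ := a.2
  simp [Matrix.mulVec, h, ehat, dotProduct, Fin.sum_univ_three]

theorem mem_intCoset_ehat {v : Fin 3 → ℝ} :
    v ∈ intCoset (ehat ℤ) ↔ (∃ m : Fin 3 → ℤ, v = toReal m) ∧ v 2 = 1 := by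
  have key : ∀ m : Fin 3 → ℤ, m ⬝ᵥ ehat ℤ = m 2 := fun m => by
    simp [ehat, dotProduct, Fin.sum_univ_three]
  constructor
  · rintro ⟨m, hm, rfl⟩
    rw [key] at hm
    exact ⟨⟨m, rfl⟩, by simp [toReal, hm]⟩
  · rintro ⟨⟨m, rfl⟩, h⟩
    refine ⟨m, ?_, rfl⟩
    rw [key]
    exact_mod_cast (show ((m 2 : ℤ) : ℝ) = 1 from h)

theorem act_subset_of_int {γ : ASL2.pts ℝ} (hγ : γ ∈ ASL2.int) :
    act γ.1 (intCoset (ehat ℤ)) ⊆ intCoset (ehat ℤ) := by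
  rintro _ ⟨v, hv, rfl⟩
  obtain ⟨⟨m, rfl⟩, h2⟩ := mem_intCoset_ehat.1 hv
  refine mem_intCoset_ehat.2 ⟨?_, ?_⟩
  · obtain ⟨g, hg⟩ := Subgroup.mem_subgroupOf.1 hγ
    refine ⟨g.1 *ᵥ m, ?_⟩
    change γ.1.1 *ᵥ toReal m = _
    rw [← mulVec_toReal, hg]
  · exact (last_coord γ _).trans h2

theorem act_eq_of_int {γ : ASL2.pts ℝ} (hγ : γ ∈ ASL2.int) :
    act γ.1 (intCoset (ehat ℤ)) = intCoset (ehat ℤ) := by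
  refine (act_subset_of_int hγ).antisymm ?_
  have h := act_subset_of_int (inv_mem hγ)
  have h2 := Set.image_mono (f := fun v => γ.1.1 *ᵥ v) h
  change act γ.1 (act γ⁻¹.1 _) ⊆ _ at h2
  rw [← act_mul] at h2
  have : γ.1 * γ⁻¹.1 = 1 := congrArg Subtype.val (mul_inv_cancel γ)
  rwa [this, act_one] at h2

theorem int_of_act_subset {γ : ASL2.pts ℝ}
    (h : act γ.1 (intCoset (ehat ℤ)) ⊆ intCoset (ehat ℤ)) : γ ∈ ASL2.int := by
  have hc : ∀ c : Fin 3 → ℤ, c 2 = 1 → ∃ m : Fin 3 → ℤ, γ.1.1 *ᵥ toReal c = toReal m := by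
    intro c hc
    have := h ⟨toReal c, mem_intCoset_ehat.2 ⟨⟨c, rfl⟩, by simp [toReal, hc]⟩, rfl⟩
    exact (mem_intCoset_ehat.1 this).1
  obtain ⟨m0, h0⟩ := hc ![1, 0, 1] rfl
  obtain ⟨m1, h1⟩ := hc ![0, 1, 1] rfl
  obtain ⟨m2, h2⟩ := hc ![0, 0, 1] rfl
  have e0 : ∀ i, γ.1.1 i 0 + γ.1.1 i 2 = m0 i := fun i => by
    simpa [toReal, Matrix.mulVec, dotProduct, Fin.sum_univ_three] using congrFun h0 i
  have e1 : ∀ i, γ.1.1 i 1 + γ.1.1 i 2 = m1 i := fun i => by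
    simpa [toReal, Matrix.mulVec, dotProduct, Fin.sum_univ_three] using congrFun h1 i
  have e2 : ∀ i, γ.1.1 i 2 = m2 i := fun i => by
    simpa [toReal, Matrix.mulVec, dotProduct, Fin.sum_univ_three] using congrFun h2 i
  let N : Matrix (Fin 3) (Fin 3) ℤ := Matrix.of fun i => ![m0 i - m2 i, m1 i - m2 i, m2 i]
  have hN : (Int.castRingHom ℝ).mapMatrix N = γ.1.1 := by
    ext i j
    have a0 := e0 i
    have a1 := e1 i
    have a2 := e2 i
    fin_cases j
    · change ((m0 i - m2 i : ℤ) : ℝ) = γ.1.1 i 0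
      push_cast
      linarith
    · change ((m1 i - m2 i : ℤ) : ℝ) = γ.1.1 i 1
      push_cast
      linarith
    · exact a2.symm
  have hdet : N.det = 1 := by
    have h3 := RingHom.map_det (Int.castRingHom ℝ) N
    rw [hN, γ.1.2] at h3
    exact Int.cast_injective (α := ℝ) (by simpa using h3)
  exact Subgroup.mem_subgroupOf.2 ⟨⟨N, hdet⟩, Subtype.ext hN⟩

theorem cosetOfPoint_eq_iff (a b : ASL2.pts ℝ) :
    cosetOfPoint a = cosetOfPoint b ↔ b * a⁻¹ ∈ ASL2.int := by
  have e : ∀ S, act b.1 (act (b⁻¹ : ASL2.pts ℝ).1 S) = S := fun S => by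
    rw [← act_mul, show b.1 * (b⁻¹ : ASL2.pts ℝ).1 = 1 from
      congrArg Subtype.val (mul_inv_cancel b), act_one]
  have e' : ∀ S, act (b⁻¹ : ASL2.pts ℝ).1 (act b.1 S) = S := fun S => by
    rw [← act_mul, show (b⁻¹ : ASL2.pts ℝ).1 * b.1 = 1 from
      congrArg Subtype.val (inv_mul_cancel b), act_one]
  have e2 : ∀ S, act (b * a⁻¹ : ASL2.pts ℝ).1 S = act b.1 (act (a⁻¹ : ASL2.pts ℝ).1 S) :=
    fun S => act_mul _ _ S
  constructor
  · intro h
    have h1 := shift_injective _ h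
    refine int_of_act_subset ?_
    rw [e2, h1, e]
  · intro h
    have h1 := act_eq_of_int h
    rw [e2] at h1
    have h2 := congrArg (act (b⁻¹ : ASL2.pts ℝ).1) h1
    rw [e'] at h2
    rw [cosetOfPoint, cosetOfPoint, h2]

theorem mem_cosetOfPoint (a : ASL2.pts ℝ) (u : Fin 3 → ℝ) :
    u ∈ cosetOfPoint a ↔ ∃ m n : ℤ,
      u = (a⁻¹ : ASL2.pts ℝ).1.1 *ᵥ ![(m : ℝ), n, 1] - ehat ℝ := by
  constructor
  · rintro ⟨_, ⟨v, hv, rfl⟩, rfl⟩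
    obtain ⟨⟨m, rfl⟩, h2⟩ := mem_intCoset_ehat.1 hv
    refine ⟨m 0, m 1, ?_⟩
    have : toReal m = ![(m 0 : ℝ), m 1, 1] := by
      funext i
      fin_cases i
      exacts [rfl, rfl, h2]
    rw [← this]
    exact (sub_eq_add_neg _ _).symm
  · rintro ⟨m, n, rfl⟩
    refine ⟨_, ⟨![(m : ℝ), n, 1], mem_intCoset_ehat.2 ⟨⟨![m, n, 1], ?_⟩, rfl⟩, rfl⟩, ?_⟩
    · funext i
      fin_cases i <;> simp [toReal]
    · exact (sub_eq_add_neg _ _).symm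

theorem mulVec_three (A : Matrix (Fin 3) (Fin 3) ℝ) (x y : ℝ) :
    A *ᵥ ![x, y, 1] - ehat ℝ =
      (fun i => A i 2 - ehat ℝ i) + x • (fun i => A i 0) + y • (fun i => A i 1) := by
  funext i
  simp only [Matrix.mulVec, dotProduct, Fin.sum_univ_three, Pi.sub_apply, Pi.add_apply,
    Pi.smul_apply, smul_eq_mul, Matrix.cons_val_zero, Matrix.cons_val_one, Matrix.cons_val]
  ring

theorem cosetOfPoint_mem (a : ASL2.pts ℝ) : cosetOfPoint a ∈ UnimodularCosets := by
  set A := (a⁻¹ : ASL2.pts ℝ).1.1 with hA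
  have hrow : A 2 = ehat ℝ := (a⁻¹ : ASL2.pts ℝ).2
  have r0 : A 2 0 = 0 := by rw [hrow]; rfl
  have r1 : A 2 1 = 0 := by rw [hrow]; rfl
  have r2 : A 2 2 = 1 := by rw [hrow]; rfl
  have hdet : A 0 0 * A 1 1 - A 0 1 * A 1 0 = 1 := by
    have hd : A.det = 1 := (a⁻¹ : ASL2.pts ℝ).1.2
    rw [Matrix.det_fin_three, r0, r1, r2] at hd
    linear_combination hd
  refine ⟨fun i => A i 2 - ehat ℝ i, fun i => A i 0, fun i => A i 1, ?_, ?_, ?_, ?_, ?_, ?_⟩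
  · rw [LinearIndependent.pair_iff]
    intro s t h
    have h0 := congrFun h 0
    have h1 := congrFun h 1
    simp only [Pi.add_apply, Pi.smul_apply, smul_eq_mul, Pi.zero_apply] at h0 h1
    constructor
    · linear_combination A 1 1 * h0 - A 0 1 * h1 - s * hdet
    · linear_combination A 0 0 * h1 - A 1 0 * h0 - t * hdet
  · simp [dotProduct, Fin.sum_univ_three, ehat, r2]
  · simp [dotProduct, Fin.sum_univ_three, ehat, r0]
  · simp [dotProduct, Fin.sum_univ_three, ehat, r1]
  · simp only [Matrix.det_fin_two_of, dotProduct, Fin.sum_univ_three, r0, r1]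
    linear_combination (A 0 0 * A 1 1 - A 0 1 * A 1 0 + 1) * hdet
  · ext u
    rw [mem_cosetOfPoint]
    simp only [Set.mem_ofPred_eq, ← hA, mulVec_three]

theorem exists_point {S : Set (Fin 3 → ℝ)} (hS : S ∈ UnimodularCosets) :
    ∃ a : ASL2.pts ℝ, cosetOfPoint a = S := by
  obtain ⟨P, v, w, -, hP, hv, hw, hd, rfl⟩ := hS
  have hP2 : P 2 = 0 := by simpa [dotProduct, Fin.sum_univ_three, ehat] using hP
  have hv2 : v 2 = 0 := by simpa [dotProduct, Fin.sum_univ_three, ehat] using hv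
  have hw2 : w 2 = 0 := by simpa [dotProduct, Fin.sum_univ_three, ehat] using hw
  have main : ∀ w' : Fin 3 → ℝ, w' 2 = 0 → v 0 * w' 1 - w' 0 * v 1 = 1 →
      ∃ a : ASL2.pts ℝ, cosetOfPoint a = {u | ∃ m n : ℤ, u = P + (m : ℝ) • v + (n : ℝ) • w'} := by
    intro w' hw' hdet
    let A : Matrix (Fin 3) (Fin 3) ℝ :=
      Matrix.of fun i => ![v i, w' i, P i + ehat ℝ i]
    have hA : A.det = 1 := by
      rw [Matrix.det_fin_three]
      simp only [A, Matrix.of_apply, Matrix.cons_val_zero, Matrix.cons_val_one, Matrix.cons_val,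
        ehat, hv2, hw', hP2]
      linear_combination hdet
    have hrow : A 2 = ehat ℝ := by
      funext j
      fin_cases j
      · exact hv2
      · exact hw'
      · change P 2 + 1 = 1
        rw [hP2, zero_add]
    let a : ASL2.pts ℝ := ⟨⟨A, hA⟩, hrow⟩
    refine ⟨a⁻¹, ?_⟩
    ext u
    rw [mem_cosetOfPoint, inv_inv]
    simp only [Set.mem_ofPred_eq, mulVec_three]
    have e2 : (fun i => a.1.1 i 2 - ehat ℝ i) = P := by
      funext i
      exact add_sub_cancel_right (P i) (ehat ℝ i)
    rw [e2]
    exact Iff.rfl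
  have hsq : (v 0 * w 1 - w 0 * v 1) ^ 2 = 1 := by
    simp only [Matrix.det_fin_two_of, dotProduct, Fin.sum_univ_three, hv2, hw2] at hd
    linear_combination hd
  have hpm : v 0 * w 1 - w 0 * v 1 = 1 ∨ v 0 * w 1 - w 0 * v 1 = -1 := by
    simpa using hsq
  rcases hpm with h | h
  · exact main w hw2 h
  · obtain ⟨a, ha⟩ := main (-w) (by simp [hw2]) (by
      simp only [Pi.neg_apply]
      linear_combination -h)
    refine ⟨a, ha.trans ?_⟩
    ext u
    constructor
    · rintro ⟨m, n, rfl⟩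
      exact ⟨m, -n, by simp⟩
    · rintro ⟨m, n, rfl⟩
      exact ⟨m, -n, by simp⟩

/-- The bijection from `ASL_2(ℤ)\ASL_2(ℝ)` to the unimodular lattice cosets in `ê^⊥(ℝ)`; it sends
the identity class to `ê^⊥(ℤ)`. -/
def cosetEquiv : ASL2.RealSpace ≃ UnimodularCosets :=
  Equiv.ofBijective
    (Quotient.lift (fun a => (⟨cosetOfPoint a, cosetOfPoint_mem a⟩ : UnimodularCosets))
      fun a b h => Subtype.ext ((cosetOfPoint_eq_iff a b).2 (QuotientGroup.rightRel_apply.1 h)))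
    ⟨by
      intro p q
      refine Quotient.inductionOn₂ p q fun a b h => ?_
      exact Quotient.sound (QuotientGroup.rightRel_apply.2
        ((cosetOfPoint_eq_iff a b).1 (congrArg Subtype.val h))),
    fun S => by
      obtain ⟨a, ha⟩ := exists_point S.2
      exact ⟨Quotient.mk _ a, Subtype.ext ha⟩⟩

/-- The identification `φ` of the unimodular lattice cosets in `ê^⊥(ℝ)` with
`ASL_2(ℤ)\ASL_2(ℝ)`. -/
def phi : UnimodularCosets → ASL2.RealSpace := cosetEquiv.symm

/-! ### Orthogonal grids and the intersection of periodic orbits -/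

/-- The primitive integral points of norm `√D`. -/
def primitivePoints (D : ℕ) : Set (Fin 3 → ℤ) :=
  {y | (∀ d : ℤ, (∀ i, d ∣ y i) → IsUnit d) ∧ y ⬝ᵥ y = D}

/-- The torus `𝐓`: the stabilizer of `x` in `SO_3`. -/
def torus (x : Fin 3 → ℤ) : AlgSubgroup 3 := SO 3 ⊓ stab fun i => (x i : ℚ)

/-- The group `ᶿ𝐇(ℝ)`, the image under the Cartan involution of the stabilizer of `x` in
`SL_3(ℝ)`. -/
def thetaH (x : Fin 3 → ℤ) : Subgroup SL(3, ℝ) :=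
  ((stab fun i => (x i : ℚ)).pts ℝ).map (cartan ℝ)

/-- The space `SL_3(ℤ)\SL_3(ℝ)`. -/
abbrev LatticeSpace : Type :=
  Quotient (QuotientGroup.rightRel
    (SpecialLinearGroup.map (n := Fin 3) (Int.castRingHom ℝ)).range)

/-- The orbit `[S]` in `SL_3(ℤ)\SL_3(ℝ)` of the identity class under a subgroup `S`. -/
def realOrbit (S : Subgroup SL(3, ℝ)) : Set LatticeSpace :=
  (fun h => (Quotient.mk _ h : LatticeSpace)) '' (S : Set SL(3, ℝ))

/-- The rotations `g` with `g x = √D ê`. -/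
def IsRotationToEhat (D : ℕ) (x : Fin 3 → ℤ) (g : SL(3, ℝ)) : Prop :=
  g ∈ (SO 3).pts ℝ ∧ g.1 *ᵥ toReal x = Real.sqrt D • ehat ℝ

/-- The map `C ↦ D^{-1/4} g (C - x/D)` from lattice cosets in `x¹ + x^⊥(ℝ)` to lattice cosets in
`ê^⊥(ℝ)`, for a rotation `g` with `g x = √D ê`. -/
def rescale (D : ℕ) (x : Fin 3 → ℤ) (g : SL(3, ℝ)) (C : Set (Fin 3 → ℝ)) :
    Set (Fin 3 → ℝ) :=
  (fun v => ((D : ℝ) ^ (-(1 / 4) : ℝ)) • v) '' act g (shift (-((D : ℝ)⁻¹ • toReal x)) C)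

/-- The orbit `Grid(y)` of `SO_2(ℝ)`: all the cosets `D^{-1/4} g (y^tors + y^⊥(ℤ))`, where
`y^tors = y¹ - y/D` and `g` is a rotation with `g y = √D ê`. -/
def grid (D : ℕ) (y : Fin 3 → ℤ) : Set (Set (Fin 3 → ℝ)) :=
  {C | ∃ g, IsRotationToEhat D y g ∧ C = rescale D y g (intCoset y)}

/-- The collection `𝒢_D`: the image of the intersection of the orbits of `ᶿ𝐇(ℝ)` and `SO_3(ℝ)`
under the composition of the map `SL_3(ℤ) h ↦ h⁻¹ (x¹ + x^⊥(ℤ))`, for `h` in `ᶿ𝐇(ℝ)`, with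
`rescale`. -/
def gridCollection (D : ℕ) (x : Fin 3 → ℤ) (g : SL(3, ℝ)) : Set (Set (Fin 3 → ℝ)) :=
  {C | ∃ h ∈ thetaH x,
    (Quotient.mk _ h : LatticeSpace) ∈ realOrbit (thetaH x) ∩ realOrbit ((SO 3).pts ℝ) ∧
    C = rescale D x g (act h⁻¹ (intCoset x))}

/-- The torus `Ad(ᶿδ) 𝐓`, for `δ` in `SL_3(ℤ)`. -/
def gridTorus (x : Fin 3 → ℤ) (δ : SL(3, ℤ)) : AlgSubgroup 3 :=
  (torus x).conj (SpecialLinearGroup.map (Int.castRingHom ℚ) (cartan ℤ δ))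

/-- The set `[(Ad(ᶿδ) 𝐓)(𝔸) g]` in `[ASL_2(𝔸)]`, for `g` in `ASL_2(ℝ)`. -/
def gridToralSet (x : Fin 3 → ℤ) (δ : SL(3, ℤ)) (g : ASL2.pts ℝ) : Set ASL2.AdelicSpace :=
  ASL2.adelicOrbit (gridTorus x δ) (ASL2.ofReal g)

/-- The condition `Ad(g⁻¹ ᶿδ) 𝐓(ℝ) = SO_2(ℝ)` on `g` in `ASL_2(ℝ)`. -/
def ConjugatesToKinf (x : Fin 3 → ℤ) (δ : SL(3, ℤ)) (g : ASL2.pts ℝ) : Prop :=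
  ((torus x).pts ℝ).map (MulAut.conj
    ((g : SL(3, ℝ))⁻¹ * SpecialLinearGroup.map (Int.castRingHom ℝ) (cartan ℤ δ))).toMonoidHom = Kinf

end ToralGrids

end

/-!
Write `D = ⟨x, x⟩` and let `T` be the group of rotations about `x`.

**The torus.** Over every `ℚ`-algebra, `T` consists of the matrices of determinant one that fix the
row vector `x` and commute with the cross product by `x` (`mem_axisTorus_iff_commute`), and its
points are parametrised by the conic `a² + D b² = 1` (`exists_rotSL`). Over the algebraic closure
the conic is a multiplicative group, so that `T` is a torus (`axisTorus_isTorus`); since `D > 0` it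
has only constant points over the Laurent polynomials, so that `T` is anisotropic
(`axisTorus_isAnisotropic`). Tori being commutative, the description by commutation shows that the
conjugate of `T` is maximal in `ASL_2` (`axisTorus_isMaximalTorus`). It also exhibits the adelic
orbit as the set of classes of points that carry a fixed matrix to a rational one, and rational
matrices are closed and discrete in the adelic ones: the orbit is closed (`isClosed_adelicOrbit`).
Any two choices of `g_∞` differ by an element of `SO_2(ℝ)`, because this group is its own normalizer
in `ASL_2(ℝ)` (`mem_Kinf_of_normalizes`).

**The grids.** If `δ y = ê` and the rotation `k` sends `y` to `√D ê`, the grid of `y` defined by `k`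
is the lattice coset of the point `ᶿδ k⁻¹ diag(c, c, c⁻²)⁻¹` of `ASL_2(ℝ)`, where `c = D^{-1/4}`
(`cosetOfPoint_gridPoint`). The points of the intersection of the two orbits come from matrices
`γ s` with `γ` integral, `s` a rotation and `s x = ᵗγ x`, which give the grids of the primitive
points `y = ᵗγ x` (`gridCollection_eq`).

**The projection.** It is well defined by strong approximation for `ASL_2`, proved one prime at a
time (`existsUnique_projectsTo`). For an adelic point of the toral set, moved by a rational matrix
to a point with integral finite components, the corresponding Gram matrix is integral, positive
definite and of determinant one. Every such ternary form is a sum of three squares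
(`IsGram.exists_eq_mul_transpose`, by Hermite's reduction), so the real component is the grid point
of some primitive `y` (`exists_integral_mul_rotation`). Conversely, any two primitive points of norm
`√D` are related, for every `p`, by a rational rotation that is integral at `p`
(`exists_rat_rotation`): a half-turn composed with a rotation of the cube. These rotations are the
components of an adelic point of the torus that realizes the grids of `y` (`exists_projectsTo_iff`).

**The invariants.** Two presentations of the toral set with tori in `SL_2` differ by a rational
point of `SL_2` and an adelic point of the torus, because `-1` belongs to `SO_2(ℝ)` and fixes only
the origin (`IsToralPresentation.exists_rat`). So it suffices to compute with one presentation,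
obtained by moving the fixed point of the torus to the origin (`isToralPresentation_centered`). The
fixed point is `w / D` for a primitive integral vector `w` with last coordinate `D`, and its order
modulo `ℤ²` is `D` (`torsionOrder_centered`). The order of the torus consists of the integral
matrices `α + β J S`, where `J` is the rotation by a right angle and `S` the Gram matrix of
`x^⊥(ℤ)`, a primitive form of determinant `D` (`mem_quadOrder_centered`). Its discriminant is `-4D`
or `-D` according as `S` takes odd values or not (`hasOrderDisc_centered`).
-/


noncomputable section

namespace ToralGrids

open AlgSubgroup

/-! ### Cross-product matrices and the rotations about a vector -/

section CrossMatrix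

variable {R : Type} [CommRing R]

/-- The matrix of `u ↦ v × u`. -/
def crossMat (v : Fin 3 → R) : Matrix (Fin 3) (Fin 3) R :=
  !![0, -v 2, v 1; v 2, 0, -v 0; -v 1, v 0, 0]

/-- The cross product is equivariant: `ᵗs (s v × s u) = det s • (v × u)`. -/
theorem transpose_mul_crossMat_mul (s : Matrix (Fin 3) (Fin 3) R) (v : Fin 3 → R) :
    sᵀ * crossMat (s *ᵥ v) * s = s.det • crossMat v := by
  ext i j
  fin_cases i <;> fin_cases j <;>
    simp [crossMat, Matrix.mul_apply, Matrix.mulVec, dotProduct, Fin.sum_univ_three,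
      Matrix.det_fin_three] <;> ring

theorem crossMat_mul_self (v : Fin 3 → R) :
    crossMat v * crossMat v = vecMulVec v v - (v ⬝ᵥ v) • (1 : Matrix (Fin 3) (Fin 3) R) := by
  ext i j
  fin_cases i <;> fin_cases j <;>
    simp [crossMat, Matrix.mul_apply, dotProduct, Fin.sum_univ_three, vecMulVec_apply] <;> ring

theorem crossMat_mulVec_self (v : Fin 3 → R) : crossMat v *ᵥ v = 0 := by
  ext i
  fin_cases i <;> simp [crossMat, Matrix.mulVec, dotProduct, Fin.sum_univ_three] <;> ring

theorem vecMul_crossMat_self (v : Fin 3 → R) : v ᵥ* crossMat v = 0 := by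
  ext i
  fin_cases i <;> simp [crossMat, Matrix.vecMul, dotProduct, Fin.sum_univ_three] <;> ring

theorem crossMat_transpose (v : Fin 3 → R) : (crossMat v)ᵀ = -crossMat v := by
  ext i j
  fin_cases i <;> fin_cases j <;> simp [crossMat]

theorem vecMulVec_mulVec' (u v w : Fin 3 → R) : vecMulVec u v *ᵥ w = (v ⬝ᵥ w) • u := by
  ext i
  simp [vecMulVec_apply, Matrix.mulVec, dotProduct, Fin.sum_univ_three]
  ring

/-- A matrix of determinant one that commutes with `u ↦ v × u` and fixes the row vector `v` is a
rotation about `v`. -/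
theorem orthogonal_of_commute {v : Fin 3 → R} {e : R} (he : e * (v ⬝ᵥ v) = 1)
    {s : Matrix (Fin 3) (Fin 3) R} (hs : s.det = 1) (hv : v ᵥ* s = v)
    (hc : s * crossMat v = crossMat v * s) : sᵀ * s = 1 ∧ s *ᵥ v = v := by
  have cancel : ∀ {M : Type} [AddCommGroup M] [Module R M] {a b : M},
      (v ⬝ᵥ v) • a = (v ⬝ᵥ v) • b → a = b := by
    intro M _ _ a b h
    have := congrArg (fun z => e • z) h
    simpa [smul_smul, he] using this
  have hfix : s *ᵥ v = v := by
    have h1 : crossMat v *ᵥ (s *ᵥ v) = 0 := by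
      rw [Matrix.mulVec_mulVec, ← hc, ← Matrix.mulVec_mulVec, crossMat_mulVec_self,
        Matrix.mulVec_zero]
    have h2 : (crossMat v * crossMat v) *ᵥ (s *ᵥ v) = 0 := by
      rw [← Matrix.mulVec_mulVec, h1, Matrix.mulVec_zero]
    rw [crossMat_mul_self, Matrix.sub_mulVec, vecMulVec_mulVec', Matrix.smul_mulVec,
      Matrix.one_mulVec, Matrix.dotProduct_mulVec, hv, sub_eq_zero] at h2
    exact (cancel h2).symm
  refine ⟨?_, hfix⟩
  have h1 : sᵀ * s * crossMat v = crossMat v := by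
    have := transpose_mul_crossMat_mul s v
    rw [hfix, hs, one_smul, Matrix.mul_assoc, ← hc, ← Matrix.mul_assoc] at this
    exact this
  have hv' : sᵀ *ᵥ v = v := by rw [Matrix.mulVec_transpose, hv]
  have h2 : sᵀ * s * (crossMat v * crossMat v) = crossMat v * crossMat v := by
    rw [← Matrix.mul_assoc, h1]
  have h3 : sᵀ * s * vecMulVec v v = vecMulVec v v := by
    rw [Matrix.mul_vecMulVec, ← Matrix.mulVec_mulVec, hfix, hv']
  rw [crossMat_mul_self, Matrix.mul_sub, h3, Matrix.mul_smul, Matrix.mul_one] at h2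
  exact cancel (sub_right_injective h2)

/-- The converse of `orthogonal_of_commute`, for which `⟨v, v⟩` need not be invertible. -/
theorem commute_of_orthogonal {v : Fin 3 → R} {s : Matrix (Fin 3) (Fin 3) R} (hs : s.det = 1)
    (ho : sᵀ * s = 1) (hv : s *ᵥ v = v) :
    v ᵥ* s = v ∧ s * crossMat v = crossMat v * s := by
  have ho' : s * sᵀ = 1 := mul_eq_one_comm.1 ho
  refine ⟨?_, ?_⟩
  · rw [← Matrix.mulVec_transpose]
    conv_lhs => rw [← hv]
    rw [Matrix.mulVec_mulVec, ho, Matrix.one_mulVec]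
  · have h := transpose_mul_crossMat_mul s v
    rw [hv, hs, one_smul] at h
    calc s * crossMat v = s * (sᵀ * crossMat v * s) := by rw [h]
      _ = s * sᵀ * crossMat v * s := by simp only [Matrix.mul_assoc]
      _ = crossMat v * s := by rw [ho', Matrix.one_mul]

/-- For `e = ⟨v, v⟩⁻¹`, the matrix acting on the plane `v^⊥` as `a + b (v × ·)` and fixing `v`. -/
def rot (v : Fin 3 → R) (e a b : R) : Matrix (Fin 3) (Fin 3) R :=
  a • 1 + b • crossMat v + (e * (1 - a)) • vecMulVec v v

theorem rot_mul {v : Fin 3 → R} {e : R} (he : e * (v ⬝ᵥ v) = 1) (a b a' b' : R) :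
    rot v e a b * rot v e a' b' =
      rot v e (a * a' - (v ⬝ᵥ v) * b * b') (a * b' + b * a') := by
  have h1 : crossMat v * vecMulVec v v = 0 := by
    rw [Matrix.mul_vecMulVec, crossMat_mulVec_self, Matrix.zero_vecMulVec]
  have h2 : vecMulVec v v * crossMat v = 0 := by
    rw [Matrix.vecMulVec_mul, vecMul_crossMat_self, Matrix.vecMulVec_zero]
  have h3 : vecMulVec v v * vecMulVec v v = (v ⬝ᵥ v) • vecMulVec v v := by
    rw [Matrix.vecMulVec_mul_vecMulVec]
    ext i j
    simp [vecMulVec_apply]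
    ring
  simp only [rot, Matrix.add_mul, Matrix.mul_add, Matrix.smul_mul, Matrix.mul_smul, h1, h2, h3,
    crossMat_mul_self, Matrix.one_mul, Matrix.mul_one]
  ext i j
  simp only [Matrix.add_apply, Matrix.smul_apply, Matrix.sub_apply, smul_eq_mul,
    Matrix.zero_apply]
  linear_combination (e * (1 - a) * (1 - a') * vecMulVec v v i j
    - b * b' * vecMulVec v v i j) * he

theorem rot_det {v : Fin 3 → R} {e : R} (he : e * (v ⬝ᵥ v) = 1) (a b : R) :
    (rot v e a b).det = a ^ 2 + (v ⬝ᵥ v) * b ^ 2 := by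
  simp only [rot, crossMat, Matrix.det_fin_three, dotProduct, Fin.sum_univ_three] at he ⊢
  simp [vecMulVec_apply]
  linear_combination (1 - a) * (a ^ 2 + (v 0 * v 0 + v 1 * v 1 + v 2 * v 2) * b ^ 2) * he

theorem vecMul_rot {v : Fin 3 → R} {e : R} (he : e * (v ⬝ᵥ v) = 1) (a b : R) :
    v ᵥ* rot v e a b = v := by
  have h : v ᵥ* vecMulVec v v = (v ⬝ᵥ v) • v := by
    ext i
    simp [vecMulVec_apply, Matrix.vecMul, dotProduct, Fin.sum_univ_three]
    ring
  simp only [rot, Matrix.vecMul_add, Matrix.vecMul_smul, Matrix.vecMul_one, vecMul_crossMat_self,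
    h]
  ext i
  simp only [Pi.add_apply, Pi.smul_apply, smul_eq_mul, Pi.zero_apply]
  linear_combination (1 - a) * v i * he

theorem rot_commute (v : Fin 3 → R) (e a b : R) :
    rot v e a b * crossMat v = crossMat v * rot v e a b := by
  have h1 : crossMat v * vecMulVec v v = 0 := by
    rw [Matrix.mul_vecMulVec, crossMat_mulVec_self, Matrix.zero_vecMulVec]
  have h2 : vecMulVec v v * crossMat v = 0 := by
    rw [Matrix.vecMulVec_mul, vecMul_crossMat_self, Matrix.vecMulVec_zero]
  simp only [rot, Matrix.add_mul, Matrix.mul_add, Matrix.smul_mul, Matrix.mul_smul, h1, h2,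
    Matrix.one_mul, Matrix.mul_one]

theorem rot_transpose (v : Fin 3 → R) (e a b : R) : (rot v e a b)ᵀ = rot v e a (-b) := by
  have h : (vecMulVec v v)ᵀ = vecMulVec v v := by
    ext i j
    simp [vecMulVec_apply, mul_comm]
  simp [rot, crossMat_transpose, h]

/-- The parameters of a rotation are read off from its trace and its skew part. -/
theorem rot_trace {v : Fin 3 → R} {e : R} (he : e * (v ⬝ᵥ v) = 1) (a b : R) :
    (rot v e a b).trace = 2 * a + 1 ∧
      (rot v e a b * crossMat v).trace = -2 * (v ⬝ᵥ v) * b := by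
  constructor
  · simp only [rot, crossMat, Matrix.trace, Matrix.diag, dotProduct, Fin.sum_univ_three] at he ⊢
    simp [vecMulVec_apply]
    linear_combination (1 - a) * he
  · simp only [rot, crossMat, Matrix.trace, Matrix.diag, dotProduct, Fin.sum_univ_three,
      Matrix.mul_apply]
    simp [vecMulVec_apply]
    ring

/-- Every rotation about `v` is of the form `rot`: its skew part is a multiple of the cross-product
matrix, and so is the product of its symmetric part with that matrix. -/
theorem exists_rot {v : Fin 3 → R} {e h : R} (he : e * (v ⬝ᵥ v) = 1) (h2 : h * 2 = 1)
    {s : Matrix (Fin 3) (Fin 3) R} (hs : s.det = 1) (ho : sᵀ * s = 1) (hv : s *ᵥ v = v) :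
    ∃ a b, a ^ 2 + (v ⬝ᵥ v) * b ^ 2 = 1 ∧ s = rot v e a b := by
  -- a skew-symmetric matrix that kills `v` is a multiple of the cross product by `v`
  have skew : ∀ A : Matrix (Fin 3) (Fin 3) R, Aᵀ = -A → A *ᵥ v = 0 →
      ∃ b : R, A = b • crossMat v := by
    intro A hA hAv
    have two : ∀ z : R, z = -z → z = 0 := fun z hz => by linear_combination h * hz - z * h2
    have d : ∀ i j, A j i = -A i j := fun i j => congrFun (congrFun hA i) j
    have d0 := two _ (d 0 0)
    have d1 := two _ (d 1 1)
    have d2 := two _ (d 2 2)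
    have e0 := congrFun hAv 0
    have e1 := congrFun hAv 1
    have e2 := congrFun hAv 2
    simp only [Matrix.mulVec, dotProduct, Fin.sum_univ_three, Pi.zero_apply] at e0 e1 e2 he
    rw [d0, d 1 0] at e0
    rw [d1, d 2 1] at e1
    rw [d2, d 0 2] at e2
    have w0 : A 2 1 = e * (A 2 1 * v 0 + A 0 2 * v 1 + A 1 0 * v 2) * v 0 := by
      linear_combination -A 2 1 * he + e * (v 1 * e2 - v 2 * e1)
    have w1 : A 0 2 = e * (A 2 1 * v 0 + A 0 2 * v 1 + A 1 0 * v 2) * v 1 := by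
      linear_combination -A 0 2 * he + e * (v 2 * e0 - v 0 * e2)
    have w2 : A 1 0 = e * (A 2 1 * v 0 + A 0 2 * v 1 + A 1 0 * v 2) * v 2 := by
      linear_combination -A 1 0 * he + e * (v 0 * e1 - v 1 * e0)
    refine ⟨e * (A 2 1 * v 0 + A 0 2 * v 1 + A 1 0 * v 2), ?_⟩
    ext i j
    fin_cases i <;> fin_cases j <;>
      simp only [crossMat, Matrix.smul_apply, smul_eq_mul, Matrix.of_apply, Matrix.cons_val_zero,
        Matrix.cons_val_one, Matrix.cons_val, mul_zero, Fin.zero_eta, Fin.mk_one,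
        Fin.reduceFinMk, d0, d1, d2, d 1 0, d 2 1, d 0 2, mul_neg, neg_inj]
    all_goals first | exact w0 | exact w1 | exact w2
  obtain ⟨hv', hc⟩ := commute_of_orthogonal hs ho hv
  have hvt : sᵀ *ᵥ v = v := by rw [Matrix.mulVec_transpose, hv']
  have hct : sᵀ * crossMat v = crossMat v * sᵀ := by
    have := congrArg Matrix.transpose hc
    simp only [Matrix.transpose_mul, crossMat_transpose, Matrix.neg_mul, Matrix.mul_neg,
      neg_inj] at this
    exact this.symm
  obtain ⟨b, hb⟩ := skew (s - sᵀ) (by simp) (by rw [Matrix.sub_mulVec, hv, hvt, sub_self])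
  obtain ⟨a, ha⟩ := skew ((s + sᵀ) * crossMat v)
    (by
      rw [Matrix.transpose_mul, crossMat_transpose, Matrix.transpose_add,
        Matrix.transpose_transpose, Matrix.neg_mul, Matrix.mul_add, Matrix.add_mul, hc, hct,
        add_comm])
    (by rw [← Matrix.mulVec_mulVec, crossMat_mulVec_self, Matrix.mulVec_zero])
  -- multiplying the second relation by `v ×` recovers the symmetric part on `v^⊥`
  have hS : s + sᵀ = a • 1 + (e * (2 - a)) • vecMulVec v v := by
    have h3 := congrArg (· * crossMat v) ha
    have h4 : (s + sᵀ) * vecMulVec v v = (2 : R) • vecMulVec v v := by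
      rw [Matrix.add_mul, Matrix.mul_vecMulVec, Matrix.mul_vecMulVec, hv, hvt, two_smul]
    simp only [Matrix.mul_assoc, Matrix.smul_mul, crossMat_mul_self, Matrix.mul_sub, h4,
      Matrix.mul_smul, Matrix.mul_one] at h3
    ext i j
    have h5 := congrFun (congrFun h3 i) j
    simp only [Matrix.sub_apply, Matrix.add_apply, Matrix.smul_apply, smul_eq_mul] at h5 ⊢
    linear_combination -e * h5 - (s i j + sᵀ i j - a * (1 : Matrix (Fin 3) (Fin 3) R) i j) * he
  have key : s = rot v e (h * a) (h * b) := by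
    ext i j
    have h5 := congrFun (congrFun hS i) j
    have h6 := congrFun (congrFun hb i) j
    simp only [Matrix.sub_apply, Matrix.add_apply, Matrix.smul_apply, smul_eq_mul, rot] at h5 h6 ⊢
    linear_combination h * h5 + h * h6 + (e * vecMulVec v v i j - s i j) * h2
  refine ⟨h * a, h * b, ?_, key⟩
  rw [← rot_det he, ← key, hs]

end CrossMatrix

/-! ### Points of closed subgroups under base change and conjugation -/

section BaseChange

variable {n : ℕ}

/-- A rational vector over a `ℚ`-algebra. -/
def baseVec (R : Type) [CommRing R] [Algebra ℚ R] (v : Fin n → ℚ) : Fin n → R :=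
  fun i => algebraMap ℚ R (v i)

/-- A rational matrix over a `ℚ`-algebra. -/
abbrev baseSL (R : Type) [CommRing R] [Algebra ℚ R] : SL(n, ℚ) →* SL(n, R) :=
  SpecialLinearGroup.map (algebraMap ℚ R)

theorem map_algebraMap_rat {R S : Type} [CommRing R] [Algebra ℚ R] [CommRing S] [Algebra ℚ S]
    (f : R →+* S) (q : ℚ) : f (algebraMap ℚ R q) = algebraMap ℚ S q :=
  RingHom.congr_fun (Subsingleton.elim (f.comp (algebraMap ℚ R)) (algebraMap ℚ S)) q

theorem map_baseVec {R S : Type} [CommRing R] [Algebra ℚ R] [CommRing S] [Algebra ℚ S]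
    (f : R →+* S) (v : Fin n → ℚ) : f ∘ baseVec R v = baseVec S v :=
  funext fun i => map_algebraMap_rat f (v i)

theorem map_baseSL {R S : Type} [CommRing R] [Algebra ℚ R] [CommRing S] [Algebra ℚ S]
    (f : R →+* S) (q : SL(n, ℚ)) :
    SpecialLinearGroup.map f (baseSL R q) = baseSL S q :=
  Subtype.ext (Matrix.ext fun i j => map_algebraMap_rat f (q.1 i j))

theorem aeval_map {R S : Type} [CommRing R] [Algebra ℚ R] [CommRing S] [Algebra ℚ S]
    (f : R →+* S) (g : SL(n, R)) (P : MvPolynomial (Fin n × Fin n) ℚ) :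
    MvPolynomial.aeval
        (fun ij : Fin n × Fin n => (SpecialLinearGroup.map f g).1 ij.1 ij.2) P =
      f (MvPolynomial.aeval (fun ij : Fin n × Fin n => g.1 ij.1 ij.2) P) := by
  have := MvPolynomial.comp_aeval (fun ij : Fin n × Fin n => g.1 ij.1 ij.2) f.toRatAlgHom
  exact (DFunLike.congr_fun this P).symm

theorem map_mem_pts (M : AlgSubgroup n) {R S : Type} [CommRing R] [Algebra ℚ R] [CommRing S]
    [Algebra ℚ S] (f : R →+* S) {g : SL(n, R)} (hg : g ∈ M.pts R) :
    SpecialLinearGroup.map f g ∈ M.pts S := by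
  obtain ⟨F, hF⟩ := M.closed
  rw [hF] at hg ⊢
  intro P hP
  rw [aeval_map, hg P hP, map_zero]

theorem mem_pts_of_map (M : AlgSubgroup n) {R S : Type} [CommRing R] [Algebra ℚ R] [CommRing S]
    [Algebra ℚ S] (f : R →+* S) (hf : Function.Injective f) {g : SL(n, R)}
    (hg : SpecialLinearGroup.map f g ∈ M.pts S) : g ∈ M.pts R := by
  obtain ⟨F, hF⟩ := M.closed
  rw [hF] at hg ⊢
  intro P hP
  have := hg P hP
  rw [aeval_map] at this
  exact hf (this.trans (map_zero f).symm)

theorem map_injective_SL {R S : Type} [CommRing R] [CommRing S] (f : R →+* S)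
    (hf : Function.Injective f) :
    Function.Injective (SpecialLinearGroup.map (n := Fin n) f) := fun _ _ h =>
  Subtype.ext (Matrix.ext fun i j => hf (congrFun (congrFun (congrArg Subtype.val h) i) j))

theorem mem_conj {M : AlgSubgroup n} {q : SL(n, ℚ)} {R : Type} [CommRing R] [Algebra ℚ R]
    {g : SL(n, R)} : g ∈ (M.conj q).pts R ↔ (baseSL R q)⁻¹ * g * baseSL R q ∈ M.pts R := by
  constructor
  · rintro ⟨m, hm, rfl⟩
    have : (baseSL R q)⁻¹ * (MulAut.conj (baseSL R q)).toMonoidHom m * baseSL R q = m := by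
      simp [MulAut.conj_apply, mul_assoc]
    rwa [this]
  · intro h
    exact ⟨_, h, by simp [MulAut.conj_apply, mul_assoc]⟩

/-- The points of a torus over any `ℚ`-algebra `R` commute, since they embed in the points over
the tensor product of `R` with the algebraic closure of `ℚ`. -/
theorem AlgSubgroup.IsTorus.mul_comm_of_mem {T : AlgSubgroup n} (hT : T.IsTorus) {R : Type}
    [CommRing R] [Algebra ℚ R] {a b : SL(n, R)} (ha : a ∈ T.pts R) (hb : b ∈ T.pts R) :
    a * b = b * a := by
  obtain ⟨r, e, -⟩ := hT
  let K := AlgebraicClosure ℚ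
  let f : R →+* TensorProduct ℚ K R :=
    (Algebra.TensorProduct.includeRight : R →ₐ[ℚ] TensorProduct ℚ K R).toRingHom
  have hf : Function.Injective f :=
    Algebra.TensorProduct.includeRight_injective (algebraMap ℚ K).injective
  apply map_injective_SL f hf
  have h : ∀ u w : T.pts (TensorProduct ℚ K R), u * w = w * u := fun u w => by
    rw [← (e _).apply_symm_apply u, ← (e _).apply_symm_apply w, ← map_mul, mul_comm, map_mul]
  rw [map_mul, map_mul]
  exact congrArg Subtype.val (h ⟨_, map_mem_pts T f ha⟩ ⟨_, map_mem_pts T f hb⟩)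

theorem AlgSubgroup.IsTorus.conj {T : AlgSubgroup n} (hT : T.IsTorus) (q : SL(n, ℚ)) :
    (T.conj q).IsTorus := by
  obtain ⟨r, e, he⟩ := hT
  refine ⟨r, fun R _ _ _ => (e R).trans
    ((T.pts R).equivMapOfInjective _ (MulAut.conj (baseSL R q)).injective), ?_⟩
  intro R S _ _ _ _ _ _ f u
  change baseSL S q * (e S _ : SL(n, S)) * (baseSL S q)⁻¹ =
    SpecialLinearGroup.map (f : R →+* S) (baseSL R q * (e R u : SL(n, R)) * (baseSL R q)⁻¹)
  rw [he, map_mul, map_mul, map_inv, map_baseSL]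

theorem AlgSubgroup.IsAnisotropic.conj {T : AlgSubgroup n} (hT : T.IsAnisotropic) (q : SL(n, ℚ)) :
    (T.conj q).IsAnisotropic := by
  intro c hc R _ _ u
  let E : ∀ (R : Type) [CommRing R] [Algebra ℚ R], T.pts R ≃* (T.conj q).pts R := fun R _ _ =>
    (T.pts R).equivMapOfInjective _ (MulAut.conj (baseSL R q)).injective
  have hE : ∀ (R : Type) [CommRing R] [Algebra ℚ R] (z : (T.conj q).pts R),
      ((E R).symm z : SL(n, R)) = (baseSL R q)⁻¹ * z * baseSL R q := by
    intro R _ _ z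
    obtain ⟨w, rfl⟩ := (E R).surjective z
    rw [MulEquiv.symm_apply_apply]
    change _ = (baseSL R q)⁻¹ * (baseSL R q * w * (baseSL R q)⁻¹) * baseSL R q
    group
  have h := hT (fun R _ _ => (E R).symm.toMonoidHom.comp (c R)) (by
    intro R S _ _ _ _ f u
    change ((E S).symm _ : SL(n, S)) = SpecialLinearGroup.map _ ((E R).symm _ : SL(n, R))
    rw [hE, hE, hc, map_mul, map_mul, map_inv, map_baseSL]) R u
  exact (E R).symm.injective (h.trans (map_one _).symm)

end BaseChange

/-! ### The torus of rotations about a rational vector -/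

/-- The stabilizer in `SO_3` of a rational vector. -/
def axisTorus (v : Fin 3 → ℚ) : AlgSubgroup 3 := SO 3 ⊓ stab v

theorem torus_eq_axisTorus (x : Fin 3 → ℤ) : torus x = axisTorus fun i => (x i : ℚ) := rfl

section AxisTorus

variable {v : Fin 3 → ℚ} {R : Type} [CommRing R] [Algebra ℚ R]

theorem mem_axisTorus {g : SL(3, R)} :
    g ∈ (axisTorus v).pts R ↔ g.1ᵀ * g.1 = 1 ∧ g.1 *ᵥ baseVec R v = baseVec R v := Iff.rfl

theorem baseVec_dotProduct (u w : Fin 3 → ℚ) :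
    baseVec R u ⬝ᵥ baseVec R w = algebraMap ℚ R (u ⬝ᵥ w) := by
  simp [baseVec, dotProduct, Fin.sum_univ_three]

theorem inv_norm_mul (hv : v ⬝ᵥ v ≠ 0) :
    algebraMap ℚ R (v ⬝ᵥ v)⁻¹ * (baseVec R v ⬝ᵥ baseVec R v) = 1 := by
  rw [baseVec_dotProduct, ← map_mul, inv_mul_cancel₀ hv, map_one]

theorem half_mul_two : algebraMap ℚ R (1 / 2) * 2 = 1 := by
  have : (2 : R) = algebraMap ℚ R 2 := (map_ofNat _ 2).symm
  rw [this, ← map_mul]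
  norm_num

/-- Among the matrices of determinant one, the rotations about `v` are those that commute with
the cross product by `v` and fix the row vector `v`. -/
theorem mem_axisTorus_iff_commute (hv : v ⬝ᵥ v ≠ 0) {g : SL(3, R)} :
    g ∈ (axisTorus v).pts R ↔ baseVec R v ᵥ* g.1 = baseVec R v ∧
      g.1 * crossMat (baseVec R v) = crossMat (baseVec R v) * g.1 := by
  rw [mem_axisTorus]
  exact ⟨fun h => commute_of_orthogonal g.2 h.1 h.2,
    fun h => orthogonal_of_commute (inv_norm_mul hv) g.2 h.1 h.2⟩

/-- The rotation about `v` with parameters `a` and `b`. -/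
def rotSL (hv : v ⬝ᵥ v ≠ 0) (a b : R) (h : a ^ 2 + algebraMap ℚ R (v ⬝ᵥ v) * b ^ 2 = 1) :
    SL(3, R) :=
  ⟨rot (baseVec R v) (algebraMap ℚ R (v ⬝ᵥ v)⁻¹) a b, by
    rw [rot_det (inv_norm_mul hv), baseVec_dotProduct, h]⟩

theorem rotSL_mem (hv : v ⬝ᵥ v ≠ 0) (a b : R)
    (h : a ^ 2 + algebraMap ℚ R (v ⬝ᵥ v) * b ^ 2 = 1) :
    rotSL hv a b h ∈ (axisTorus v).pts R :=
  (mem_axisTorus_iff_commute hv).2 ⟨vecMul_rot (inv_norm_mul hv) a b, rot_commute _ _ a b⟩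

theorem exists_rotSL (hv : v ⬝ᵥ v ≠ 0) {g : SL(3, R)} (hg : g ∈ (axisTorus v).pts R) :
    ∃ a b h, g = rotSL hv a b h := by
  obtain ⟨a, b, h, e⟩ := exists_rot (inv_norm_mul hv) half_mul_two g.2 hg.1 hg.2
  rw [baseVec_dotProduct] at h
  exact ⟨a, b, h, Subtype.ext e⟩

theorem rot_params_ext (hv : v ⬝ᵥ v ≠ 0) {a b a' b' : R}
    (h : rot (baseVec R v) (algebraMap ℚ R (v ⬝ᵥ v)⁻¹) a b =
      rot (baseVec R v) (algebraMap ℚ R (v ⬝ᵥ v)⁻¹) a' b') : a = a' ∧ b = b' := by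
  obtain ⟨h1, h2⟩ := rot_trace (inv_norm_mul (R := R) hv) a b
  obtain ⟨h3, h4⟩ := rot_trace (inv_norm_mul (R := R) hv) a' b'
  rw [← h] at h3 h4
  have e := inv_norm_mul (R := R) hv
  have t := half_mul_two (R := R)
  constructor
  · linear_combination algebraMap ℚ R (1 / 2) * (h3 - h1) - (a - a') * t
  · linear_combination
      algebraMap ℚ R (1 / 2) * algebraMap ℚ R (v ⬝ᵥ v)⁻¹ * (h2 - h4) - (b - b') * t +
        (- (b - b') * algebraMap ℚ R (1 / 2) * 2) * e

end AxisTorus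

theorem map_rot {R S : Type} [CommRing R] [CommRing S] (f : R →+* S) (w : Fin 3 → R) (e a b : R) :
    f.mapMatrix (rot w e a b) = rot (f ∘ w) (f e) (f a) (f b) := by
  ext i j
  fin_cases i <;> fin_cases j <;> simp [rot, crossMat, vecMulVec_apply]

/-- Over `ℚ(√-D)`, with `D = ⟨v, v⟩`, the eigenvalue of a rotation about `v` on an isotropic line
of `v^⊥` is an isomorphism to the multiplicative group. -/
theorem axisTorus_isTorus {v : Fin 3 → ℚ} (hv : v ⬝ᵥ v ≠ 0) : (axisTorus v).IsTorus := by
  -- the unit `u` goes to the rotation with `a = (u + u⁻¹) / 2` and `b = j (u - u⁻¹) / 2`, whose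
  -- eigenvalues on `v^⊥` are `u` and `u⁻¹`, because `D j² = -1`
  obtain ⟨j, hj⟩ : ∃ j : AlgebraicClosure ℚ,
      algebraMap ℚ (AlgebraicClosure ℚ) (v ⬝ᵥ v) * j ^ 2 = -1 := by
    obtain ⟨j, hj⟩ := IsAlgClosed.exists_pow_nat_eq
      (-algebraMap ℚ (AlgebraicClosure ℚ) (v ⬝ᵥ v)⁻¹) (n := 2) two_pos
    refine ⟨j, ?_⟩
    rw [hj, mul_neg, ← map_mul, mul_inv_cancel₀ hv, map_one]
  have hjR : ∀ (R : Type) [CommRing R] [Algebra ℚ R] [Algebra (AlgebraicClosure ℚ) R],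
      algebraMap ℚ R (v ⬝ᵥ v) * algebraMap (AlgebraicClosure ℚ) R j ^ 2 = -1 := by
    intro R _ _ _
    rw [← map_algebraMap_rat (algebraMap (AlgebraicClosure ℚ) R), ← map_pow, ← map_mul, hj,
      map_neg, map_one]
  have hpar : ∀ (R : Type) [CommRing R] [Algebra ℚ R] [Algebra (AlgebraicClosure ℚ) R] (u : Rˣ),
      (algebraMap ℚ R (1 / 2) * (u + (u⁻¹ : Rˣ))) ^ 2 + algebraMap ℚ R (v ⬝ᵥ v) *
        (algebraMap ℚ R (1 / 2) * algebraMap (AlgebraicClosure ℚ) R j *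
          (u - (u⁻¹ : Rˣ))) ^ 2 = 1 := by
    intro R _ _ _ u
    have h1 := hjR R
    have h2 := half_mul_two (R := R)
    have h3 := u.mul_inv
    set h := algebraMap ℚ R (1 / 2)
    linear_combination (h * (u - (u⁻¹ : Rˣ))) ^ 2 * h1 + 4 * h ^ 2 * h3 + (2 * h + 1) * h2
  let φ : ∀ (R : Type) [CommRing R] [Algebra ℚ R] [Algebra (AlgebraicClosure ℚ) R],
      (Fin 1 → Rˣ) →* (axisTorus v).pts R := fun R _ _ _ =>
    MonoidHom.mk' (fun u => ⟨rotSL hv _ _ (hpar R (u 0)), rotSL_mem hv _ _ _⟩) (by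
      intro u w
      refine Subtype.ext (Subtype.ext ?_)
      change rot _ _ _ _ = rot _ _ _ _ * rot _ _ _ _
      rw [rot_mul (inv_norm_mul hv), baseVec_dotProduct]
      have h1 := hjR R
      have h2 := half_mul_two (R := R)
      rw [Pi.mul_apply, _root_.mul_inv_rev, Units.val_mul, Units.val_mul]
      set h := algebraMap ℚ R (1 / 2)
      set J := algebraMap (AlgebraicClosure ℚ) R j
      congr 1
      · linear_combination
          (-h * (u 0 * w 0 + ((u 0)⁻¹ : Rˣ) * ((w 0)⁻¹ : Rˣ) : R)) * h2 +
          (h ^ 2 * (u 0 - ((u 0)⁻¹ : Rˣ)) * (w 0 - ((w 0)⁻¹ : Rˣ))) * h1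
      · linear_combination
          (-h * J * (u 0 * w 0 - ((u 0)⁻¹ : Rˣ) * ((w 0)⁻¹ : Rˣ) : R)) * h2)
  have hφ : ∀ (R : Type) [CommRing R] [Algebra ℚ R] [Algebra (AlgebraicClosure ℚ) R],
      Function.Bijective (φ R) := by
    intro R _ _ _
    have h1 := hjR R
    have h2 := half_mul_two (R := R)
    set h := algebraMap ℚ R (1 / 2) with hh
    set J := algebraMap (AlgebraicClosure ℚ) R j with hJ
    constructor
    · intro u w huw
      obtain ⟨e1, e2⟩ := rot_params_ext hv (congrArg Subtype.val (congrArg Subtype.val huw))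
      funext i
      rw [Subsingleton.elim i 0]
      refine Units.ext ?_
      rw [← hh] at e1 e2
      rw [← hJ] at e2
      linear_combination e1 - algebraMap ℚ R (v ⬝ᵥ v) * J * e2 +
        (h * (u 0 - ((u 0)⁻¹ : Rˣ)) - h * (w 0 - ((w 0)⁻¹ : Rˣ))) * h1 - (u 0 - w 0 : R) * h2
    · rintro ⟨g, hg⟩
      obtain ⟨a, b, hab, rfl⟩ := exists_rotSL hv hg
      let d := algebraMap ℚ R (v ⬝ᵥ v)
      -- the eigenvalue is recovered as `u = a - D j b`
      have p1 : (a - d * J * b) * (a + d * J * b) = 1 := by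
        linear_combination hab - d * b ^ 2 * h1
      let u : Rˣ := ⟨a - d * J * b, a + d * J * b, p1, by rw [mul_comm, p1]⟩
      refine ⟨fun _ => u, Subtype.ext (Subtype.ext ?_)⟩
      change rot _ _ (h * ((a - d * J * b) + (a + d * J * b)))
        (h * J * ((a - d * J * b) - (a + d * J * b))) = rot _ _ a b
      congr 1
      · linear_combination a * h2
      · linear_combination b * h2 - 2 * h * b * h1
  refine ⟨1, fun R _ _ _ => MulEquiv.ofBijective (φ R) (hφ R), ?_⟩
  intro R S _ _ _ _ _ _ f u
  refine Subtype.ext ?_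
  change rot _ _ _ _ = (f : R →+* S).mapMatrix (rot _ _ _ _)
  rw [map_rot, map_baseVec, map_algebraMap_rat]
  simp only [map_mul, map_add, map_sub, map_algebraMap_rat]
  have : (f : R →+* S) (algebraMap (AlgebraicClosure ℚ) R j) =
    algebraMap (AlgebraicClosure ℚ) S j := f.commutes j
  rw [this]
  rfl

/-- The torus of rotations about `v` has a rational point of angle different from `0` and `π`, hence
a point with the same centralizer as the cross product by `v`. -/
theorem exists_generic_rotation {v : Fin 3 → ℚ} (hv : v ⬝ᵥ v ≠ 0) :
    ∃ a b : ℚ, a ^ 2 + (v ⬝ᵥ v) * b ^ 2 = 1 ∧ b ≠ 0 := by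
  have hpos : 0 < v ⬝ᵥ v := lt_of_le_of_ne (by
    simp only [dotProduct, Fin.sum_univ_three]
    nlinarith [mul_self_nonneg (v 0), mul_self_nonneg (v 1), mul_self_nonneg (v 2)]) hv.symm
  -- the rational parametrisation of the conic `a² + D b² = 1` from `(-1, 0)`, at slope one
  refine ⟨(1 - v ⬝ᵥ v) / (1 + v ⬝ᵥ v), 2 / (1 + v ⬝ᵥ v), ?_, by positivity⟩
  field_simp
  ring

/-- A matrix that commutes with a rotation about `w`, of angle different from `0` and `π`, and
with its inverse commutes with their difference, a multiple of the cross product by `w`. -/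
theorem commute_crossMat_of_commute_rot {R : Type} [CommRing R] {w : Fin 3 → R} {e a b b' h : R}
    (hb : b' * b = 1) (h2 : h * 2 = 1) {s : Matrix (Fin 3) (Fin 3) R}
    (h1 : s * rot w e a b = rot w e a b * s) (h1' : s * rot w e a (-b) = rot w e a (-b) * s) :
    s * crossMat w = crossMat w * s := by
  have e1 : crossMat w = (h * b') • (rot w e a b - rot w e a (-b)) := by
    ext i j
    simp only [rot, Matrix.sub_apply, Matrix.add_apply, Matrix.smul_apply, smul_eq_mul]
    linear_combination (-crossMat w i j) * h2 - 2 * h * crossMat w i j * hb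
  rw [e1, Matrix.mul_smul, Matrix.smul_mul, Matrix.mul_sub, Matrix.sub_mul, h1, h1']

theorem ehat_vecMul {R : Type} [CommRing R] (A : Matrix (Fin 3) (Fin 3) R) :
    ehat R ᵥ* A = A 2 := by
  ext j
  simp [ehat, Matrix.vecMul, dotProduct, Fin.sum_univ_three]

theorem mem_ASL2 {R : Type} [CommRing R] [Algebra ℚ R] {g : SL(3, R)} :
    g ∈ ASL2.pts R ↔ ehat R ᵥ* g.1 = ehat R := by
  rw [ehat_vecMul]
  exact Iff.rfl

theorem ehat_vecMul_baseSL {v : Fin 3 → ℚ} {q : SL(3, ℚ)} (hq : q.1 2 = v) (R : Type)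
    [CommRing R] [Algebra ℚ R] : ehat R ᵥ* (baseSL R q).1 = baseVec R v := by
  rw [ehat_vecMul, ← hq]
  rfl

/-- If the last row of `q` is `v`, then `g` fixes the row vector `ê` exactly when `q⁻¹ g q` fixes
the row vector `v`. -/
theorem ehat_vecMul_mul_iff {v : Fin 3 → ℚ} {q : SL(3, ℚ)} (hq : q.1 2 = v) {R : Type}
    [CommRing R] [Algebra ℚ R] (g : SL(3, R)) : g ∈ ASL2.pts R ↔
      baseVec R v ᵥ* ((baseSL R q)⁻¹ * g * baseSL R q).1 = baseVec R v := by
  have h1 : (baseSL R q).1 * (baseSL R q)⁻¹.1 = 1 :=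
    congrArg Subtype.val (mul_inv_cancel (baseSL R q))
  have h2 : baseVec R v ᵥ* ((baseSL R q)⁻¹ * g * baseSL R q).1 =
      (ehat R ᵥ* g.1) ᵥ* (baseSL R q).1 := by
    change baseVec R v ᵥ* ((baseSL R q)⁻¹.1 * g.1 * (baseSL R q).1) = _
    rw [← ehat_vecMul_baseSL hq R, Matrix.vecMul_vecMul, Matrix.vecMul_vecMul, Matrix.mul_assoc,
      ← Matrix.mul_assoc, h1, Matrix.one_mul]
  rw [h2, ← ehat_vecMul_baseSL hq R, mem_ASL2]
  refine ⟨fun h => by rw [h], fun h => ?_⟩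
  have := congrArg (· ᵥ* (baseSL R q)⁻¹.1) h
  simpa only [Matrix.vecMul_vecMul, Matrix.mul_assoc, h1, Matrix.mul_one, Matrix.vecMul_one]
    using this

/-- If the last row of `q` is `v`, then `q` conjugates the rotations about `v` into `ASL_2`. -/
theorem axisTorus_conj_le {v : Fin 3 → ℚ} (hv : v ⬝ᵥ v ≠ 0) {q : SL(3, ℚ)} (hq : q.1 2 = v) :
    (axisTorus v).conj q ≤ ASL2 := fun _ _ _ _ hg =>
  (ehat_vecMul_mul_iff hq _).2 ((mem_axisTorus_iff_commute hv).1 (mem_conj.1 hg)).1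

/-- A torus of `ASL_2` that contains the rotations about `v` centralizes a generic one, hence
consists of rotations about `v`. -/
theorem axisTorus_isMaximalTorus {v : Fin 3 → ℚ} (hv : v ⬝ᵥ v ≠ 0) {q : SL(3, ℚ)}
    (hq : q.1 2 = v) : IsMaximalTorus ASL2 ((axisTorus v).conj q) := by
  refine ⟨axisTorus_conj_le hv hq, (axisTorus_isTorus hv).conj q, ?_⟩
  intro S hS hST hTS R _ _ s hs
  rw [mem_conj, mem_axisTorus_iff_commute hv]
  refine ⟨(ehat_vecMul_mul_iff hq _).1 (hS R hs), ?_⟩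
  obtain ⟨a, b, hab, hb⟩ := exists_generic_rotation hv
  have habR : ∀ b' : ℚ, b' = b ∨ b' = -b → algebraMap ℚ R a ^ 2 +
      algebraMap ℚ R (v ⬝ᵥ v) * algebraMap ℚ R b' ^ 2 = 1 := by
    rintro b' (rfl | rfl)
    · rw [← map_pow, ← map_pow, ← map_mul, ← map_add, hab, map_one]
    · rw [← map_pow, ← map_pow, ← map_mul, ← map_add, neg_sq, hab, map_one]
  have hcomm : ∀ t : SL(3, R), t ∈ (axisTorus v).pts R →
      ((baseSL R q)⁻¹ * s * baseSL R q) * t = t * ((baseSL R q)⁻¹ * s * baseSL R q) := by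
    intro t ht
    have h1 : baseSL R q * t * (baseSL R q)⁻¹ ∈ S.pts R :=
      hTS R (mem_conj.2 (by simpa [mul_assoc] using ht))
    have h2 := hST.mul_comm_of_mem hs h1
    have h3 := congrArg (fun z => (baseSL R q)⁻¹ * z * baseSL R q) h2
    simpa only [mul_assoc, inv_mul_cancel_left, inv_mul_cancel, mul_one] using h3
  have h1 := congrArg Subtype.val (hcomm _ (rotSL_mem hv _ _ (habR b (Or.inl rfl))))
  have h2 := congrArg Subtype.val (hcomm _ (rotSL_mem hv _ _ (habR (-b) (Or.inr rfl))))
  refine commute_crossMat_of_commute_rot (b' := algebraMap ℚ R b⁻¹) ?_ half_mul_two h1 ?_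
  · rw [← map_mul, inv_mul_cancel₀ hb, map_one]
  · rw [← map_neg]
    exact h2

/-! ### Anisotropy -/

open Polynomial in
/-- Positivity of `D` prevents cancellation of the lowest and of the highest terms of
`A ^ 2 + D B ^ 2`. The constant terms vanish together, so that `X` can be divided out until the
right-hand side is `1`; then the top terms show that both polynomials are constant. -/
theorem eq_monomials_of_sq_add_sq {d : ℚ} (hd : 0 < d) (n : ℕ) : ∀ A B : ℚ[X],
    A ^ 2 + C d * B ^ 2 = X ^ (2 * n) → ∃ a b : ℚ, A = C a * X ^ n ∧ B = C b * X ^ n := by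
  have pos : ∀ a b : ℚ, a ^ 2 + d * b ^ 2 = 0 → a = 0 ∧ b = 0 := by
    intro a b h
    have h1 : a ^ 2 = 0 := by nlinarith [sq_nonneg a, mul_nonneg hd.le (sq_nonneg b)]
    have h2 : b ^ 2 = 0 := by
      rw [h1, zero_add] at h
      exact (mul_eq_zero.1 h).resolve_left hd.ne'
    exact ⟨pow_eq_zero_iff two_ne_zero |>.1 h1, pow_eq_zero_iff two_ne_zero |>.1 h2⟩
  induction n with
  | zero =>
    intro A B h
    set N := max A.natDegree B.natDegree with hN
    have hc : A.coeff N ^ 2 + d * B.coeff N ^ 2 = (1 : ℚ[X]).coeff (N + N) := by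
      have := congrArg (fun P => P.coeff (N + N)) h
      simp only [mul_zero, pow_zero, coeff_add, coeff_C_mul, sq] at this
      rw [coeff_mul_add_eq_of_natDegree_le (le_max_left _ _) (le_max_left _ _),
        coeff_mul_add_eq_of_natDegree_le (le_max_right _ _) (le_max_right _ _)] at this
      rw [sq, sq, this]
    have hN0 : N = 0 := by
      by_contra hne
      rw [coeff_one, if_neg (by omega)] at hc
      obtain ⟨h1, h2⟩ := pos _ _ hc
      rcases max_choice A.natDegree B.natDegree with h3 | h3
      · rw [hN, h3] at h1 hne
        exact hne (by rw [leadingCoeff_eq_zero.1 h1, natDegree_zero])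
      · rw [hN, h3] at h2 hne
        exact hne (by rw [leadingCoeff_eq_zero.1 h2, natDegree_zero])
    refine ⟨A.coeff 0, B.coeff 0, ?_, ?_⟩
    · rw [pow_zero, mul_one]
      exact eq_C_of_natDegree_le_zero ((le_max_left _ _).trans hN0.le)
    · rw [pow_zero, mul_one]
      exact eq_C_of_natDegree_le_zero ((le_max_right _ _).trans hN0.le)
  | succ n ih =>
    intro A B h
    have h0 := congrArg (fun P => P.eval 0) h
    simp only [eval_add, eval_pow, eval_mul, eval_C, eval_X] at h0
    rw [zero_pow (by omega)] at h0
    obtain ⟨h1, h2⟩ := pos _ _ h0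
    obtain ⟨A', rfl⟩ := X_dvd_iff.2 ((coeff_zero_eq_eval_zero A).trans h1)
    obtain ⟨B', rfl⟩ := X_dvd_iff.2 ((coeff_zero_eq_eval_zero B).trans h2)
    have h3 : A' ^ 2 + C d * B' ^ 2 = X ^ (2 * n) := by
      apply mul_left_cancel₀ (pow_ne_zero 2 (X_ne_zero (R := ℚ)))
      calc X ^ 2 * (A' ^ 2 + C d * B' ^ 2) = (X * A') ^ 2 + C d * (X * B') ^ 2 := by ring
        _ = X ^ (2 * (n + 1)) := h
        _ = X ^ 2 * X ^ (2 * n) := by rw [← pow_add]; congr 1; ring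
    obtain ⟨a, b, rfl, rfl⟩ := ih A' B' h3
    exact ⟨a, b, by ring, by ring⟩

open LaurentPolynomial in
/-- The conic `a ^ 2 + D b ^ 2 = 1` has only constant points over `ℚ[T;T⁻¹]`: clearing the
denominators reduces this to polynomials. -/
theorem laurent_constant_of_sq_add_sq {d : ℚ} (hd : 0 < d) {a b : ℚ[T;T⁻¹]}
    (h : a ^ 2 + C d * b ^ 2 = 1) : ∃ a₀ b₀ : ℚ, a = C a₀ ∧ b = C b₀ := by
  obtain ⟨m, A, hA⟩ := a.exists_T_pow
  obtain ⟨k, B, hB⟩ := b.exists_T_pow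
  have hT : ∀ i j : ℕ, (T i * T j : ℚ[T;T⁻¹]) = T ((i + j : ℕ) : ℤ) := fun i j => by
    rw [← T_add, Nat.cast_add]
  have hX : ∀ i : ℕ, Polynomial.toLaurent (Polynomial.X ^ i : Polynomial ℚ) = T i := fun i => by
    rw [Polynomial.toLaurent_X_pow]
  obtain ⟨a₀, b₀, h1, h2⟩ := eq_monomials_of_sq_add_sq hd (m + k) (A * Polynomial.X ^ k)
    (B * Polynomial.X ^ m) (by
      apply Polynomial.toLaurent_injective
      rw [map_add, map_mul, map_pow, map_pow, map_mul, map_mul, hX, hX, hA, hB, hX,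
        Polynomial.toLaurent_C, mul_assoc, mul_assoc, hT, hT, add_comm k m, mul_pow, mul_pow,
        T_pow]
      have : (T (((2 : ℕ) : ℤ) * ((m + k : ℕ) : ℤ)) : ℚ[T;T⁻¹]) = T ((2 * (m + k) : ℕ) : ℤ) := by
        congr 1
      rw [this]
      linear_combination T ((2 * (m + k) : ℕ) : ℤ) * h)
  have hu : IsUnit (T ((m + k : ℕ) : ℤ) : ℚ[T;T⁻¹]) := isUnit_T _
  refine ⟨a₀, b₀, ?_, ?_⟩
  · have := congrArg Polynomial.toLaurent h1
    rw [map_mul, map_mul, hX, hX, hA, Polynomial.toLaurent_C, mul_assoc, hT] at this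
    exact hu.mul_right_cancel this
  · have := congrArg Polynomial.toLaurent h2
    rw [map_mul, map_mul, hX, hX, hB, Polynomial.toLaurent_C, mul_assoc, hT, add_comm k m] at this
    exact hu.mul_right_cancel this

open LaurentPolynomial in
/-- A homomorphism from the multiplicative group is determined by its value at the coordinate `T`
of `ℚ[T;T⁻¹]`, and this value is constant. -/
theorem axisTorus_isAnisotropic {v : Fin 3 → ℚ} (hv : v ⬝ᵥ v ≠ 0) :
    (axisTorus v).IsAnisotropic := by
  intro c hc
  have hpos : 0 < v ⬝ᵥ v := lt_of_le_of_ne (by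
    simp only [dotProduct, Fin.sum_univ_three]
    nlinarith [mul_self_nonneg (v 0), mul_self_nonneg (v 1), mul_self_nonneg (v 2)]) hv.symm
  let U : ℚ[T;T⁻¹]ˣ := ⟨T 1, T (-1), by rw [← T_add]; exact T_zero, by rw [← T_add]; exact T_zero⟩
  obtain ⟨a, b, hab, hU⟩ := exists_rotSL hv (c _ U).2
  obtain ⟨a₀, b₀, rfl, rfl⟩ := laurent_constant_of_sq_add_sq hpos hab
  have hev : ∀ (R : Type) [CommRing R] [Algebra ℚ R] (u : Rˣ),
      (c R u : SL(3, R)).1 = rot (baseVec R v) (algebraMap ℚ R (v ⬝ᵥ v)⁻¹)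
        (algebraMap ℚ R a₀) (algebraMap ℚ R b₀) := by
    intro R _ _ u
    let f : ℚ[T;T⁻¹] →ₐ[ℚ] R :=
      { eval₂ (algebraMap ℚ R) u with commutes' := fun r => eval₂_C _ _ r }
    have h1 : Units.map (f : ℚ[T;T⁻¹] →* R) U = u := by
      refine Units.ext ?_
      change eval₂ (algebraMap ℚ R) u (T 1) = u
      rw [eval₂_T, zpow_one]
    have h2 := hc _ _ f U
    rw [h1, hU] at h2
    rw [h2]
    change (f : ℚ[T;T⁻¹] →+* R).mapMatrix (rot _ _ _ _) = _
    rw [map_rot, map_baseVec, map_algebraMap_rat]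
    congr 1
    · exact eval₂_C _ _ _
    · exact eval₂_C _ _ _
  -- the value at `u` does not depend on `u`, so it is the value at `1`
  intro R _ _ u
  refine Subtype.ext (Subtype.ext ?_)
  have h1 := hev R 1
  rw [map_one] at h1
  rw [hev R u, ← h1]

/-! ### Rational points in the adèles -/

theorem rat_mem_padicInt_iff (p : Nat.Primes) (q : ℚ) :
    (q : ℚ_[(p : ℕ)]) ∈ PadicInt.subring (p : ℕ) ↔ ¬ (p : ℕ) ∣ q.den := by
  refine ⟨fun h hd => ?_, fun h => Padic.norm_rat_le_one h⟩
  have h1 := PadicInt.isUnit_iff.1 (PadicInt.isUnit_den q h)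
  have h2 : ‖((q.den : ℤ) : ℚ_[(p : ℕ)])‖ < 1 :=
    (Padic.norm_intCast_lt_one_iff).2 (Int.natCast_dvd_natCast.2 hd)
  rw [PadicInt.norm_def] at h1
  simp only [PadicInt.coe_natCast] at h1
  rw [Int.cast_natCast, h1] at h2
  exact lt_irrefl _ h2

/-- A rational number that is integral at every prime is an integer. -/
theorem exists_int_of_forall_padicInt {q : ℚ}
    (h : ∀ p : Nat.Primes, (q : ℚ_[(p : ℕ)]) ∈ PadicInt.subring (p : ℕ)) : ∃ n : ℤ, q = n := by
  have h1 : q.den = 1 := by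
    by_contra hne
    obtain ⟨p, hp, hd⟩ := Nat.exists_prime_and_dvd hne
    exact (rat_mem_padicInt_iff ⟨p, hp⟩ q).1 (h ⟨p, hp⟩) hd
  exact ⟨q.num, (Rat.den_eq_one_iff q).1 h1 |>.symm⟩

instance isOpen_padicInt :
    Fact (∀ p : Nat.Primes, IsOpen (PadicInt.subring (p : ℕ) : Set ℚ_[(p : ℕ)])) := ⟨by
  intro p
  have : (PadicInt.subring (p : ℕ) : Set ℚ_[(p : ℕ)]) = Metric.closedBall 0 1 := by
    ext z
    simp
  rw [this]
  exact IsUltrametricDist.isOpen_closedBall _ one_ne_zero⟩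

theorem algebraMap_adele_fst (q : ℚ) : (algebraMap ℚ Adele q).1 = (q : ℝ) :=
  map_algebraMap_rat (RingHom.fst ℝ FinAdele) q

theorem algebraMap_adele_snd (q : ℚ) (p : Nat.Primes) :
    (algebraMap ℚ Adele q).2 p = (q : ℚ_[(p : ℕ)]) :=
  map_algebraMap_rat (atPrime p) q

/-- The rational vectors are closed and discrete in the adelic ones: two of them whose
coordinates differ by less than one in `ℝ` and by integral finite adèles are equal. -/
theorem isClosed_image_rat {ι : Type} [Finite ι] (S : Set (ι → ℚ)) :
    IsClosed ((fun v : ι → ℚ => fun i => algebraMap ℚ Adele (v i)) '' S) := by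
  rw [← Set.biUnion_of_singleton S, Set.image_iUnion₂, Set.biUnion_eq_iUnion]
  refine LocallyFinite.isClosed_iUnion ?_ fun v => by
    rw [Set.image_singleton]
    exact isClosed_singleton
  -- a translate of `W` meets `ℚ` in at most one point
  intro a
  let W : Set Adele := {w | |w.1| < 1 / 2} ∩
    {w | ∀ p : Nat.Primes, w.2 p ∈ PadicInt.subring (p : ℕ)}
  have hW : IsOpen W := by
    refine IsOpen.inter (isOpen_lt (continuous_fst.abs) continuous_const) ?_
    exact (RestrictedProduct.isOpen_forall_mem isOpen_padicInt.out).preimage continuous_snd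
  refine ⟨{b | ∀ i, b i - a i ∈ W}, ?_, ?_⟩
  · refine Filter.eventually_all.2 fun i => ?_
    have hc : Continuous fun b : ι → Adele => b i - a i := by fun_prop
    refine hc.continuousAt.eventually (hW.mem_nhds ?_)
    have h0 : (0 : Adele) ∈ W := ⟨by change |(0 : ℝ)| < 1 / 2; norm_num, fun p => zero_mem _⟩
    rwa [← sub_self (a i)] at h0
  · refine Set.Subsingleton.finite ?_
    rintro ⟨v, hv⟩ ⟨b, hb, hbW⟩ ⟨w, hw⟩ ⟨c, hc, hcW⟩
    simp only [Set.image_singleton, Set.mem_singleton_iff] at hb hc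
    subst hb hc
    refine Subtype.ext (funext fun i => ?_)
    obtain ⟨n, hn⟩ : ∃ n : ℤ, v i - w i = n := by
      refine exists_int_of_forall_padicInt fun p => ?_
      have h1 := sub_mem ((hbW i).2 p) ((hcW i).2 p)
      change (algebraMap ℚ Adele (v i)).2 p - (a i).2 p -
        ((algebraMap ℚ Adele (w i)).2 p - (a i).2 p) ∈ _ at h1
      rw [algebraMap_adele_snd, algebraMap_adele_snd, sub_sub_sub_cancel_right] at h1
      rwa [Rat.cast_sub]
    have h1 := (hbW i).1
    have h2 := (hcW i).1
    change |(algebraMap ℚ Adele (v i)).1 - (a i).1| < 1 / 2 at h1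
    change |(algebraMap ℚ Adele (w i)).1 - (a i).1| < 1 / 2 at h2
    rw [algebraMap_adele_fst] at h1 h2
    have h3 : ((n : ℚ) : ℝ) = v i - w i := by rw [← hn, Rat.cast_sub]
    have h4 : |((n : ℤ) : ℝ)| < 1 := by
      rw [abs_lt] at h1 h2 ⊢
      rw [Rat.cast_intCast] at h3
      constructor <;> linarith [h1.1, h1.2, h2.1, h2.2]
    have h5 : n = 0 := by
      rw [← Int.cast_abs] at h4
      exact Int.abs_lt_one_iff.1 (by exact_mod_cast h4)
    rw [h5, Int.cast_zero] at hn
    exact sub_eq_zero.1 hn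

theorem adelicClass_eq_iff {n : ℕ} (M : AlgSubgroup n) (g h : M.pts Adele) :
    M.adelicClass g = M.adelicClass h ↔
      ∃ γ ∈ M.pts ℚ, (h : SL(n, Adele)) = baseSL Adele γ * (g : SL(n, Adele)) := by
  have : M.adelicClass g = M.adelicClass h ↔ h * g⁻¹ ∈ M.rat := by
    rw [adelicClass, adelicClass, Quotient.eq]
    exact QuotientGroup.rightRel_apply
  rw [this, rat, Subgroup.mem_subgroupOf, Subgroup.mem_map]
  refine exists_congr fun γ => and_congr_right fun _ => ?_
  change baseSL Adele γ = (h : SL(n, Adele)) * (g : SL(n, Adele))⁻¹ ↔ _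
  rw [eq_mul_inv_iff_mul_eq, eq_comm]

theorem crossMat_baseVec (v : Fin 3 → ℚ) (R : Type) [CommRing R] [Algebra ℚ R] :
    crossMat (baseVec R v) = (algebraMap ℚ R).mapMatrix (crossMat v) := by
  ext i j
  fin_cases i <;> fin_cases j <;> simp [crossMat, baseVec]

theorem SL_inv_mul {n : ℕ} {R : Type} [CommRing R] (g : SL(n, R)) : g⁻¹.1 * g.1 = 1 :=
  congrArg Subtype.val (inv_mul_cancel g)

theorem SL_mul_inv {n : ℕ} {R : Type} [CommRing R] (g : SL(n, R)) : g.1 * g⁻¹.1 = 1 :=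
  congrArg Subtype.val (mul_inv_cancel g)

/-- The conjugate `g A g⁻¹` of a matrix. -/
def conjMat {n : ℕ} {R : Type} [CommRing R] (g : SL(n, R)) (A : Matrix (Fin n) (Fin n) R) :
    Matrix (Fin n) (Fin n) R := g.1 * A * g⁻¹.1

section ConjMat

variable {n : ℕ} {R : Type} [CommRing R]

theorem conjMat_one (A : Matrix (Fin n) (Fin n) R) : conjMat 1 A = A := by simp [conjMat]

theorem conjMat_mul (g h : SL(n, R)) (A : Matrix (Fin n) (Fin n) R) :
    conjMat (g * h) A = conjMat g (conjMat h A) := by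
  have : (g * h)⁻¹.1 = h⁻¹.1 * g⁻¹.1 := congrArg Subtype.val (_root_.mul_inv_rev g h)
  rw [conjMat, conjMat, conjMat, this]
  change g.1 * h.1 * A * _ = _
  simp only [Matrix.mul_assoc]

theorem conjMat_eq_iff {g : SL(n, R)} {A B : Matrix (Fin n) (Fin n) R} :
    conjMat g A = B ↔ A = conjMat g⁻¹ B := by
  constructor
  · rintro rfl
    rw [← conjMat_mul, inv_mul_cancel, conjMat_one]
  · rintro rfl
    rw [← conjMat_mul, mul_inv_cancel, conjMat_one]

theorem conjMat_eq_self_iff {g : SL(n, R)} {A : Matrix (Fin n) (Fin n) R} :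
    conjMat g A = A ↔ g.1 * A = A * g.1 := by
  constructor
  · intro h
    conv_rhs => rw [← h, conjMat, Matrix.mul_assoc, SL_inv_mul, Matrix.mul_one]
  · intro h
    rw [conjMat, h, Matrix.mul_assoc, SL_mul_inv, Matrix.mul_one]

theorem conjMat_map {S : Type} [CommRing S] (f : R →+* S) (g : SL(n, R))
    (A : Matrix (Fin n) (Fin n) R) :
    f.mapMatrix (conjMat g A) = conjMat (SpecialLinearGroup.map f g) (f.mapMatrix A) := by
  rw [conjMat, conjMat, map_mul, map_mul, ← map_inv]
  rfl

end ConjMat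

/-- The torus `q T q⁻¹` is the centralizer in `ASL_2` of a rational matrix. -/
theorem mem_conj_axisTorus_iff {v : Fin 3 → ℚ} (hv : v ⬝ᵥ v ≠ 0) {q : SL(3, ℚ)} (hq : q.1 2 = v)
    {R : Type} [CommRing R] [Algebra ℚ R] {g : SL(3, R)} :
    g ∈ ((axisTorus v).conj q).pts R ↔ g ∈ ASL2.pts R ∧
      conjMat g ((algebraMap ℚ R).mapMatrix (conjMat q (crossMat v))) =
        (algebraMap ℚ R).mapMatrix (conjMat q (crossMat v)) := by
  rw [mem_conj, mem_axisTorus_iff_commute hv, ehat_vecMul_mul_iff hq, conjMat_map,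
    crossMat_baseVec, ← conjMat_eq_self_iff, conjMat_mul, conjMat_mul, conjMat_eq_iff, inv_inv]

/-- The orbit of the torus is closed: it consists of the classes of the points `h` that transport
a fixed matrix to a rational conjugate of a given rational one, and every set of rational matrices
is closed in the adelic ones. -/
theorem isClosed_adelicOrbit {v : Fin 3 → ℚ} (hv : v ⬝ᵥ v ≠ 0) {q : SL(3, ℚ)} (hq : q.1 2 = v)
    (g : ASL2.pts Adele) : IsClosed (ASL2.adelicOrbit ((axisTorus v).conj q) g) := by
  rw [← isQuotientMap_quotient_mk'.isClosed_preimage]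
  set X := conjMat q (crossMat v)
  let A : Matrix (Fin 3) (Fin 3) Adele := (algebraMap ℚ Adele).mapMatrix X
  let F : ASL2.pts Adele → (Fin 3 × Fin 3 → Adele) := fun h ij =>
    conjMat (h : SL(3, Adele)) (conjMat (g : SL(3, Adele))⁻¹ A) ij.1 ij.2
  have hF : Continuous F := by
    have h1 : Continuous fun h : ASL2.pts Adele => (h : SL(3, Adele)).1 :=
      continuous_subtype_val.comp continuous_subtype_val
    have h0 : Continuous fun h : ASL2.pts Adele => (h : SL(3, Adele))⁻¹ :=
      continuous_subtype_val.inv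
    have h2 : Continuous fun h : ASL2.pts Adele => (h : SL(3, Adele))⁻¹.1 :=
      continuous_subtype_val.comp h0
    have h3 := (h1.matrix_mul (continuous_const (y := conjMat (g : SL(3, Adele))⁻¹ A))).matrix_mul
      h2
    exact continuous_pi fun ij => h3.matrix_elem ij.1 ij.2
  let S : Set (Fin 3 × Fin 3 → ℚ) :=
    {w | ∃ γ ∈ ASL2.pts ℚ, w = fun ij => conjMat γ X ij.1 ij.2}
  convert (isClosed_image_rat S).preimage hF using 1
  ext h
  have key : F h ∈ (fun v : Fin 3 × Fin 3 → ℚ => fun i => algebraMap ℚ Adele (v i)) '' S ↔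
      ∃ γ ∈ ASL2.pts ℚ, conjMat (baseSL Adele γ) A =
        conjMat (h : SL(3, Adele)) (conjMat (g : SL(3, Adele))⁻¹ A) := by
    constructor
    · rintro ⟨_, ⟨γ, hγ, rfl⟩, e⟩
      refine ⟨γ, hγ, ?_⟩
      rw [← conjMat_map]
      exact Matrix.ext fun i j => congrFun e (i, j)
    · rintro ⟨γ, hγ, e⟩
      rw [← conjMat_map] at e
      exact ⟨_, ⟨γ, hγ, rfl⟩, funext fun ij => congrFun (congrFun e ij.1) ij.2⟩
  refine Iff.trans ?_ key.symm
  change (∃ t : ASL2.pts Adele, _ ∧ ASL2.adelicClass h = ASL2.adelicClass (t * g)) ↔ _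
  constructor
  · rintro ⟨t, ht, he⟩
    obtain ⟨γ, hγM, e⟩ := (adelicClass_eq_iff _ _ _).1 he.symm
    refine ⟨γ, hγM, ?_⟩
    rw [e, Subgroup.coe_mul, conjMat_mul, conjMat_mul, ← conjMat_mul (g : SL(3, Adele)),
      mul_inv_cancel, conjMat_one, ((mem_conj_axisTorus_iff hv hq).1 ht).2]
  · rintro ⟨γ, hγM, e⟩
    let Γ : ASL2.pts Adele := ⟨baseSL Adele γ, map_mem_pts ASL2 _ hγM⟩
    refine ⟨Γ⁻¹ * h * g⁻¹, (mem_conj_axisTorus_iff hv hq).2 ⟨(Γ⁻¹ * h * g⁻¹).2, ?_⟩,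
      ((adelicClass_eq_iff _ _ _).2 ⟨γ, hγM, ?_⟩).symm⟩
    · change conjMat ((baseSL Adele γ)⁻¹ * (h : SL(3, Adele)) * (g : SL(3, Adele))⁻¹) A = A
      rw [conjMat_mul, conjMat_mul, ← e, ← conjMat_mul, inv_mul_cancel, conjMat_one]
    · change (h : SL(3, Adele)) = baseSL Adele γ *
        ((baseSL Adele γ)⁻¹ * (h : SL(3, Adele)) * (g : SL(3, Adele))⁻¹ * (g : SL(3, Adele)))
      group

theorem isToralPresentation_axisTorus {v : Fin 3 → ℚ} (hv : v ⬝ᵥ v ≠ 0) {q : SL(3, ℚ)}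
    (hq : q.1 2 = v) (g : ASL2.pts Adele)
    (hg : (((axisTorus v).conj q).pts ℝ).map (MulAut.conj
      (SpecialLinearGroup.map (RingHom.fst ℝ FinAdele) (g : SL(3, Adele)))⁻¹).toMonoidHom =
        Kinf) :
    IsToralPresentation ((axisTorus v).conj q) g (ASL2.adelicOrbit ((axisTorus v).conj q) g) :=
  ⟨axisTorus_isMaximalTorus hv hq, (axisTorus_isAnisotropic hv).conj q,
    isClosed_adelicOrbit hv hq g, rfl, hg⟩

/-! ### Rotations and unimodular matrices with a prescribed image of a vector -/

theorem exists_rotation_of_unit {u : Fin 3 → ℝ} (hu : u ⬝ᵥ u = 1) :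
    ∃ g : SL(3, ℝ), g ∈ (SO 3).pts ℝ ∧ g.1 *ᵥ u = ehat ℝ := by
  have h : u 0 ^ 2 + u 1 ^ 2 + u 2 ^ 2 = 1 := by
    rw [← hu, dotProduct, Fin.sum_univ_three]
    ring
  by_cases hc : 1 + u 2 = 0
  · have h2 : u 2 = -1 := by linarith
    have h0 : u 0 = 0 := by nlinarith [sq_nonneg (u 0), sq_nonneg (u 1)]
    have h1 : u 1 = 0 := by nlinarith [sq_nonneg (u 0), sq_nonneg (u 1)]
    refine ⟨⟨!![1, 0, 0; 0, -1, 0; 0, 0, -1], by simp [Matrix.det_fin_three]⟩, ?_, ?_⟩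
    · change (_ : Matrix (Fin 3) (Fin 3) ℝ)ᵀ * _ = 1
      ext i j
      fin_cases i <;> fin_cases j <;> simp [Matrix.mul_apply, Fin.sum_univ_three]
    · funext i
      fin_cases i <;>
        simp [Matrix.mulVec, dotProduct, Fin.sum_univ_three, ehat, h0, h1, h2]
  · -- the rotation in the plane of `u` and `ê`, by Rodrigues' formula
    let t := (1 + u 2)⁻¹
    have ht : t * (1 + u 2) = 1 := inv_mul_cancel₀ hc
    let A : Matrix (Fin 3) (Fin 3) ℝ :=
      !![1 - t * u 0 ^ 2, -t * u 0 * u 1, -u 0; -t * u 0 * u 1, 1 - t * u 1 ^ 2, -u 1;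
        u 0, u 1, u 2]
    have h' : u 0 ^ 2 + u 1 ^ 2 = 1 - u 2 ^ 2 := by linarith
    have ht' : t * (u 0 ^ 2 + u 1 ^ 2) = 1 - u 2 := by
      rw [h']
      linear_combination (1 - u 2) * ht
    have e2 : t ^ 2 * (u 0 ^ 2 + u 1 ^ 2) = t * (1 - u 2) := by rw [sq, mul_assoc, ht']
    have ho : Aᵀ * A = 1 := by
      ext i j
      fin_cases i <;> fin_cases j <;>
        simp [A, Matrix.mul_apply, Fin.sum_univ_three]
      · linear_combination u 0 ^ 2 * e2 - u 0 ^ 2 * ht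
      · linear_combination u 0 * u 1 * e2 - u 0 * u 1 * ht
      · linear_combination u 0 * ht'
      · linear_combination u 0 * u 1 * e2 - u 0 * u 1 * ht
      · linear_combination u 1 ^ 2 * e2 - u 1 ^ 2 * ht
      · linear_combination u 1 * ht'
      · linear_combination u 0 * ht'
      · linear_combination u 1 * ht'
      · linear_combination h
    have hd : A.det = 1 := by
      simp only [A, Matrix.det_fin_three, Matrix.of_apply, Matrix.cons_val_zero,
        Matrix.cons_val_one, Matrix.cons_val]
      linear_combination h - u 2 * ht'
    refine ⟨⟨A, hd⟩, ho, ?_⟩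
    funext i
    fin_cases i <;>
      simp [A, Matrix.mulVec, dotProduct, Fin.sum_univ_three, ehat]
    · linear_combination -u 0 * ht'
    · linear_combination -u 1 * ht'
    · linear_combination h

theorem toReal_dotProduct (y z : Fin 3 → ℤ) : toReal y ⬝ᵥ toReal z = ((y ⬝ᵥ z : ℤ) : ℝ) := by
  simp [toReal, dotProduct, Fin.sum_univ_three]

theorem pos_of_primitive {D : ℕ} {x : Fin 3 → ℤ} (hx : x ∈ primitivePoints D) : 0 < D := by
  rcases Nat.eq_zero_or_pos D with rfl | h
  · exfalso
    obtain ⟨hp, h0⟩ := hx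
    simp only [dotProduct, Fin.sum_univ_three, Nat.cast_zero] at h0
    have hz : ∀ i, x i = 0 := by
      intro i
      have q0 := mul_self_nonneg (x 0)
      have q1 := mul_self_nonneg (x 1)
      have q2 := mul_self_nonneg (x 2)
      refine mul_self_eq_zero.1 ?_
      fin_cases i
      · change x 0 * x 0 = 0
        omega
      · change x 1 * x 1 = 0
        omega
      · change x 2 * x 2 = 0
        omega
    exact not_isUnit_zero (hp 0 fun i => by rw [hz i])
  · exact h

theorem exists_isRotationToEhat {D : ℕ} {x : Fin 3 → ℤ} (hx : x ∈ primitivePoints D) :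
    ∃ g, IsRotationToEhat D x g := by
  have hD : (0 : ℝ) < D := Nat.cast_pos.2 (pos_of_primitive hx)
  have hs : Real.sqrt D ≠ 0 := (Real.sqrt_pos.2 hD).ne'
  obtain ⟨g, hg, h⟩ := exists_rotation_of_unit (u := (Real.sqrt D)⁻¹ • toReal x) (by
    rw [smul_dotProduct, dotProduct_smul, toReal_dotProduct, hx.2, smul_smul, smul_eq_mul,
      ← mul_inv, Real.mul_self_sqrt hD.le, Int.cast_natCast, inv_mul_cancel₀ hD.ne'])
  refine ⟨g, hg, ?_⟩
  rw [← h, Matrix.mulVec_smul, smul_smul, mul_inv_cancel₀ hs, one_smul]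

/-- A primitive vector is mapped to `ê` by two applications of Bézout's identity. -/
theorem exists_SL_mulVec_eq_ehat {y : Fin 3 → ℤ} (hy : ∀ d : ℤ, (∀ i, d ∣ y i) → IsUnit d) :
    ∃ δ : SL(3, ℤ), δ.1 *ᵥ y = ehat ℤ := by
  have step : ∃ (γ : SL(3, ℤ)) (g : ℤ), g ∣ y 0 ∧ g ∣ y 1 ∧ γ.1 *ᵥ y = ![0, g, y 2] := by
    by_cases h0 : Int.gcd (y 0) (y 1) = 0
    · obtain ⟨h1, h2⟩ := Int.gcd_eq_zero_iff.1 h0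
      refine ⟨1, 0, by rw [h1], by rw [h2], ?_⟩
      funext i
      fin_cases i <;> simp [h1, h2]
    · set g : ℤ := (Int.gcd (y 0) (y 1) : ℤ) with hg
      have hg0 : g ≠ 0 := Int.natCast_ne_zero.2 h0
      obtain ⟨a, ha⟩ : g ∣ y 0 := Int.gcd_dvd_left _ _
      obtain ⟨b, hb⟩ : g ∣ y 1 := Int.gcd_dvd_right _ _
      have hbez := Int.gcd_eq_gcd_ab (y 0) (y 1)
      set u := Int.gcdA (y 0) (y 1)
      set w := Int.gcdB (y 0) (y 1)
      rw [← hg] at hbez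
      have h1 : a * u + b * w = 1 := by
        apply mul_left_cancel₀ hg0
        linear_combination -hbez - u * ha - w * hb
      refine ⟨⟨!![b, -a, 0; u, w, 0; 0, 0, 1], by
        simp [Matrix.det_fin_three]; linear_combination h1⟩, g, ⟨a, ha⟩, ⟨b, hb⟩, ?_⟩
      funext i
      fin_cases i <;> simp [Matrix.mulVec, dotProduct, Fin.sum_univ_three]
      · linear_combination b * ha - a * hb
      · linear_combination -hbez
  obtain ⟨γ, g, hg0, hg1, hγ⟩ := step
  have hcop : IsCoprime g (y 2) := by
    rw [Int.isCoprime_iff_gcd_eq_one]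
    have := hy (Int.gcd g (y 2) : ℤ) (by
      intro i
      fin_cases i
      · exact (Int.gcd_dvd_left _ _).trans hg0
      · exact (Int.gcd_dvd_left _ _).trans hg1
      · exact Int.gcd_dvd_right _ _)
    rw [Int.isUnit_iff] at this
    omega
  obtain ⟨s, t, hst⟩ := hcop
  refine ⟨⟨!![1, 0, 0; 0, y 2, -g; 0, s, t], by
    simp [Matrix.det_fin_three]; linear_combination hst⟩ * γ, ?_⟩
  change (!![1, 0, 0; 0, y 2, -g; 0, s, t] * γ.1) *ᵥ y = _
  rw [← Matrix.mulVec_mulVec, hγ]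
  funext i
  fin_cases i <;> simp [Matrix.mulVec, dotProduct, Fin.sum_univ_three, ehat]
  · ring
  · exact hst

/-! ### The Cartan involution and orthogonal matrices -/

section Cartan

variable {R : Type} [CommRing R]

theorem cartan_coe (g : SL(3, R)) : (cartan R g).1 = g⁻¹.1ᵀ := rfl

theorem cartan_inv_coe (g : SL(3, R)) : (cartan R g)⁻¹.1 = g.1ᵀ := by
  rw [← map_inv, cartan_coe, inv_inv]

theorem cartan_cartan (g : SL(3, R)) : cartan R (cartan R g) = g :=
  Subtype.ext (by rw [cartan_coe, cartan_inv_coe, Matrix.transpose_transpose])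

theorem map_cartan {S : Type} [CommRing S] (f : R →+* S) (g : SL(3, R)) :
    SpecialLinearGroup.map f (cartan R g) = cartan S (SpecialLinearGroup.map f g) := by
  refine Subtype.ext ?_
  rw [cartan_coe, ← map_inv]
  rfl

theorem vecMul_cartan (g : SL(3, R)) (v : Fin 3 → R) : v ᵥ* (cartan R g).1 = g⁻¹.1 *ᵥ v := by
  rw [cartan_coe, Matrix.vecMul_transpose]

theorem mem_SO {n : ℕ} [Algebra ℚ R] {g : SL(n, R)} :
    g ∈ (SO n).pts R ↔ g.1ᵀ * g.1 = 1 := Iff.rfl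

theorem inv_coe_of_mem_SO {n : ℕ} [Algebra ℚ R] {g : SL(n, R)} (hg : g ∈ (SO n).pts R) :
    g⁻¹.1 = g.1ᵀ := by
  have h1 := mem_SO.1 hg
  calc g⁻¹.1 = (g.1ᵀ * g.1) * g⁻¹.1 := by rw [h1, Matrix.one_mul]
    _ = g.1ᵀ := by rw [Matrix.mul_assoc, SL_mul_inv, Matrix.mul_one]

theorem cartan_of_mem_SO [Algebra ℚ R] {g : SL(3, R)} (hg : g ∈ (SO 3).pts R) :
    cartan R g = g :=
  Subtype.ext (by rw [cartan_coe, inv_coe_of_mem_SO hg, Matrix.transpose_transpose])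

theorem mulVec_eq_iff {n : ℕ} {g : SL(n, R)} {u w : Fin n → R} :
    g.1 *ᵥ u = w ↔ u = g⁻¹.1 *ᵥ w := by
  constructor
  · rintro rfl
    rw [Matrix.mulVec_mulVec, SL_inv_mul, Matrix.one_mulVec]
  · rintro rfl
    rw [Matrix.mulVec_mulVec, SL_mul_inv, Matrix.one_mulVec]

end Cartan

/-- An integral matrix over `ℝ`. -/
abbrev toRealSL : SL(3, ℤ) →* SL(3, ℝ) := SpecialLinearGroup.map (Int.castRingHom ℝ)

/-! ### Orthogonal grids as points of `ASL_2(ℤ)\ASL_2(ℝ)` -/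

/-- The integral vectors `m` with `⟨m, y⟩ = 1` are carried by `ᶿδ` to those with
`⟨m, δ y⟩ = 1`, because `⟨ᶿδ m, δ y⟩ = ⟨m, y⟩`. -/
theorem act_cartan_intCoset (δ : SL(3, ℤ)) (y : Fin 3 → ℤ) :
    act (toRealSL (cartan ℤ δ)) (intCoset y) = intCoset (δ.1 *ᵥ y) := by
  have hsub : ∀ (δ : SL(3, ℤ)) (y : Fin 3 → ℤ),
      act (toRealSL (cartan ℤ δ)) (intCoset y) ⊆ intCoset (δ.1 *ᵥ y) := by
    rintro δ y _ ⟨_, ⟨m, hm, rfl⟩, rfl⟩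
    refine ⟨(cartan ℤ δ).1 *ᵥ m, ?_, mulVec_toReal _ _⟩
    rw [cartan_coe, Matrix.mulVec_transpose, Matrix.dotProduct_mulVec, Matrix.vecMul_vecMul,
      SL_inv_mul, Matrix.vecMul_one, hm]
  refine (hsub δ y).antisymm ?_
  have h := hsub δ⁻¹ (δ.1 *ᵥ y)
  rw [Matrix.mulVec_mulVec, SL_inv_mul, Matrix.one_mulVec, map_inv, map_inv] at h
  have h2 := Set.image_mono (f := fun v => (toRealSL (cartan ℤ δ)).1 *ᵥ v) h
  change act _ (act _ _) ⊆ act _ _ at h2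
  rwa [← act_mul, mul_inv_cancel, act_one] at h2

/-- The scaling factor `D^{-1/4}`. -/
def gridScale (D : ℕ) : ℝ := (D : ℝ) ^ (-(1 / 4) : ℝ)

theorem gridScale_pos {D : ℕ} (hD : 0 < D) : 0 < gridScale D :=
  Real.rpow_pos_of_pos (Nat.cast_pos.2 hD) _

theorem gridScale_sq_mul_sqrt {D : ℕ} (hD : 0 < D) : gridScale D ^ 2 * Real.sqrt D = 1 := by
  have hD' : (0 : ℝ) < D := Nat.cast_pos.2 hD
  rw [gridScale, ← Real.rpow_natCast, ← Real.rpow_mul hD'.le, Real.sqrt_eq_rpow,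
    ← Real.rpow_add hD']
  norm_num

/-- The matrix `diag(c, c, c⁻²)`. -/
def diagSL (c : ℝ) (hc : c ≠ 0) : SL(3, ℝ) :=
  ⟨Matrix.diagonal ![c, c, (c ^ 2)⁻¹], by
    rw [Matrix.det_diagonal, Fin.prod_univ_three]
    simp only [Matrix.cons_val_zero, Matrix.cons_val_one, Matrix.cons_val]
    field_simp⟩

theorem diagSL_mulVec (c : ℝ) (hc : c ≠ 0) (v : Fin 3 → ℝ) :
    (diagSL c hc).1 *ᵥ v = c • v + (((c ^ 2)⁻¹ - c) * v 2) • ehat ℝ := by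
  funext i
  rw [diagSL, Matrix.mulVec_diagonal]
  fin_cases i <;> simp [ehat]
  ring

theorem rotation_dotProduct {k : SL(3, ℝ)} (hk : k ∈ (SO 3).pts ℝ) (u w : Fin 3 → ℝ) :
    (k.1 *ᵥ u) ⬝ᵥ (k.1 *ᵥ w) = u ⬝ᵥ w := by
  rw [Matrix.dotProduct_mulVec, ← Matrix.mulVec_transpose, Matrix.mulVec_mulVec, mem_SO.1 hk,
    Matrix.one_mulVec]

/-- For `δ y = ê` and a rotation `k` with `k y = √D ê`, the point of `ASL_2(ℝ)` whose lattice
coset is the orthogonal grid of `y`. -/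
def gridPoint (D : ℕ) (hD : 0 < D) (δ : SL(3, ℤ)) (k : SL(3, ℝ)) : SL(3, ℝ) :=
  toRealSL (cartan ℤ δ) * k⁻¹ * (diagSL (gridScale D) (gridScale_pos hD).ne')⁻¹

theorem gridPoint_mem {D : ℕ} (hD : 0 < D) {y : Fin 3 → ℤ} {δ : SL(3, ℤ)}
    (hδ : δ.1 *ᵥ y = ehat ℤ) {k : SL(3, ℝ)} (hk : IsRotationToEhat D y k) :
    gridPoint D hD δ k ∈ ASL2.pts ℝ := by
  rw [mem_ASL2]
  have h1 : ehat ℝ ᵥ* (toRealSL (cartan ℤ δ)).1 = toReal y := by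
    rw [map_cartan, vecMul_cartan, ← map_inv]
    have : ehat ℝ = toReal (ehat ℤ) := by
      funext i
      fin_cases i <;> simp [ehat, toReal]
    rw [this, mulVec_toReal, ← mulVec_eq_iff.1 hδ]
  have h2 : toReal y ᵥ* k⁻¹.1 = Real.sqrt D • ehat ℝ := by
    rw [inv_coe_of_mem_SO hk.1, Matrix.vecMul_transpose, hk.2]
  have h3 : ehat ℝ ᵥ* (diagSL (gridScale D) (gridScale_pos hD).ne')⁻¹.1 =
      (gridScale D ^ 2) • ehat ℝ := by
    have h4 : (gridScale D ^ 2) • (ehat ℝ ᵥ* (diagSL (gridScale D) (gridScale_pos hD).ne').1) =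
        ehat ℝ := by
      have := gridScale_pos hD
      rw [ehat_vecMul]
      funext i
      fin_cases i <;> simp [diagSL, ehat]
      field_simp
    conv_lhs => rw [← h4]
    rw [Matrix.smul_vecMul, Matrix.vecMul_vecMul, SL_mul_inv, Matrix.vecMul_one]
  change ehat ℝ ᵥ* ((toRealSL (cartan ℤ δ)).1 * k⁻¹.1 * (diagSL _ _)⁻¹.1) = _
  rw [← Matrix.vecMul_vecMul, ← Matrix.vecMul_vecMul, h1, h2, Matrix.smul_vecMul, h3, smul_smul,
    mul_comm, gridScale_sq_mul_sqrt hD, one_smul]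

/-- The inverse of the grid point is `diag(c, c, c⁻²) k (ᶿδ)⁻¹` with `c = D^{-1/4}`. It carries
`ê + ê^⊥(ℤ)` first to `y¹ + y^⊥(ℤ)`, then to a coset in the plane at height `D^{-1/2} = c²`, and
finally to height one, with the plane `ê^⊥` scaled by `c`. -/
theorem cosetOfPoint_gridPoint {D : ℕ} (hD : 0 < D) {y : Fin 3 → ℤ} {δ : SL(3, ℤ)}
    (hδ : δ.1 *ᵥ y = ehat ℤ) {k : SL(3, ℝ)} (hk : IsRotationToEhat D y k) :
    cosetOfPoint ⟨gridPoint D hD δ k, gridPoint_mem hD hδ hk⟩ = rescale D y k (intCoset y) := by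
  have hc := gridScale_pos hD
  have h1 := gridScale_sq_mul_sqrt hD
  have hD' : (0 : ℝ) < D := Nat.cast_pos.2 hD
  have hs : Real.sqrt D * Real.sqrt D = D := Real.mul_self_sqrt hD'.le
  set c := gridScale D
  have hs' : Real.sqrt D = (c ^ 2)⁻¹ := by
    field_simp
    linarith
  have hD2 : (D : ℝ)⁻¹ = c ^ 4 := by
    rw [← hs, hs']
    field_simp
  rw [cosetOfPoint]
  change shift _ (act (gridPoint D hD δ k)⁻¹ (intCoset (ehat ℤ))) = _
  have e1 : (gridPoint D hD δ k)⁻¹ =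
      diagSL c hc.ne' * k * (toRealSL (cartan ℤ δ))⁻¹ := by
    simp only [gridPoint, _root_.mul_inv_rev, inv_inv, mul_assoc]
    rfl
  rw [e1, ← hδ, ← act_cartan_intCoset, ← act_mul, inv_mul_cancel_right, act_mul, rescale]
  simp only [act, shift, Set.image_image]
  refine Set.image_congr ?_
  rintro _ ⟨m, hm, rfl⟩
  -- the height of `k m` is `⟨k m, k y⟩ / √D = 1 / √D`
  have h2 : (k.1 *ᵥ toReal m) 2 = c ^ 2 := by
    have h3 := rotation_dotProduct hk.1 (toReal m) (toReal y)
    rw [hk.2, toReal_dotProduct, hm, dotProduct_smul, smul_eq_mul] at h3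
    have h4 : (k.1 *ᵥ toReal m) ⬝ᵥ ehat ℝ = (k.1 *ᵥ toReal m) 2 := by
      simp [ehat, dotProduct, Fin.sum_univ_three]
    rw [h4] at h3
    calc (k.1 *ᵥ toReal m) 2 = c ^ 2 * (Real.sqrt D * (k.1 *ᵥ toReal m) 2) := by
          rw [← mul_assoc, h1, one_mul]
      _ = c ^ 2 := by rw [h3, Int.cast_one, mul_one]
  change _ = c • _
  rw [diagSL_mulVec, h2, Matrix.mulVec_add, Matrix.mulVec_neg, Matrix.mulVec_smul, hk.2, hs', hD2]
  funext i
  simp only [Pi.add_apply, Pi.smul_apply, Pi.neg_apply, smul_eq_mul]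
  field_simp
  ring

theorem rescale_mem_unimodularCosets {D : ℕ} (hD : 0 < D) {y : Fin 3 → ℤ}
    (hy : y ∈ primitivePoints D) {k : SL(3, ℝ)} (hk : IsRotationToEhat D y k) :
    rescale D y k (intCoset y) ∈ UnimodularCosets := by
  obtain ⟨δ, hδ⟩ := exists_SL_mulVec_eq_ehat hy.1
  rw [← cosetOfPoint_gridPoint hD hδ hk]
  exact cosetOfPoint_mem _

/-! ### The intersection of the two orbits -/

theorem mem_thetaH {x : Fin 3 → ℤ} {h : SL(3, ℝ)} :
    h ∈ thetaH x ↔ toReal x ᵥ* h.1 = toReal x := by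
  have hx : (fun i => algebraMap ℚ ℝ (x i : ℚ)) = toReal x := by
    funext i
    simp [toReal]
  constructor
  · rintro ⟨g, hg, rfl⟩
    have hg' : g.1 *ᵥ (fun i => algebraMap ℚ ℝ (x i : ℚ)) = _ := hg
    rw [hx] at hg'
    rw [vecMul_cartan, ← mulVec_eq_iff.1 hg']
  · intro hh
    refine ⟨cartan ℝ h, ?_, cartan_cartan h⟩
    change (cartan ℝ h).1 *ᵥ (fun i => algebraMap ℚ ℝ (x i : ℚ)) = fun i => algebraMap ℚ ℝ (x i : ℚ)
    rw [hx, mulVec_eq_iff, cartan_inv_coe, Matrix.mulVec_transpose, hh]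

theorem mk_mem_realOrbit {h : SL(3, ℝ)} {S : Subgroup SL(3, ℝ)} :
    (Quotient.mk _ h : LatticeSpace) ∈ realOrbit S ↔
      ∃ s ∈ S, ∃ γ : SL(3, ℤ), h = toRealSL γ * s := by
  constructor
  · rintro ⟨s, hs, e⟩
    obtain ⟨γ, hγ⟩ := QuotientGroup.rightRel_apply.1 (Quotient.exact e)
    exact ⟨s, hs, γ, by rw [toRealSL, hγ, inv_mul_cancel_right]⟩
  · rintro ⟨s, hs, γ, rfl⟩
    refine ⟨s, hs, Quotient.sound (QuotientGroup.rightRel_apply.2 ⟨γ, ?_⟩)⟩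
    rw [mul_inv_cancel_right]

theorem mulVec_primitive {y : Fin 3 → ℤ} (hy : ∀ d : ℤ, (∀ i, d ∣ y i) → IsUnit d)
    (γ : SL(3, ℤ)) : ∀ d : ℤ, (∀ i, d ∣ (γ.1 *ᵥ y) i) → IsUnit d := by
  intro d hd
  refine hy d fun i => ?_
  have : y = γ⁻¹.1 *ᵥ (γ.1 *ᵥ y) := by
    rw [Matrix.mulVec_mulVec, SL_inv_mul, Matrix.one_mulVec]
  rw [this]
  change d ∣ ∑ j, γ⁻¹.1 i j * (γ.1 *ᵥ y) j
  exact Finset.dvd_sum fun j _ => (hd j).mul_left _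

/-- If `h = γ s` with `γ` integral and `s` a rotation, then `y = ᵗγ x = s x` is a primitive point
and `h` gives the grid of `y`. -/
theorem rescale_act_inv {D : ℕ} {x y : Fin 3 → ℤ} {γ : SL(3, ℤ)} {s g : SL(3, ℝ)}
    (hg : IsRotationToEhat D x g) (hs : s ∈ (SO 3).pts ℝ)
    (hy : y = γ.1ᵀ *ᵥ x) (hsx : s.1 *ᵥ toReal x = toReal y) :
    IsRotationToEhat D y (g * s⁻¹) ∧
      rescale D x g (act (toRealSL γ * s)⁻¹ (intCoset x)) =
        rescale D y (g * s⁻¹) (intCoset y) := by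
  have hsy : s⁻¹.1 *ᵥ toReal y = toReal x := (mulVec_eq_iff.1 hsx).symm
  refine ⟨⟨mul_mem hg.1 (inv_mem hs), ?_⟩, ?_⟩
  · change (g.1 * s⁻¹.1) *ᵥ toReal y = _
    rw [← Matrix.mulVec_mulVec, hsy, hg.2]
  · have h1 : act (toRealSL γ)⁻¹ (intCoset x) = intCoset y := by
      have := act_cartan_intCoset (cartan ℤ γ⁻¹) x
      rw [cartan_cartan, map_inv] at this
      rw [this, hy, map_inv, cartan_inv_coe]
    rw [_root_.mul_inv_rev, act_mul, h1, rescale, rescale, act_mul]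
    congr 2
    simp only [act, shift, Set.image_image]
    refine Set.image_congr' fun v => ?_
    rw [Matrix.mulVec_add, Matrix.mulVec_neg, Matrix.mulVec_smul, hsy]

/-- A point of the intersection is the class of some `h = γ s` in `ᶿH(ℝ)`, with `γ` integral and
`s` a rotation, and `h` fixes the row vector `x` exactly when `s x = ᵗγ x`. Every primitive point
of norm `√D` is of the form `ᵗγ x`, since `SL_3(ℤ)` is transitive on primitive vectors. -/
theorem gridCollection_eq {D : ℕ} {x : Fin 3 → ℤ} (hx : x ∈ primitivePoints D) {g : SL(3, ℝ)}
    (hg : IsRotationToEhat D x g) :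
    gridCollection D x g = ⋃ y ∈ primitivePoints D, grid D y := by
  ext C
  simp only [Set.mem_iUnion, exists_prop]
  constructor
  · rintro ⟨h, hh, ⟨-, hs⟩, rfl⟩
    obtain ⟨s, hs', γ, rfl⟩ := mk_mem_realOrbit.1 hs
    have hsx : s.1 *ᵥ toReal x = toReal (γ.1ᵀ *ᵥ x) := by
      have h1 := mem_thetaH.1 hh
      change toReal x ᵥ* ((toRealSL γ).1 * s.1) = _ at h1
      have h2 : toReal x ᵥ* (toRealSL γ).1 = toReal (γ.1ᵀ *ᵥ x) := by
        rw [← Matrix.mulVec_transpose]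
        exact mulVec_toReal γ.transpose x
      rw [← Matrix.vecMul_vecMul, h2, ← Matrix.mulVec_transpose, ← inv_coe_of_mem_SO hs'] at h1
      exact mulVec_eq_iff.2 h1.symm
    obtain ⟨h1, h2⟩ := rescale_act_inv hg hs' rfl hsx
    refine ⟨γ.1ᵀ *ᵥ x, ⟨mulVec_primitive hx.1 γ.transpose, ?_⟩, _, h1, h2⟩
    have h3 := rotation_dotProduct hs' (toReal x) (toReal x)
    rw [hsx, toReal_dotProduct, toReal_dotProduct, hx.2] at h3
    exact_mod_cast h3
  · rintro ⟨y, hy, k, hk, rfl⟩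
    obtain ⟨δ, hδ⟩ := exists_SL_mulVec_eq_ehat hx.1
    obtain ⟨ε, hε⟩ := exists_SL_mulVec_eq_ehat hy.1
    let s : SL(3, ℝ) := k⁻¹ * g
    let γ : SL(3, ℤ) := (ε⁻¹ * δ).transpose
    have hs : s ∈ (SO 3).pts ℝ := mul_mem (inv_mem hk.1) hg.1
    have hγ : y = γ.1ᵀ *ᵥ x := by
      change y = (ε⁻¹.1 * δ.1)ᵀᵀ *ᵥ x
      rw [Matrix.transpose_transpose, ← Matrix.mulVec_mulVec, hδ, ← mulVec_eq_iff.1 hε]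
    have hsx : s.1 *ᵥ toReal x = toReal y := by
      change (k⁻¹.1 * g.1) *ᵥ toReal x = _
      rw [← Matrix.mulVec_mulVec, hg.2, ← hk.2, ← mulVec_eq_iff.1 rfl]
    obtain ⟨h1, h2⟩ := rescale_act_inv hg hs hγ hsx
    have hmem : toRealSL γ * s ∈ thetaH x := by
      rw [mem_thetaH]
      change toReal x ᵥ* ((toRealSL γ).1 * s.1) = _
      have h3 : toReal x ᵥ* (toRealSL γ).1 = toReal y := by
        rw [hγ, ← Matrix.mulVec_transpose]
        exact mulVec_toReal γ.transpose x
      rw [← Matrix.vecMul_vecMul, h3, ← Matrix.mulVec_transpose, ← inv_coe_of_mem_SO hs,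
        ← mulVec_eq_iff.1 hsx]
    refine ⟨_, hmem, ⟨mk_mem_realOrbit.2 ⟨_, hmem, 1, by rw [map_one, one_mul]⟩,
      mk_mem_realOrbit.2 ⟨s, hs, γ, rfl⟩⟩, ?_⟩
    rw [h2]
    congr 1
    change k = g * (k⁻¹ * g)⁻¹
    group

theorem gridCollection_subset {D : ℕ} {x : Fin 3 → ℤ} (hx : x ∈ primitivePoints D) {g : SL(3, ℝ)}
    (hg : IsRotationToEhat D x g) : gridCollection D x g ⊆ UnimodularCosets := by
  rw [gridCollection_eq hx hg]
  intro C hC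
  simp only [Set.mem_iUnion, exists_prop] at hC
  obtain ⟨y, hy, k, hk, rfl⟩ := hC
  exact rescale_mem_unimodularCosets (pos_of_primitive hx) hy hk

/-! ### Components of adelic points -/

/-- The real component of an adelic matrix. -/
abbrev realComp {n : ℕ} : SL(n, Adele) →* SL(n, ℝ) :=
  SpecialLinearGroup.map (RingHom.fst ℝ FinAdele)

/-- The component at `p` of an adelic matrix. -/
abbrev finComp {n : ℕ} (p : Nat.Primes) : SL(n, Adele) →* SL(n, ℚ_[(p : ℕ)]) :=
  SpecialLinearGroup.map (atPrime p)

/-- The subgroup `SL_n(ℤ_p)` of `SL_n(ℚ_p)`. -/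
def integralSL (n : ℕ) (p : Nat.Primes) : Subgroup SL(n, ℚ_[(p : ℕ)]) :=
  (SpecialLinearGroup.map (n := Fin n) (PadicInt.subring (p : ℕ)).subtype).range

theorem mem_integralSL {n : ℕ} {p : Nat.Primes} {g : SL(n, ℚ_[(p : ℕ)])} :
    g ∈ integralSL n p ↔ ∀ i j, g.1 i j ∈ PadicInt.subring (p : ℕ) := by
  constructor
  · rintro ⟨h, rfl⟩ i j
    exact (h.1 i j).2
  · intro h
    let A : Matrix (Fin n) (Fin n) (PadicInt.subring (p : ℕ)) := Matrix.of fun i j => ⟨_, h i j⟩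
    have hA : (PadicInt.subring (p : ℕ)).subtype.mapMatrix A = g.1 := rfl
    refine ⟨⟨A, Subtype.ext ?_⟩, Subtype.ext hA⟩
    have := RingHom.map_det (PadicInt.subring (p : ℕ)).subtype A
    rw [hA, g.2] at this
    exact this

theorem eventually_finComp_integral {n : ℕ} (g : SL(n, Adele)) :
    ∀ᶠ p : Nat.Primes in Filter.cofinite, finComp p g ∈ integralSL n p := by
  simp only [mem_integralSL]
  exact Filter.eventually_all.2 fun i => Filter.eventually_all.2 fun j => (g.1 i j).2.2

section Components

variable {n : ℕ} (M : AlgSubgroup n)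

theorem realComp_ofReal (r : M.pts ℝ) : realComp (M.ofReal r : SL(n, Adele)) = r := rfl

theorem finComp_ofReal (r : M.pts ℝ) (p : Nat.Primes) :
    finComp p (M.ofReal r : SL(n, Adele)) = 1 := by
  refine Subtype.ext (Matrix.ext fun i j => ?_)
  change (1 : Matrix (Fin n) (Fin n) FinAdele) i j p = (1 : Matrix (Fin n) (Fin n) _) i j
  rw [Matrix.one_apply, Matrix.one_apply]
  split_ifs <;> rfl

theorem mem_integral {k : M.pts Adele} : k ∈ M.integral ↔
    realComp (k : SL(n, Adele)) = 1 ∧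
      ∀ p, finComp p (k : SL(n, Adele)) ∈ integralSL n p := by
  constructor
  · intro h
    exact ⟨Subtype.ext (Matrix.ext fun i j => (h i j).1),
      fun p => mem_integralSL.2 fun i j => (h i j).2 p⟩
  · rintro ⟨h1, h2⟩ i j
    exact ⟨congrFun (congrFun (congrArg Subtype.val h1) i) j,
      fun p => mem_integralSL.1 (h2 p) i j⟩

theorem realClass_eq_iff (r s : M.pts ℝ) : M.realClass r = M.realClass s ↔
    ∃ γ : SL(n, ℤ), (s : SL(n, ℝ)) =
      SpecialLinearGroup.map (Int.castRingHom ℝ) γ * (r : SL(n, ℝ)) := by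
  have : M.realClass r = M.realClass s ↔ s * r⁻¹ ∈ M.int := by
    rw [realClass, realClass, Quotient.eq]
    exact QuotientGroup.rightRel_apply
  rw [this, int, Subgroup.mem_subgroupOf]
  refine exists_congr fun γ => ?_
  change _ = (s : SL(n, ℝ)) * (r : SL(n, ℝ))⁻¹ ↔ _
  rw [eq_mul_inv_iff_mul_eq, eq_comm]

/-- The projection of the class of `g` is computed from any rational `γ` for which the finite
components of `γ g` are integral. -/
theorem projectsTo_iff {g : M.pts Adele} {b : M.RealSpace} :
    M.ProjectsTo (M.adelicClass g) b ↔ ∃ γ ∈ M.pts ℚ, ∃ r : M.pts ℝ,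
      (r : SL(n, ℝ)) = baseSL ℝ γ * realComp (g : SL(n, Adele)) ∧
      (∀ p : Nat.Primes, baseSL ℚ_[(p : ℕ)] γ * finComp p (g : SL(n, Adele)) ∈ integralSL n p) ∧
      b = M.realClass r := by
  have hγ : ∀ γ : SL(n, ℚ), realComp (baseSL Adele γ) = baseSL ℝ γ := fun γ =>
    map_baseSL (RingHom.fst ℝ FinAdele) γ
  have hγp : ∀ (γ : SL(n, ℚ)) p, finComp p (baseSL Adele γ) = baseSL ℚ_[(p : ℕ)] γ := fun γ p =>
    map_baseSL (atPrime p) γ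
  constructor
  · rintro ⟨r, k, hk, e, rfl⟩
    obtain ⟨hk1, hk2⟩ := (mem_integral M).1 hk
    obtain ⟨γ, hγM, h⟩ := (adelicClass_eq_iff M _ _).1 e
    rw [Subgroup.coe_mul] at h
    refine ⟨γ, hγM, r, ?_, fun p => ?_, rfl⟩
    · have := congrArg realComp h
      rw [map_mul, map_mul, hk1, mul_one, hγ, realComp_ofReal] at this
      exact this
    · have := congrArg (finComp p) h
      rw [map_mul, map_mul, finComp_ofReal, one_mul, hγp] at this
      rw [← this]
      exact hk2 p
  · rintro ⟨γ, hγM, r, hr, hp, rfl⟩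
    let Γ : M.pts Adele := ⟨baseSL Adele γ, map_mem_pts M _ hγM⟩
    refine ⟨r, (M.ofReal r)⁻¹ * Γ * g, (mem_integral M).2 ⟨?_, fun p => ?_⟩,
      (adelicClass_eq_iff M _ _).2 ⟨γ, hγM, ?_⟩, rfl⟩
    · change realComp ((M.ofReal r : SL(n, Adele))⁻¹ * baseSL Adele γ * (g : SL(n, Adele))) = 1
      rw [map_mul, map_mul, map_inv, hγ, realComp_ofReal, mul_assoc, ← hr, inv_mul_cancel]
    · change finComp p ((M.ofReal r : SL(n, Adele))⁻¹ * baseSL Adele γ * (g : SL(n, Adele))) ∈ _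
      rw [map_mul, map_mul, map_inv, hγp, finComp_ofReal, inv_one, one_mul]
      exact hp p
    · change (M.ofReal r : SL(n, Adele)) *
        ((M.ofReal r : SL(n, Adele))⁻¹ * baseSL Adele γ * (g : SL(n, Adele))) = _
      group

theorem exists_intSL_of_integral {γ : SL(n, ℚ)}
    (h : ∀ p : Nat.Primes, baseSL ℚ_[(p : ℕ)] γ ∈ integralSL n p) :
    ∃ γ' : SL(n, ℤ), γ = SpecialLinearGroup.map (Int.castRingHom ℚ) γ' := by
  have hz : ∀ i j, ∃ z : ℤ, γ.1 i j = z := fun i j =>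
    exists_int_of_forall_padicInt fun p => mem_integralSL.1 (h p) i j
  choose z hz using hz
  have hA : (Int.castRingHom ℚ).mapMatrix (Matrix.of z) = γ.1 :=
    Matrix.ext fun i j => (hz i j).symm
  refine ⟨⟨Matrix.of z, ?_⟩, Subtype.ext hA.symm⟩
  have := RingHom.map_det (Int.castRingHom ℚ) (Matrix.of z)
  rw [hA, γ.2] at this
  exact Int.cast_injective (α := ℚ) (by simpa using this)

theorem toReal_of_rat_int (γ : SL(n, ℤ)) :
    baseSL ℝ (SpecialLinearGroup.map (Int.castRingHom ℚ) γ) =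
      SpecialLinearGroup.map (Int.castRingHom ℝ) γ := by
  refine Subtype.ext (Matrix.ext fun i j => ?_)
  change algebraMap ℚ ℝ ((γ.1 i j : ℤ) : ℚ) = ((γ.1 i j : ℤ) : ℝ)
  simp

theorem baseSL_int_mem (γ : SL(n, ℤ)) (p : Nat.Primes) :
    baseSL ℚ_[(p : ℕ)] (SpecialLinearGroup.map (Int.castRingHom ℚ) γ) ∈ integralSL n p := by
  rw [mem_integralSL]
  intro i j
  change algebraMap ℚ ℚ_[(p : ℕ)] ((γ.1 i j : ℤ) : ℚ) ∈ _
  rw [map_intCast]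
  exact intCast_mem _ _

/-- Two rational matrices that make the finite components integral differ by an integral matrix. -/
theorem projectsTo_unique {a : M.AdelicSpace} {b b' : M.RealSpace} (h : M.ProjectsTo a b)
    (h' : M.ProjectsTo a b') : b = b' := by
  induction a using Quotient.inductionOn with
  | h g =>
  obtain ⟨γ, hγ, r, hr, hp, rfl⟩ := (projectsTo_iff M).1 h
  obtain ⟨γ', hγ', r', hr', hp', rfl⟩ := (projectsTo_iff M).1 h'
  obtain ⟨ε, hε⟩ := exists_intSL_of_integral (γ := γ' * γ⁻¹) fun p => by
    have := mul_mem (hp' p) (inv_mem (hp p))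
    rw [map_mul, map_inv]
    convert this using 1
    group
  refine (realClass_eq_iff M r r').2 ⟨ε, ?_⟩
  rw [← toReal_of_rat_int, ← hε, hr, hr', map_mul, map_inv]
  group

end Components

/-! ### Strong approximation for `ASL_2` -/

theorem zpow_prime_mem_of_ne {p q : Nat.Primes} (h : q ≠ p) (n : ℤ) :
    ((((p : ℕ) : ℚ) ^ n : ℚ) : ℚ_[(q : ℕ)]) ∈ PadicInt.subring (q : ℕ) := by
  have h1 : ‖((p : ℕ) : ℚ_[(q : ℕ)])‖ = 1 := by
    rw [Padic.norm_natCast_eq_one_iff]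
    exact (Nat.coprime_primes q.2 p.2).2 fun e => h (Subtype.ext e)
  rw [PadicInt.mem_subring_iff, Rat.cast_zpow, Rat.cast_natCast, norm_zpow, h1, _root_.one_zpow]

/-- The ring `ℤ[1/p]` is dense in `ℚ_p`. -/
theorem exists_rat_near (p : Nat.Primes) (z : ℚ_[(p : ℕ)]) {ε : ℝ} (hε : 0 < ε) :
    ∃ r : ℚ, ‖(r : ℚ_[(p : ℕ)]) + z‖ ≤ ε ∧
      ∀ q : Nat.Primes, q ≠ p → (r : ℚ_[(q : ℕ)]) ∈ PadicInt.subring (q : ℕ) := by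
  have hp0 : ((p : ℕ) : ℚ_[(p : ℕ)]) ≠ 0 := Nat.cast_ne_zero.2 p.2.ne_zero
  have hpR : (0 : ℝ) < ((p : ℕ) : ℝ) := Nat.cast_pos.2 p.2.pos
  -- after multiplication by a power of `p`, density of `ℤ` in `ℤ_p` applies
  obtain ⟨n, hn⟩ : ∃ n : ℤ, ‖((p : ℕ) : ℚ_[(p : ℕ)]) ^ n * z‖ ≤ 1 := by
    rcases eq_or_ne z 0 with rfl | hz
    · exact ⟨0, by simp⟩
    · refine ⟨-z.valuation, ?_⟩
      rw [norm_mul, Padic.norm_p_zpow, Padic.norm_eq_zpow_neg_valuation hz,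
        ← zpow_add₀ hpR.ne']
      simp
  have hε' : 0 < ε * ((p : ℕ) : ℝ) ^ (-n) := mul_pos hε (zpow_pos hpR _)
  obtain ⟨N, hN⟩ := PadicInt.denseRange_intCast.exists_dist_lt
    (-⟨_, hn⟩ : ℤ_[(p : ℕ)]) hε'
  refine ⟨((p : ℕ) : ℚ) ^ (-n) * N, ?_, fun q hq => ?_⟩
  · rw [dist_eq_norm, ← norm_neg, neg_sub, PadicInt.norm_def] at hN
    simp only [PadicInt.coe_sub, PadicInt.coe_intCast] at hN
    change ‖(N : ℚ_[(p : ℕ)]) - -(((p : ℕ) : ℚ_[(p : ℕ)]) ^ n * z)‖ < _ at hN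
    rw [sub_neg_eq_add] at hN
    have e : (((((p : ℕ) : ℚ) ^ (-n) * N : ℚ)) : ℚ_[(p : ℕ)]) + z =
        ((p : ℕ) : ℚ_[(p : ℕ)]) ^ (-n) * (N + ((p : ℕ) : ℚ_[(p : ℕ)]) ^ n * z) := by
      rw [mul_add, ← mul_assoc, ← zpow_add₀ hp0]
      simp
    rw [e, norm_mul, Padic.norm_p_zpow, neg_neg]
    calc _ ≤ ((p : ℕ) : ℝ) ^ n * (ε * ((p : ℕ) : ℝ) ^ (-n)) :=
          mul_le_mul_of_nonneg_left hN.le (zpow_nonneg hpR.le _)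
      _ = ε := by
          rw [mul_comm ε, ← mul_assoc, ← zpow_add₀ hpR.ne']
          simp
  · rw [Rat.cast_mul, Rat.cast_intCast]
    exact mul_mem (zpow_prime_mem_of_ne hq _) (intCast_mem _ _)

/-- The affine matrix with linear part `(a b; c d)` and translation part `(x, y)`. -/
def affineSL {R : Type} [CommRing R] (a b c d x y : R) (h : a * d - b * c = 1) : SL(3, R) :=
  ⟨!![a, b, x; c, d, y; 0, 0, 1], by
    simp [Matrix.det_fin_three]
    linear_combination h⟩

theorem affineSL_mem {R : Type} [CommRing R] [Algebra ℚ R] (a b c d x y : R)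
    (h : a * d - b * c = 1) : affineSL a b c d x y h ∈ ASL2.pts R := by
  change (!![a, b, x; c, d, y; 0, 0, 1] : Matrix (Fin 3) (Fin 3) R) 2 = ehat R
  funext j
  fin_cases j <;> rfl

theorem exists_affineSL {R : Type} [CommRing R] [Algebra ℚ R] {g : SL(3, R)}
    (hg : g ∈ ASL2.pts R) : ∃ a b c d x y h, g = affineSL a b c d x y h := by
  have hr : g.1 2 = ehat R := hg
  have h0 : g.1 2 0 = 0 := by rw [hr]; rfl
  have h1 : g.1 2 1 = 0 := by rw [hr]; rfl
  have h2 : g.1 2 2 = 1 := by rw [hr]; rfl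
  refine ⟨g.1 0 0, g.1 0 1, g.1 1 0, g.1 1 1, g.1 0 2, g.1 1 2, ?_, Subtype.ext ?_⟩
  · have hd := g.2
    rw [Matrix.det_fin_three, h0, h1, h2] at hd
    linear_combination hd
  · ext i j
    fin_cases i <;> fin_cases j <;> first | rfl | exact h0 | exact h1 | exact h2

/-- Up to right multiplication by an integral matrix, a matrix in `SL_2(ℚ_p)` is upper
triangular: the column operation clears the lower left entry `c` by means of the larger of `c` and
the lower right entry `d`. -/
theorem exists_integral_mul_triangular (p : Nat.Primes) {g : SL(3, ℚ_[(p : ℕ)])}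
    (hg : g ∈ ASL2.pts ℚ_[(p : ℕ)]) : ∃ k ∈ integralSL 3 p, ∃ a b d x y h,
      g * k = affineSL a b 0 d x y h := by
  obtain ⟨a, b, c, d, x, y, h, rfl⟩ := exists_affineSL hg
  rcases le_or_gt ‖c‖ ‖d‖ with hcd | hcd
  · have hd : d ≠ 0 := by
      rintro rfl
      rw [norm_zero, norm_le_zero_iff] at hcd
      rw [hcd] at h
      simp at h
    refine ⟨affineSL 1 0 (-(c / d)) 1 0 0 (by ring), mem_integralSL.2 ?_, a - b * (c / d), b, d, x,
      y, ?_, Subtype.ext ?_⟩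
    · have hm : -(c / d) ∈ PadicInt.subring (p : ℕ) := by
        rw [PadicInt.mem_subring_iff, norm_neg, norm_div]
        exact div_le_one_of_le₀ hcd (norm_nonneg _)
      intro i j
      fin_cases i <;> fin_cases j <;> first | exact hm | exact one_mem _ | exact zero_mem _
    · field_simp
      linear_combination h
    · change !![a, b, x; c, d, y; 0, 0, 1] *
        !![1, 0, 0; -(c / d), 1, 0; 0, 0, 1] = !![_, _, _; _, _, _; _, _, _]
      ext i j
      fin_cases i <;> fin_cases j <;> simp [Matrix.mul_apply, Fin.sum_univ_three]
      · ring
      · field_simp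
        ring
  · have hc : c ≠ 0 := by
      rintro rfl
      rw [norm_zero] at hcd
      exact absurd hcd (not_lt.2 (norm_nonneg _))
    refine ⟨affineSL (-(d / c)) (-1) 1 0 0 0 (by ring), mem_integralSL.2 ?_, b - a * (d / c), -a,
      -c, x, y, ?_, Subtype.ext ?_⟩
    · have hm : -(d / c) ∈ PadicInt.subring (p : ℕ) := by
        rw [PadicInt.mem_subring_iff, norm_neg, norm_div]
        exact div_le_one_of_le₀ hcd.le (norm_nonneg _)
      intro i j
      fin_cases i <;> fin_cases j <;>
        first | exact hm | exact one_mem _ | exact zero_mem _ | exact neg_mem (one_mem _)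
    · field_simp
      linear_combination h
    · change !![a, b, x; c, d, y; 0, 0, 1] *
        !![-(d / c), -1, 0; 1, 0, 0; 0, 0, 1] = !![_, _, _; _, _, _; _, _, _]
      ext i j
      fin_cases i <;> fin_cases j <;> simp [Matrix.mul_apply, Fin.sum_univ_three]
      · ring
      · field_simp
        ring

/-- Strong approximation at one prime: a point of `ASL_2(ℚ_p)` is made integral by a point of
`ASL_2(ℤ[1/p])`. -/
theorem exists_rat_mul_integral (p : Nat.Primes) {g : SL(3, ℚ_[(p : ℕ)])}
    (hg : g ∈ ASL2.pts ℚ_[(p : ℕ)]) : ∃ γ ∈ ASL2.pts ℚ,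
      baseSL ℚ_[(p : ℕ)] γ * g ∈ integralSL 3 p ∧
        ∀ q : Nat.Primes, q ≠ p → baseSL ℚ_[(q : ℕ)] γ ∈ integralSL 3 q := by
  obtain ⟨k, hk, a, b, d, x, y, h, e⟩ := exists_integral_mul_triangular p hg
  have had : a * d = 1 := by linear_combination h
  have ha : a ≠ 0 := left_ne_zero_of_mul_eq_one had
  have hpQ : ((p : ℕ) : ℚ) ≠ 0 := Nat.cast_ne_zero.2 p.2.ne_zero
  have hpp : ((p : ℕ) : ℚ_[(p : ℕ)]) ≠ 0 := Nat.cast_ne_zero.2 p.2.ne_zero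
  have hpR : (0 : ℝ) < ((p : ℕ) : ℝ) := Nat.cast_pos.2 p.2.pos
  -- `π` is the power of `p` with the norm of `a`, and `γ` has linear part `(π⁻¹ r; 0 π)` and
  -- translation part `(s, t)`, with `r`, `s`, `t` in `ℤ[1/p]` making the other entries integral
  set n := a.valuation
  set π : ℚ_[(p : ℕ)] := ((p : ℕ) : ℚ_[(p : ℕ)]) ^ n with hπ
  set π' : ℚ_[(p : ℕ)] := ((p : ℕ) : ℚ_[(p : ℕ)]) ^ (-n) with hπ'
  have hππ : π' * π = 1 := by rw [hπ, hπ', ← zpow_add₀ hpp]; simp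
  have hna : ‖π‖ = ‖a‖ := by
    rw [Padic.norm_p_zpow, Padic.norm_eq_zpow_neg_valuation ha]
  have hn1 : ‖π'‖ * ‖a‖ = 1 := by rw [← hna, ← norm_mul, hππ, norm_one]
  have hn2 : ‖a‖ * ‖d‖ = 1 := by rw [← norm_mul, had, norm_one]
  obtain ⟨r, hr, hr'⟩ := exists_rat_near p (π' * b * a) (norm_pos_iff.2 ha)
  obtain ⟨s, hs, hs'⟩ := exists_rat_near p (π' * x + r * y) one_pos
  obtain ⟨t, ht, ht'⟩ := exists_rat_near p (π * y) one_pos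
  refine ⟨affineSL (((p : ℕ) : ℚ) ^ (-n)) r 0 (((p : ℕ) : ℚ) ^ n) s t ?_,
    affineSL_mem _ _ _ _ _ _ _, ?_, fun q hq => mem_integralSL.2 ?_⟩
  · rw [← zpow_add₀ hpQ]
    simp
  · rw [← mul_inv_cancel_right (_ * g) k]
    refine mul_mem ?_ (inv_mem hk)
    rw [mul_assoc, e, mem_integralSL]
    have hm : (baseSL ℚ_[(p : ℕ)] (affineSL (((p : ℕ) : ℚ) ^ (-n)) r 0 (((p : ℕ) : ℚ) ^ n) s t
        (by rw [← zpow_add₀ hpQ]; simp)) * affineSL a b 0 d x y h).1 =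
        !![π' * a, d * (r + π' * b * a), s + (π' * x + r * y); 0, π * d, t + π * y; 0, 0, 1] := by
      change (algebraMap ℚ ℚ_[(p : ℕ)]).mapMatrix !![((p : ℕ) : ℚ) ^ (-n), r, s;
        0, ((p : ℕ) : ℚ) ^ n, t; 0, 0, 1] * !![a, b, x; 0, d, y; 0, 0, 1] = _
      ext i j
      fin_cases i <;> fin_cases j <;>
        simp [Matrix.mul_apply, Fin.sum_univ_three, hπ, hπ']
      · linear_combination (-(((p : ℕ) : ℚ_[(p : ℕ)]) ^ n)⁻¹ * b) * had
      · ring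
      · ring
    rw [hm]
    have e1 : π' * a ∈ PadicInt.subring (p : ℕ) := by
      rw [PadicInt.mem_subring_iff, norm_mul, hn1]
    have e2 : π * d ∈ PadicInt.subring (p : ℕ) := by
      rw [PadicInt.mem_subring_iff, norm_mul, hna, hn2]
    have e3 : d * (r + π' * b * a) ∈ PadicInt.subring (p : ℕ) := by
      rw [PadicInt.mem_subring_iff, norm_mul]
      calc _ ≤ ‖d‖ * ‖a‖ := mul_le_mul_of_nonneg_left hr (norm_nonneg _)
        _ = 1 := by rw [mul_comm, hn2]
    intro i j
    fin_cases i <;> fin_cases j <;>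
      first
      | exact e1 | exact e2 | exact e3 | exact hs | exact ht | exact one_mem _ | exact zero_mem _
  · intro i j
    change algebraMap ℚ ℚ_[(q : ℕ)] ((!![((p : ℕ) : ℚ) ^ (-n), r, s;
        0, ((p : ℕ) : ℚ) ^ n, t; 0, 0, 1] : Matrix (Fin 3) (Fin 3) ℚ) i j) ∈ _
    have e0 : algebraMap ℚ ℚ_[(q : ℕ)] 0 ∈ PadicInt.subring (q : ℕ) := by
      rw [map_zero]; exact zero_mem _
    have e1 : algebraMap ℚ ℚ_[(q : ℕ)] 1 ∈ PadicInt.subring (q : ℕ) := by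
      rw [map_one]; exact one_mem _
    fin_cases i <;> fin_cases j <;>
      first | exact e0 | exact e1 | exact hr' q hq | exact hs' q hq | exact ht' q hq |
        exact zpow_prime_mem_of_ne hq _

/-- Strong approximation: `ASL_2(𝔸) = ASL_2(ℚ) ASL_2(ℝ) ASL_2(ℤ̂)`. -/
theorem exists_rat_mul_integral_forall (g : ASL2.pts Adele) : ∃ γ ∈ ASL2.pts ℚ,
    ∀ p : Nat.Primes, baseSL ℚ_[(p : ℕ)] γ * finComp p (g : SL(3, Adele)) ∈ integralSL 3 p := by
  -- the primes outside of `S` are those at which `γ g` is already integral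
  have main : ∀ (S : Finset Nat.Primes) (γ : SL(3, ℚ)), γ ∈ ASL2.pts ℚ →
      (∀ p ∉ S, baseSL ℚ_[(p : ℕ)] γ * finComp p (g : SL(3, Adele)) ∈ integralSL 3 p) →
      ∃ γ ∈ ASL2.pts ℚ,
        ∀ p : Nat.Primes, baseSL ℚ_[(p : ℕ)] γ * finComp p (g : SL(3, Adele)) ∈ integralSL 3 p := by
    intro S
    induction S using Finset.induction_on with
    | empty => exact fun γ hγ h => ⟨γ, hγ, fun p => h p (Finset.notMem_empty p)⟩
    | insert p S hpS ih =>
      intro γ hγ h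
      obtain ⟨ε, hε, h1, h2⟩ := exists_rat_mul_integral p
        (mul_mem (map_mem_pts ASL2 (algebraMap ℚ ℚ_[(p : ℕ)]) hγ)
          (map_mem_pts ASL2 (atPrime p) g.2))
      refine ih (ε * γ) (mul_mem hε hγ) fun q hq => ?_
      rw [map_mul, mul_assoc]
      rcases eq_or_ne q p with rfl | hqp
      · exact h1
      · exact mul_mem (h2 q hqp) (h q (by simp [hqp, hq]))
  refine main (eventually_finComp_integral (g : SL(3, Adele))).toFinset 1 (one_mem _) fun p hp => ?_
  rw [map_one, one_mul]
  by_contra hne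
  exact hp ((Set.Finite.mem_toFinset _).2 hne)

/-- The projection of `[ASL_2(𝔸)]` to `ASL_2(ℤ)\ASL_2(ℝ)` is a well-defined map. -/
theorem existsUnique_projectsTo (a : ASL2.AdelicSpace) : ∃! b, ASL2.ProjectsTo a b := by
  refine existsUnique_of_exists_of_unique ?_ fun b b' => projectsTo_unique ASL2
  induction a using Quotient.inductionOn with
  | h g =>
  obtain ⟨γ, hγ, h⟩ := exists_rat_mul_integral_forall g
  exact ⟨_, (projectsTo_iff ASL2).2 ⟨γ, hγ, ⟨baseSL ℝ γ * realComp (g : SL(3, Adele)),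
    mul_mem (map_mem_pts ASL2 _ hγ) (map_mem_pts ASL2 _ g.2)⟩, rfl, h, rfl⟩⟩

/-! ### Unimodular ternary forms -/

/-- `S` is the Gram matrix of a basis of determinant one of `ℝ³`. -/
def IsGram (S : Matrix (Fin 3) (Fin 3) ℤ) : Prop :=
  ∃ B : Matrix (Fin 3) (Fin 3) ℝ, B.det = 1 ∧ (Int.castRingHom ℝ).mapMatrix S = B * Bᵀ

theorem IsGram.conj {S : Matrix (Fin 3) (Fin 3) ℤ} (hS : IsGram S) (U : SL(3, ℤ)) :
    IsGram (U.1 * S * U.1ᵀ) := by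
  obtain ⟨B, hB, h⟩ := hS
  refine ⟨(Int.castRingHom ℝ).mapMatrix U.1 * B, ?_, ?_⟩
  · rw [Matrix.det_mul, hB, mul_one, ← RingHom.map_det, U.2, map_one]
  · rw [map_mul, map_mul, h, Matrix.transpose_mul]
    simp only [Matrix.mul_assoc]
    rfl

/-- The leading minors of a Gram matrix are positive and its determinant is one. -/
theorem IsGram.minors {S : Matrix (Fin 3) (Fin 3) ℤ} (hS : IsGram S) :
    0 < S 0 0 ∧ 0 < S 0 0 * S 1 1 - S 0 1 ^ 2 ∧ S.det = 1 ∧ Sᵀ = S := by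
  obtain ⟨B, hB, h⟩ := hS
  have hdet : S.det = 1 := by
    have := RingHom.map_det (Int.castRingHom ℝ) S
    rw [h, Matrix.det_mul, Matrix.det_transpose, hB, one_mul] at this
    exact Int.cast_injective (α := ℝ) (by simpa using this)
  have hsymm : Sᵀ = S := by
    have h1 : (Int.castRingHom ℝ).mapMatrix Sᵀ = (Int.castRingHom ℝ).mapMatrix S := by
      change ((Int.castRingHom ℝ).mapMatrix S)ᵀ = _
      rw [h, Matrix.transpose_mul, Matrix.transpose_transpose]
    exact Matrix.ext fun i j => Int.cast_injective (α := ℝ) (congrFun (congrFun h1 i) j)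
  have e : ∀ i j, (S i j : ℝ) = B i 0 * B j 0 + B i 1 * B j 1 + B i 2 * B j 2 := by
    intro i j
    have := congrFun (congrFun h i) j
    rw [Matrix.mul_apply, Fin.sum_univ_three] at this
    exact this
  rw [Matrix.det_fin_three] at hB
  refine ⟨?_, ?_, hdet, hsymm⟩
  · have h0 : (0 : ℝ) < S 0 0 := by
      rw [e]
      by_contra hle
      have h0 : B 0 0 = 0 := by
        nlinarith [mul_self_nonneg (B 0 0), mul_self_nonneg (B 0 1), mul_self_nonneg (B 0 2)]
      have h1 : B 0 1 = 0 := by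
        nlinarith [mul_self_nonneg (B 0 0), mul_self_nonneg (B 0 1), mul_self_nonneg (B 0 2)]
      have h2 : B 0 2 = 0 := by
        nlinarith [mul_self_nonneg (B 0 0), mul_self_nonneg (B 0 1), mul_self_nonneg (B 0 2)]
      rw [h0, h1, h2] at hB
      norm_num at hB
    exact_mod_cast h0
  · -- the minor is the square of the norm of the cross product of the first two rows
    set u := B 0 1 * B 1 2 - B 0 2 * B 1 1 with hu
    set v := B 0 2 * B 1 0 - B 0 0 * B 1 2 with hv
    set w := B 0 0 * B 1 1 - B 0 1 * B 1 0 with hw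
    have h3 : B 2 0 * u + B 2 1 * v + B 2 2 * w = 1 := by
      rw [← hB, hu, hv, hw]
      ring
    have h4 : ((S 0 0 * S 1 1 - S 0 1 ^ 2 : ℤ) : ℝ) = u * u + v * v + w * w := by
      push_cast
      rw [e, e, e, hu, hv, hw]
      ring
    have h5 : (0 : ℝ) < u * u + v * v + w * w := by
      by_contra hle
      have h0 : u = 0 := by
        nlinarith [mul_self_nonneg u, mul_self_nonneg v, mul_self_nonneg w]
      have h1 : v = 0 := by
        nlinarith [mul_self_nonneg u, mul_self_nonneg v, mul_self_nonneg w]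
      have h2 : w = 0 := by
        nlinarith [mul_self_nonneg u, mul_self_nonneg v, mul_self_nonneg w]
      rw [h0, h1, h2] at h3
      norm_num at h3
    rw [← h4] at h5
    exact_mod_cast h5

theorem exists_centered_residue {a : ℤ} (ha : 0 < a) (b : ℤ) :
    ∃ k : ℤ, 4 * (b + k * a) ^ 2 ≤ a ^ 2 := by
  refine ⟨-((2 * b + a) / (2 * a)), ?_⟩
  have h1 := Int.mul_ediv_add_emod (2 * b + a) (2 * a)
  have h2 := Int.emod_nonneg (2 * b + a) (show 2 * a ≠ 0 by omega)
  have h3 := Int.emod_lt_of_pos (2 * b + a) (show 0 < 2 * a by omega)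
  set q := (2 * b + a) / (2 * a)
  have h4 : 2 * (b + -q * a) = (2 * b + a) % (2 * a) - a := by linarith
  have h5 : 4 * (b + -q * a) ^ 2 = ((2 * b + a) % (2 * a) - a) ^ 2 := by rw [← h4]; ring
  rw [h5]
  nlinarith

/-- A positive definite integral ternary form of determinant one is equivalent to the sum of three
squares. A basis minimizing the sum of the first two leading minors `a` and `f` satisfies
`3 a² ≤ 4 f` and `3 f² ≤ 4 a`, as in Hermite's reduction, so that both minors are equal to one. -/
theorem IsGram.exists_eq_mul_transpose {S : Matrix (Fin 3) (Fin 3) ℤ} (hS : IsGram S) :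
    ∃ η : SL(3, ℤ), S = η.1 * η.1ᵀ := by
  let m : Matrix (Fin 3) (Fin 3) ℤ → ℤ := fun T => T 0 0 + (T 0 0 * T 1 1 - T 0 1 ^ 2)
  obtain ⟨U, hU⟩ : ∃ U : SL(3, ℤ), ∀ V : SL(3, ℤ),
      m (U.1 * S * U.1ᵀ) ≤ m (V.1 * (U.1 * S * U.1ᵀ) * V.1ᵀ) := by
    obtain ⟨U, -, hU⟩ := (measure fun U : SL(3, ℤ) => (m (U.1 * S * U.1ᵀ)).toNat).wf.has_min
      Set.univ ⟨1, trivial⟩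
    refine ⟨U, fun V => ?_⟩
    have h1 : ¬ (m ((V * U).1 * S * (V * U).1ᵀ)).toNat < (m (U.1 * S * U.1ᵀ)).toNat :=
      hU (V * U) trivial
    have h2 : (V * U).1 * S * (V * U).1ᵀ = V.1 * (U.1 * S * U.1ᵀ) * V.1ᵀ := by
      change V.1 * U.1 * S * (V.1 * U.1)ᵀ = _
      rw [Matrix.transpose_mul]
      simp only [Matrix.mul_assoc]
    rw [h2] at h1
    obtain ⟨p1, p2, -, -⟩ := (hS.conj U).minors
    obtain ⟨q1, q2, -, -⟩ := ((hS.conj U).conj V).minors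
    simp only [m] at h1 ⊢
    omega
  have hT := hS.conj U
  set T := U.1 * S * U.1ᵀ with hTdef
  obtain ⟨ha, hf, hdet, hsymm⟩ := hT.minors
  have h10 : T 1 0 = T 0 1 := congrFun (congrFun hsymm 0) 1
  have h20 : T 2 0 = T 0 2 := congrFun (congrFun hsymm 0) 2
  have h21 : T 2 1 = T 1 2 := congrFun (congrFun hsymm 1) 2
  rw [Matrix.det_fin_three, h10, h20, h21] at hdet
  have hent : ∀ (V : Matrix (Fin 3) (Fin 3) ℤ) i j, (V * T * Vᵀ) i j =
      (V i 0 * T 0 0 + V i 1 * T 1 0 + V i 2 * T 2 0) * V j 0 +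
      (V i 0 * T 0 1 + V i 1 * T 1 1 + V i 2 * T 2 1) * V j 1 +
      (V i 0 * T 0 2 + V i 1 * T 1 2 + V i 2 * T 2 2) * V j 2 := fun V i j => by
    simp only [Matrix.mul_apply, Fin.sum_univ_three, Matrix.transpose_apply]
  rw [h10, h20, h21] at hent
  -- `f`, `g` and `h` are the minors of `T` that contain the corner `a`
  set a := T 0 0 with haT
  set f := a * T 1 1 - T 0 1 ^ 2 with hfT
  set g := a * T 1 2 - T 0 1 * T 0 2 with hg
  set h := a * T 2 2 - T 0 2 ^ 2 with hh
  have hfh : f * h = a + g ^ 2 := by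
    rw [hfT, hg, hh]
    linear_combination a * hdet
  -- replacing the first basis vector by `e₁ + k e₀` preserves `f`
  have r1 : 3 * a ^ 2 ≤ 4 * f := by
    obtain ⟨k, hk⟩ := exists_centered_residue ha (T 0 1)
    have := hU ⟨!![k, 1, 0; -1, 0, 0; 0, 0, 1], by simp [Matrix.det_fin_three]⟩
    simp only [m, hent, ← haT, Matrix.of_apply, Matrix.cons_val_zero, Matrix.cons_val_one,
      Matrix.cons_val] at this
    have h1 : a ≤ T 1 1 + 2 * k * T 0 1 + k ^ 2 * a := by linarith
    have h2 : a * (T 1 1 + 2 * k * T 0 1 + k ^ 2 * a) = f + (T 0 1 + k * a) ^ 2 := by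
      rw [hfT]; ring
    nlinarith
  -- replacing the second basis vector by `e₂ + k e₁` preserves `a`
  have r2 : 3 * f ^ 2 ≤ 4 * a := by
    obtain ⟨k, hk⟩ := exists_centered_residue hf g
    have := hU ⟨!![1, 0, 0; 0, k, 1; 0, -1, 0], by simp [Matrix.det_fin_three]⟩
    simp only [m, hent, ← haT, Matrix.of_apply, Matrix.cons_val_zero, Matrix.cons_val_one,
      Matrix.cons_val] at this
    have h1 : f ≤ h + 2 * k * g + k ^ 2 * f := by
      rw [hg, hh]
      linarith
    have h2 : f * (h + 2 * k * g + k ^ 2 * f) = a + (g + k * f) ^ 2 := by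
      linear_combination hfh
    nlinarith
  have ha1 : a = 1 := by
    by_contra hne
    have : 2 ≤ a := by omega
    have : f < a := by nlinarith
    nlinarith
  have hf1 : f = 1 := by
    rw [ha1] at r2
    nlinarith
  -- with both leading minors equal to one, Gram-Schmidt orthogonalization is integral
  let V : SL(3, ℤ) := ⟨!![1, 0, 0; -T 0 1, 1, 0; g * T 0 1 - T 0 2, -g, 1], by
    simp [Matrix.det_fin_three]⟩
  rw [ha1] at hfT hg hh hfh
  rw [hf1] at hfT hfh
  have e11 : T 1 1 = 1 + T 0 1 ^ 2 := by linarith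
  have e12 : T 1 2 = g + T 0 1 * T 0 2 := by linarith
  have e22 : T 2 2 = 1 + g ^ 2 + T 0 2 ^ 2 := by linarith
  have hV : V.1 * T * V.1ᵀ = 1 := by
    ext i j
    rw [hent, ha1, e11, e12, e22]
    fin_cases i <;> fin_cases j <;> simp [V] <;> ring
  have hVU : S = (V * U)⁻¹.1 * (V * U)⁻¹.1ᵀ := by
    have h1 : (V * U).1 * S * (V * U).1ᵀ = 1 := by
      rw [← hV, hTdef]
      change V.1 * U.1 * S * (V.1 * U.1)ᵀ = _
      rw [Matrix.transpose_mul]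
      simp only [Matrix.mul_assoc]
    have h2 : (V * U).1ᵀ * (V * U)⁻¹.1ᵀ = 1 := by
      rw [← Matrix.transpose_mul, SL_inv_mul, Matrix.transpose_one]
    calc S = ((V * U)⁻¹.1 * (V * U).1) * S * ((V * U).1ᵀ * (V * U)⁻¹.1ᵀ) := by
          rw [SL_inv_mul, h2, Matrix.one_mul, Matrix.mul_one]
      _ = (V * U)⁻¹.1 * ((V * U).1 * S * (V * U).1ᵀ) * (V * U)⁻¹.1ᵀ := by
          simp only [Matrix.mul_assoc]
      _ = _ := by rw [h1, Matrix.mul_one]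
  exact ⟨_, hVU⟩

/-! ### Rational rotations between primitive points, integral at a given prime -/

/-- The rotation by the angle `π` about `w`. -/
theorem exists_half_turn {w : Fin 3 → ℚ} (hw : w ⬝ᵥ w ≠ 0) :
    ∃ h ∈ (SO 3).pts ℚ, h.1 = (2 / (w ⬝ᵥ w)) • vecMulVec w w - 1 := by
  have hc : 2 / (w ⬝ᵥ w) * (w ⬝ᵥ w) = 2 := div_mul_cancel₀ _ hw
  set c := 2 / (w ⬝ᵥ w)
  have hvv : vecMulVec w w * vecMulVec w w = (w ⬝ᵥ w) • vecMulVec w w := by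
    rw [Matrix.vecMulVec_mul_vecMulVec]
    ext i j
    simp [vecMulVec_apply]
    ring
  have hT : (vecMulVec w w)ᵀ = vecMulVec w w := by
    ext i j
    simp [vecMulVec_apply, mul_comm]
  refine ⟨⟨c • vecMulVec w w - 1, ?_⟩, ?_, rfl⟩
  · simp only [dotProduct, Fin.sum_univ_three] at hc
    simp [Matrix.det_fin_three, vecMulVec_apply]
    linear_combination hc
  · change (c • vecMulVec w w - 1)ᵀ * (c • vecMulVec w w - 1) = 1
    rw [Matrix.transpose_sub, Matrix.transpose_smul, hT, Matrix.transpose_one, Matrix.sub_mul,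
      Matrix.mul_sub, Matrix.smul_mul, Matrix.mul_smul, hvv, smul_smul, smul_smul]
    have e : c * c * (w ⬝ᵥ w) = c + c := by rw [mul_assoc, hc]; ring
    rw [e, Matrix.mul_one, Matrix.one_mul, add_smul]
    abel

/-- A sum of three squares is divisible by `4` only if the three terms are even, so that the powers
of two can be divided out one at a time. -/
theorem two_pow_dvd_of_sum_sq {a b c m : ℤ} (k : ℕ) (h : a ^ 2 + b ^ 2 + c ^ 2 = (2 ^ k * m) ^ 2) :
    2 ^ k ∣ a ∧ 2 ^ k ∣ b ∧ 2 ^ k ∣ c := by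
  induction k generalizing a b c with
  | zero => simp
  | succ k ih =>
    have h4 : (a ^ 2 + b ^ 2 + c ^ 2) % 4 = 0 := by
      rw [h, show (2 ^ (k + 1) * m) ^ 2 = 4 * (2 ^ k * m) ^ 2 by ring]
      omega
    have sq4 : ∀ z : ℤ, z % 2 = 0 ∧ z ^ 2 % 4 = 0 ∨ z ^ 2 % 4 = 1 := by
      intro z
      rcases Int.even_or_odd' z with ⟨w, rfl | rfl⟩
      · exact Or.inl ⟨by omega, by ring_nf; omega⟩
      · exact Or.inr (by ring_nf; omega)
    have ha := sq4 a
    have hb := sq4 b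
    have hc := sq4 c
    obtain ⟨a', rfl⟩ : (2 : ℤ) ∣ a := by omega
    obtain ⟨b', rfl⟩ : (2 : ℤ) ∣ b := by omega
    obtain ⟨c', rfl⟩ : (2 : ℤ) ∣ c := by omega
    obtain ⟨h1, h2, h3⟩ := ih (a := a') (b := b') (c := c') (by
      have h5 : 4 * (a' ^ 2 + b' ^ 2 + c' ^ 2) = 4 * (2 ^ k * m) ^ 2 := by
        rw [pow_succ 2 k] at h
        linear_combination h
      omega)
    rw [pow_succ, mul_comm (2 ^ k) (2 : ℤ)]
    exact ⟨mul_dvd_mul_left 2 h1, mul_dvd_mul_left 2 h2, mul_dvd_mul_left 2 h3⟩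

/-- A rational vector of norm one is integral at `2`, since a sum of three squares is divisible
by `4` only if the three terms are even. -/
theorem rat_integral_two_of_sum_sq {p : Nat.Primes} (hp : (p : ℕ) = 2) {u : Fin 3 → ℚ}
    (hu : u ⬝ᵥ u = 1) (i : Fin 3) : (u i : ℚ_[(p : ℕ)]) ∈ PadicInt.subring (p : ℕ) := by
  set d : ℕ := (u 0).den * (u 1).den * (u 2).den with hd
  have hd0 : d ≠ 0 := by positivity
  obtain ⟨k, m, hm, hkm⟩ := Nat.exists_eq_two_pow_mul_odd hd0
  have hnum : ∀ j, ∃ z : ℤ, u j * d = z := by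
    intro j
    have hj : u j * (u j).den = (u j).num := Rat.mul_den_eq_num _
    fin_cases j
    · refine ⟨(u 0).num * (u 1).den * (u 2).den, ?_⟩
      push_cast [hd]
      rw [← Rat.mul_den_eq_num (u 0)]
      ring
    · refine ⟨(u 1).num * (u 0).den * (u 2).den, ?_⟩
      push_cast [hd]
      rw [← Rat.mul_den_eq_num (u 1)]
      ring
    · refine ⟨(u 2).num * (u 0).den * (u 1).den, ?_⟩
      push_cast [hd]
      rw [← Rat.mul_den_eq_num (u 2)]
      ring
  choose z hz using hnum
  have hsum : z 0 ^ 2 + z 1 ^ 2 + z 2 ^ 2 = (2 ^ k * (m : ℤ)) ^ 2 := by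
    have h1 : (d : ℚ) = 2 ^ k * m := by rw [hkm]; push_cast; ring
    have h2 : ((z 0 ^ 2 + z 1 ^ 2 + z 2 ^ 2 : ℤ) : ℚ) = ((2 ^ k * (m : ℤ)) ^ 2 : ℤ) := by
      push_cast
      rw [← h1, ← hz, ← hz, ← hz]
      simp only [dotProduct, Fin.sum_univ_three] at hu
      linear_combination (d : ℚ) ^ 2 * hu
    exact_mod_cast h2
  have hdvd : (2 : ℤ) ^ k ∣ z i := by
    obtain ⟨h0, h1, h2⟩ := two_pow_dvd_of_sum_sq k hsum
    fin_cases i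
    exacts [h0, h1, h2]
  obtain ⟨w, hw⟩ := hdvd
  have hm0 : (m : ℚ) ≠ 0 := by
    rintro h
    rw [Nat.cast_eq_zero] at h
    rw [h] at hm
    exact absurd hm (by decide)
  have hu' : u i = w / m := by
    have h1 := hz i
    rw [hw, hkm] at h1
    push_cast at h1
    rw [eq_div_iff hm0]
    have : (2 : ℚ) ^ k ≠ 0 := by positivity
    apply mul_left_cancel₀ this
    linear_combination h1
  rw [rat_mem_padicInt_iff]
  intro h2
  rw [hp] at h2
  have h3 : (u i).den ∣ m := by
    rw [hu']
    exact_mod_cast Rat.den_dvd w m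
  exact (Nat.not_even_iff_odd.2 hm) (even_iff_two_dvd.2 (h2.trans h3))

theorem baseVec_int (R : Type) [CommRing R] [Algebra ℚ R] (x : Fin 3 → ℤ) :
    baseVec R (fun i => (x i : ℚ)) = fun i => (x i : R) :=
  funext fun _ => map_intCast _ _

/-- For a prime `p ≠ 2`, two integral vectors of norm `D` that are nonzero modulo `p` satisfy
`D + ⟨σ x, y⟩ ≠ 0` modulo `p` for some rotation `σ` of the cube: otherwise all the products
`x_i y_j` would vanish modulo `p`. -/
theorem exists_cube_rotation {p : ℕ} (hp : p.Prime) (hp2 : p ≠ 2) {D : ℤ} {x y : Fin 3 → ℤ}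
    (hx : ∃ i, ¬ (p : ℤ) ∣ x i) (hy : ∃ i, ¬ (p : ℤ) ∣ y i) :
    ∃ σ : SL(3, ℤ), σ.1ᵀ * σ.1 = 1 ∧ ¬ (p : ℤ) ∣ D + (σ.1 *ᵥ x) ⬝ᵥ y := by
  by_contra hcon
  push Not at hcon
  have : Fact p.Prime := ⟨hp⟩
  have key : ∀ A : Matrix (Fin 3) (Fin 3) ℤ, A.det = 1 → Aᵀ * A = 1 →
      (((D + (A *ᵥ x) ⬝ᵥ y : ℤ)) : ZMod p) = 0 := fun A hA hA' =>
    (ZMod.intCast_zmod_eq_zero_iff_dvd _ p).2 (hcon ⟨A, hA⟩ hA')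
  have two : (2 : ZMod p) ≠ 0 := by
    intro h
    have h2 : ((2 : ℕ) : ZMod p) = 0 := h
    rw [ZMod.natCast_eq_zero_iff] at h2
    exact hp2 ((Nat.prime_dvd_prime_iff_eq hp Nat.prime_two).1 h2)
  have c2 : ∀ z : ZMod p, 2 * z = 0 → z = 0 := fun z hz => (mul_eq_zero.1 hz).resolve_left two
  -- the identity and the half-turns about the axes: the four values sum to `4 D`, and the sums of
  -- the first one with each of the others then give the `2 x_i y_i`
  have k1 := key !![1, 0, 0; 0, 1, 0; 0, 0, 1] (by decide) (by decide)
  have k2 := key !![1, 0, 0; 0, -1, 0; 0, 0, -1] (by decide) (by decide)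
  have k3 := key !![-1, 0, 0; 0, 1, 0; 0, 0, -1] (by decide) (by decide)
  have k4 := key !![-1, 0, 0; 0, -1, 0; 0, 0, 1] (by decide) (by decide)
  -- the remaining rotations isolate the products `x_i y_j` with `i ≠ j`
  have k5 := key !![0, -1, 0; 1, 0, 0; 0, 0, 1] (by decide) (by decide)
  have k6 := key !![0, 1, 0; 1, 0, 0; 0, 0, -1] (by decide) (by decide)
  have k7 := key !![1, 0, 0; 0, 0, -1; 0, 1, 0] (by decide) (by decide)
  have k8 := key !![-1, 0, 0; 0, 0, 1; 0, 1, 0] (by decide) (by decide)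
  have k9 := key !![0, 0, 1; 0, 1, 0; -1, 0, 0] (by decide) (by decide)
  have k10 := key !![0, 0, 1; 0, -1, 0; 1, 0, 0] (by decide) (by decide)
  simp only [Matrix.mulVec, dotProduct, Fin.sum_univ_three, Matrix.of_apply, Matrix.cons_val_zero,
    Matrix.cons_val_one, Matrix.cons_val] at k1 k2 k3 k4 k5 k6 k7 k8 k9 k10
  push_cast at k1 k2 k3 k4 k5 k6 k7 k8 k9 k10
  have hD : (D : ZMod p) = 0 := c2 _ (c2 _ (by linear_combination k1 + k2 + k3 + k4))
  have p00 : (x 0 * y 0 : ZMod p) = 0 := c2 _ (by linear_combination k1 + k2 - 2 * hD)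
  have p11 : (x 1 * y 1 : ZMod p) = 0 := c2 _ (by linear_combination k1 + k3 - 2 * hD)
  have p22 : (x 2 * y 2 : ZMod p) = 0 := c2 _ (by linear_combination k1 + k4 - 2 * hD)
  have p01 : (x 0 * y 1 : ZMod p) = 0 := c2 _ (by linear_combination k5 + k6 - 2 * hD)
  have p10 : (x 1 * y 0 : ZMod p) = 0 := by linear_combination k6 - hD - p01 + p22
  have p12 : (x 1 * y 2 : ZMod p) = 0 := c2 _ (by linear_combination k7 + k8 - 2 * hD)
  have p21 : (x 2 * y 1 : ZMod p) = 0 := by linear_combination k8 - hD - p12 + p00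
  have p20 : (x 2 * y 0 : ZMod p) = 0 := c2 _ (by linear_combination k9 + k10 - 2 * hD)
  have p02 : (x 0 * y 2 : ZMod p) = 0 := by linear_combination k10 - hD - p20 + p11
  obtain ⟨i, hi⟩ := hx
  obtain ⟨j, hj⟩ := hy
  rw [← ZMod.intCast_zmod_eq_zero_iff_dvd] at hi hj
  refine mul_ne_zero hi hj ?_
  fin_cases i <;> fin_cases j <;>
    first
    | exact p00 | exact p01 | exact p02 | exact p10 | exact p11 | exact p12 | exact p20
    | exact p21 | exact p22

theorem exists_not_dvd_of_primitive {D : ℕ} {x : Fin 3 → ℤ} (hx : x ∈ primitivePoints D) {p : ℕ}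
    (hp : p.Prime) : ∃ i, ¬ (p : ℤ) ∣ x i := by
  by_contra! h
  exact (Nat.prime_iff_prime_int.1 hp).not_isUnit (hx.1 _ h)

/-- With `σ` as in `exists_cube_rotation`, the half-turn about `w = σ x + y` exchanges `σ x` and
`y`. It is integral at `p` because `⟨w, w⟩ / 2 = D + ⟨σ x, y⟩` is prime to `p`. -/
theorem exists_rat_rotation_of_odd {D : ℕ} {x y : Fin 3 → ℤ} (hx : x ∈ primitivePoints D)
    (hy : y ∈ primitivePoints D) {p : Nat.Primes} (hp : (p : ℕ) ≠ 2) :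
    ∃ ρ ∈ (SO 3).pts ℚ, ρ.1 *ᵥ (fun i => (x i : ℚ)) = (fun i => (y i : ℚ)) ∧
      baseSL ℚ_[(p : ℕ)] ρ ∈ integralSL 3 p := by
  obtain ⟨σ, hσ, hdvd⟩ := exists_cube_rotation p.2 hp (D := D) (exists_not_dvd_of_primitive hx p.2)
    (exists_not_dvd_of_primitive hy p.2)
  set x' := σ.1 *ᵥ x with hx'
  have hσx : x' ⬝ᵥ x' = D := by
    rw [hx', Matrix.dotProduct_mulVec, ← Matrix.mulVec_transpose, Matrix.mulVec_mulVec, hσ,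
      Matrix.one_mulVec, hx.2]
  set s : ℤ := D + x' ⬝ᵥ y with hs
  have hs0 : s ≠ 0 := fun h => hdvd (by rw [h]; exact dvd_zero _)
  have hs0' : (s : ℚ) ≠ 0 := Int.cast_ne_zero.2 hs0
  set w : Fin 3 → ℚ := fun i => ((x' i + y i : ℤ) : ℚ) with hw
  have hyy := hy.2
  simp only [dotProduct, Fin.sum_univ_three] at hσx hs hyy
  have hww : w ⬝ᵥ w = 2 * s := by
    have : (x' 0 + y 0) * (x' 0 + y 0) + (x' 1 + y 1) * (x' 1 + y 1) +
        (x' 2 + y 2) * (x' 2 + y 2) = 2 * s := by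
      rw [hs]
      linear_combination hσx + hyy
    simp only [dotProduct, Fin.sum_univ_three, hw]
    exact_mod_cast this
  have hwx : w ⬝ᵥ (fun i => (x' i : ℚ)) = s := by
    have : (x' 0 + y 0) * x' 0 + (x' 1 + y 1) * x' 1 + (x' 2 + y 2) * x' 2 = s := by
      rw [hs]
      linear_combination hσx
    simp only [dotProduct, Fin.sum_univ_three, hw]
    exact_mod_cast this
  obtain ⟨h, hO, hh⟩ := exists_half_turn (w := w) (by
    rw [hww]
    exact mul_ne_zero two_ne_zero hs0')
  have hc : 2 / (w ⬝ᵥ w) = (s : ℚ)⁻¹ := by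
    rw [hww]
    field_simp
  rw [hc] at hh
  have hσO : SpecialLinearGroup.map (Int.castRingHom ℚ) σ ∈ (SO 3).pts ℚ := by
    rw [mem_SO]
    have := congrArg (Int.castRingHom ℚ).mapMatrix hσ
    rw [map_mul, map_one] at this
    exact this
  refine ⟨h * SpecialLinearGroup.map (Int.castRingHom ℚ) σ, mul_mem hO hσO, ?_, ?_⟩
  · change (h.1 * (Int.castRingHom ℚ).mapMatrix σ.1) *ᵥ _ = _
    have h1 : (Int.castRingHom ℚ).mapMatrix σ.1 *ᵥ (fun i => (x i : ℚ)) =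
        fun i => (x' i : ℚ) := by
      funext i
      simp [hx', Matrix.mulVec, dotProduct]
    rw [← Matrix.mulVec_mulVec, h1, hh, Matrix.sub_mulVec, Matrix.smul_mulVec, vecMulVec_mulVec',
      hwx, smul_smul, inv_mul_cancel₀ hs0', one_smul, Matrix.one_mulVec]
    funext i
    simp [hw]
  · rw [map_mul]
    refine mul_mem (mem_integralSL.2 fun i j => ?_) (baseSL_int_mem σ p)
    have h1 : h.1 i j = (s : ℚ)⁻¹ * ((x' i + y i : ℤ) * (x' j + y j : ℤ)) -
        (1 : Matrix (Fin 3) (Fin 3) ℤ) i j := by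
      rw [hh]
      simp [vecMulVec_apply, Matrix.one_apply, hw]
    change algebraMap ℚ ℚ_[(p : ℕ)] (h.1 i j) ∈ _
    rw [h1, map_sub, map_mul, map_mul, map_intCast, map_intCast, map_intCast, map_inv₀,
      map_intCast]
    refine sub_mem (mul_mem ?_ (mul_mem (intCast_mem _ _) (intCast_mem _ _))) (intCast_mem _ _)
    have h2 : ‖(s : ℚ_[(p : ℕ)])‖ = 1 := by
      refine le_antisymm (Padic.norm_int_le_one s) (not_lt.1 fun hlt => hdvd ?_)
      exact Padic.norm_intCast_lt_one_iff.1 hlt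
    rw [PadicInt.mem_subring_iff, norm_inv, h2, inv_one]

/-- Any two primitive points of norm `√D` are related, for every prime `p`, by a rational rotation
that is integral at `p`. -/
theorem exists_rat_rotation {D : ℕ} {x y : Fin 3 → ℤ} (hx : x ∈ primitivePoints D)
    (hy : y ∈ primitivePoints D) (p : Nat.Primes) :
    ∃ ρ ∈ (SO 3).pts ℚ, ρ.1 *ᵥ (fun i => (x i : ℚ)) = (fun i => (y i : ℚ)) ∧
      baseSL ℚ_[(p : ℕ)] ρ ∈ integralSL 3 p := by
  by_cases hp : (p : ℕ) = 2
  · -- every rational rotation is integral at `2`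
    obtain ⟨ρ, hρ, h, -⟩ := exists_rat_rotation_of_odd hx hy (p := ⟨3, Nat.prime_three⟩)
      (by norm_num)
    refine ⟨ρ, hρ, h, mem_integralSL.2 fun i j => ?_⟩
    have hcol : (fun k => ρ.1 k j) ⬝ᵥ (fun k => ρ.1 k j) = 1 := by
      have := congrFun (congrFun (mem_SO.1 hρ) j) j
      rw [Matrix.one_apply_eq] at this
      exact this
    exact rat_integral_two_of_sum_sq hp hcol i
  · exact exists_rat_rotation_of_odd hx hy hp

/-! ### The normalizer of `SO_2(ℝ)` and the choice of `g_∞` -/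

theorem baseVec_ehat (R : Type) [CommRing R] [Algebra ℚ R] : baseVec R (ehat ℚ) = ehat R := by
  funext i
  fin_cases i <;> simp [baseVec, ehat]

theorem ehat_norm : ehat ℚ ⬝ᵥ ehat ℚ ≠ 0 := by
  simp [ehat, dotProduct, Fin.sum_univ_three]

theorem Kinf_eq_axisTorus : Kinf = (axisTorus (ehat ℚ)).pts ℝ := by
  ext g
  constructor
  · rintro ⟨h1, -, h2⟩
    exact ⟨h1, h2⟩
  · intro h
    refine ⟨h.1, ?_, h.2⟩
    have h1 := ((mem_axisTorus_iff_commute ehat_norm).1 h).1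
    rw [baseVec_ehat] at h1
    exact mem_ASL2.2 h1

theorem mem_Kinf {g : SL(3, ℝ)} : g ∈ Kinf ↔ g ∈ (SO 3).pts ℝ ∧ g.1 *ᵥ ehat ℝ = ehat ℝ := by
  rw [Kinf_eq_axisTorus, mem_axisTorus, baseVec_ehat]
  exact Iff.rfl

theorem diagSL_eq (c : ℝ) (hc : c ≠ 0) : (diagSL c hc).1 =
    c • 1 + ((c ^ 2)⁻¹ - c) • vecMulVec (ehat ℝ) (ehat ℝ) := by
  ext i j
  fin_cases i <;> fin_cases j <;> simp [diagSL, ehat]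

/-- `diag(c, c, c⁻²)` acts by scalars on `ê` and on `ê^⊥`, which `SO_2(ℝ)` preserves. -/
theorem diagSL_commute (c : ℝ) (hc : c ≠ 0) {κ : SL(3, ℝ)} (hκ : κ ∈ Kinf) :
    diagSL c hc * κ = κ * diagSL c hc := by
  have h1 : ehat ℝ ᵥ* κ.1 = ehat ℝ := mem_ASL2.1 hκ.2.1
  have h2 := (mem_Kinf.1 hκ).2
  refine Subtype.ext ?_
  change (diagSL c hc).1 * κ.1 = κ.1 * (diagSL c hc).1
  rw [diagSL_eq, Matrix.add_mul, Matrix.mul_add, Matrix.smul_mul, Matrix.mul_smul,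
    Matrix.smul_mul, Matrix.mul_smul, Matrix.vecMulVec_mul, Matrix.mul_vecMulVec, h1, h2,
    Matrix.one_mul, Matrix.mul_one]

/-- A point of `ASL_2(ℝ)` that normalizes `SO_2(ℝ)` lies in it. It maps the rotation by a right
angle to that rotation or to its inverse, and the latter would make its determinant negative. -/
theorem mem_Kinf_of_normalizes {n : SL(3, ℝ)} (hn : n ∈ ASL2.pts ℝ)
    (h : ∀ κ ∈ Kinf, n⁻¹ * κ * n ∈ Kinf) : n ∈ Kinf := by
  let J : SL(3, ℝ) := rotSL (R := ℝ) ehat_norm 0 1 (by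
    simp [ehat, dotProduct, Fin.sum_univ_three])
  have hJ : J ∈ Kinf := by
    rw [Kinf_eq_axisTorus]
    exact rotSL_mem _ _ _ _
  have hJn := h J hJ
  rw [Kinf_eq_axisTorus] at hJn
  obtain ⟨a, b, hab, e⟩ := exists_rotSL ehat_norm hJn
  set X := crossMat (ehat ℝ) with hX
  have e1 : J.1 * n.1 = n.1 * (rotSL ehat_norm a b hab).1 := by
    rw [← e]
    change J.1 * n.1 = n.1 * (n⁻¹.1 * J.1 * n.1)
    rw [← Matrix.mul_assoc, ← Matrix.mul_assoc, SL_mul_inv, Matrix.one_mul]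
  have hJO : J ∈ (SO 3).pts ℝ := hJ.1
  have hRO : rotSL (R := ℝ) ehat_norm a b hab ∈ (SO 3).pts ℝ := (rotSL_mem ehat_norm a b hab).1
  have e2 : J.1ᵀ * n.1 = n.1 * (rotSL (R := ℝ) ehat_norm a b hab).1ᵀ := by
    rw [← inv_coe_of_mem_SO hJO, ← inv_coe_of_mem_SO hRO, ← e]
    have : (n⁻¹ * J * n)⁻¹ = n⁻¹ * J⁻¹ * n := by group
    rw [this]
    change J⁻¹.1 * n.1 = n.1 * (n⁻¹.1 * J⁻¹.1 * n.1)
    rw [← Matrix.mul_assoc, ← Matrix.mul_assoc, SL_mul_inv, Matrix.one_mul]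
  have e3 : X * n.1 = b • (n.1 * X) := by
    have h1 : ∀ a b : ℝ, rot (baseVec ℝ (ehat ℚ)) (algebraMap ℚ ℝ (ehat ℚ ⬝ᵥ ehat ℚ)⁻¹) a b -
        (rot (baseVec ℝ (ehat ℚ)) (algebraMap ℚ ℝ (ehat ℚ ⬝ᵥ ehat ℚ)⁻¹) a b)ᵀ =
          (2 * b) • X := by
      intro a b
      rw [rot_transpose, rot, rot, baseVec_ehat]
      ext i j
      simp only [Matrix.sub_apply, Matrix.add_apply, Matrix.smul_apply, smul_eq_mul, hX]
      ring
    have h2 : (J.1 - J.1ᵀ) * n.1 =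
        n.1 * ((rotSL (R := ℝ) ehat_norm a b hab).1 -
          (rotSL (R := ℝ) ehat_norm a b hab).1ᵀ) := by
      rw [Matrix.sub_mul, Matrix.mul_sub, e1, e2]
    change (rot _ _ _ _ - (rot _ _ _ _)ᵀ) * _ = _ * (rot _ _ _ _ - (rot _ _ _ _)ᵀ) at h2
    rw [h1, h1, Matrix.smul_mul, Matrix.mul_smul] at h2
    ext i j
    have := congrFun (congrFun h2 i) j
    simp only [Matrix.smul_apply, smul_eq_mul] at this ⊢
    linarith
  obtain ⟨p, q, r, s, x, y, hd, hneq⟩ := exists_affineSL hn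
  -- `X n = b n X` gives `b (p² + r²) = det n = 1` and `b² = 1`
  have hb : b = 1 := by
    have entry := fun i j => congrFun (congrFun e3 i) j
    have hn1 : n.1 = !![p, q, x; r, s, y; 0, 0, 1] := congrArg Subtype.val hneq
    have t00 := entry 0 0
    have t01 := entry 0 1
    have t10 := entry 1 0
    have t11 := entry 1 1
    simp [hn1, hX, crossMat, ehat, Matrix.mul_apply, Fin.sum_univ_three] at t00 t01 t10 t11
    have h1 : b * (p ^ 2 + r ^ 2) = 1 := by
      linear_combination hd - p * t01 + r * t11
    have h2 : (p ^ 2 + r ^ 2) = b ^ 2 * (p ^ 2 + r ^ 2) := by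
      linear_combination p * t10 + b * p * t01 - r * t00 - b * r * t11
    have h3 : 0 < b := by
      by_contra hle
      nlinarith [sq_nonneg p, sq_nonneg r]
    have h4 : b ^ 2 = 1 := by
      have h5 : p ^ 2 + r ^ 2 ≠ 0 := right_ne_zero_of_mul_eq_one h1
      exact mul_right_cancel₀ h5 (by rw [one_mul]; exact h2.symm)
    nlinarith
  rw [Kinf_eq_axisTorus, mem_axisTorus_iff_commute ehat_norm, baseVec_ehat]
  refine ⟨mem_ASL2.1 hn, ?_⟩
  rw [hb, one_smul] at e3
  exact e3.symm

section GridTorus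

variable {D : ℕ} {x : Fin 3 → ℤ}

theorem axis_dotProduct (hx : x ∈ primitivePoints D) :
    (fun i => (x i : ℚ)) ⬝ᵥ (fun i => (x i : ℚ)) = D := by
  have h2 : (fun i => (x i : ℚ)) ⬝ᵥ (fun i => (x i : ℚ)) = ((x ⬝ᵥ x : ℤ) : ℚ) := by
    simp [dotProduct]
  rw [h2, hx.2]
  rfl

theorem norm_ne_zero (hx : x ∈ primitivePoints D) :
    (fun i => (x i : ℚ)) ⬝ᵥ (fun i => (x i : ℚ)) ≠ 0 := by
  rw [axis_dotProduct hx]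
  exact_mod_cast (pos_of_primitive hx).ne'

/-- An integral matrix over `ℚ`. -/
abbrev toRatSL : SL(3, ℤ) →* SL(3, ℚ) := SpecialLinearGroup.map (Int.castRingHom ℚ)

theorem mulVec_toRat (g : SL(3, ℤ)) (m : Fin 3 → ℤ) :
    (toRatSL g).1 *ᵥ (fun i => (m i : ℚ)) = fun i => ((g.1 *ᵥ m) i : ℚ) := by
  funext i
  simp [Matrix.mulVec, dotProduct]

theorem intCast_ehat {R : Type} [CommRing R] : (fun i => (ehat ℤ i : R)) = ehat R := by
  funext i
  fin_cases i <;> simp [ehat]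

theorem cartan_last_row {δ : SL(3, ℤ)} (hδ : δ.1 *ᵥ x = ehat ℤ) :
    (toRatSL (cartan ℤ δ)).1 2 = fun i => (x i : ℚ) := by
  rw [← ehat_vecMul (toRatSL (cartan ℤ δ)).1, map_cartan, vecMul_cartan, ← map_inv, ← intCast_ehat,
    mulVec_toRat, ← mulVec_eq_iff.1 hδ]

theorem mem_torus_real {t : SL(3, ℝ)} :
    t ∈ (torus x).pts ℝ ↔ t ∈ (SO 3).pts ℝ ∧ t.1 *ᵥ toReal x = toReal x := by
  have : baseVec ℝ (fun i => (x i : ℚ)) = toReal x := baseVec_int ℝ x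
  rw [torus_eq_axisTorus, mem_axisTorus, this]
  exact Iff.rfl

theorem map_conj_torus {k : SL(3, ℝ)} (hk : IsRotationToEhat D x k) (hD : 0 < D) :
    ((torus x).pts ℝ).map (MulAut.conj k).toMonoidHom = Kinf := by
  have hs : Real.sqrt D ≠ 0 := (Real.sqrt_pos.2 (Nat.cast_pos.2 hD)).ne'
  have hk' : k⁻¹.1 *ᵥ ehat ℝ = (Real.sqrt D)⁻¹ • toReal x := by
    rw [mulVec_eq_iff.1 hk.2, Matrix.mulVec_smul, smul_smul, inv_mul_cancel₀ hs, one_smul]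
  ext g
  constructor
  · rintro ⟨t, ht, rfl⟩
    obtain ⟨h1, h2⟩ := mem_torus_real.1 ht
    refine mem_Kinf.2 ⟨mul_mem (mul_mem hk.1 h1) (inv_mem hk.1), ?_⟩
    change (k.1 * t.1 * k⁻¹.1) *ᵥ ehat ℝ = _
    rw [← Matrix.mulVec_mulVec, ← Matrix.mulVec_mulVec, hk', Matrix.mulVec_smul, h2, ← hk',
      Matrix.mulVec_mulVec, SL_mul_inv, Matrix.one_mulVec]
  · intro hg
    obtain ⟨h1, h2⟩ := mem_Kinf.1 hg
    refine ⟨k⁻¹ * g * k, mem_torus_real.2 ⟨mul_mem (mul_mem (inv_mem hk.1) h1) hk.1, ?_⟩, ?_⟩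
    · change (k⁻¹.1 * g.1 * k.1) *ᵥ toReal x = _
      rw [← Matrix.mulVec_mulVec, ← Matrix.mulVec_mulVec, hk.2, Matrix.mulVec_smul, h2, ← hk.2,
        ← mulVec_eq_iff.1 rfl]
    · change k * (k⁻¹ * g * k) * k⁻¹ = g
      group

/-- The product of the inverse of the grid point and of `ᶿδ` is `diag(c, c, c⁻²) k`. Conjugation by
`k` carries the rotations about `x` to those about `ê`, and the latter commute with the diagonal
matrix. -/
theorem gridPoint_conjugates {k : SL(3, ℝ)} (hk : IsRotationToEhat D x k) (hD : 0 < D)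
    {δ : SL(3, ℤ)} (hδ : δ.1 *ᵥ x = ehat ℤ) :
    ConjugatesToKinf x δ ⟨gridPoint D hD δ k, gridPoint_mem hD hδ hk⟩ := by
  have h1 : (gridPoint D hD δ k)⁻¹ * toRealSL (cartan ℤ δ) =
      diagSL _ (gridScale_pos hD).ne' * k := by
    rw [gridPoint]
    group
  have h2 : ∀ t ∈ (torus x).pts ℝ, MulAut.conj (diagSL _ (gridScale_pos hD).ne' * k) t =
      MulAut.conj k t := by
    intro t ht
    have h3 : MulAut.conj k t ∈ Kinf := by
      rw [← map_conj_torus hk hD]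
      exact ⟨t, ht, rfl⟩
    rw [map_mul, MulAut.mul_apply, MulAut.conj_apply (diagSL _ _), diagSL_commute _ _ h3,
      mul_inv_cancel_right]
  change ((torus x).pts ℝ).map (MulAut.conj ((gridPoint D hD δ k)⁻¹ *
    toRealSL (cartan ℤ δ))).toMonoidHom = Kinf
  rw [h1, ← map_conj_torus hk hD]
  exact SetLike.coe_injective (Set.image_congr h2)

/-- The choices of `g_∞` differ by elements of `SO_2(ℝ)`. -/
theorem exists_eq_gridPoint_mul {k : SL(3, ℝ)} (hk : IsRotationToEhat D x k) (hD : 0 < D)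
    {δ : SL(3, ℤ)} (hδ : δ.1 *ᵥ x = ehat ℤ) {g : ASL2.pts ℝ} (hg : ConjugatesToKinf x δ g) :
    ∃ κ ∈ Kinf, (g : SL(3, ℝ)) = gridPoint D hD δ k * κ := by
  refine ⟨(gridPoint D hD δ k)⁻¹ * g, ?_, by group⟩
  refine mem_Kinf_of_normalizes (mul_mem (inv_mem (gridPoint_mem hD hδ hk)) g.2) ?_
  intro κ hκ
  have h0 := gridPoint_conjugates hk hD hδ
  rw [ConjugatesToKinf] at h0 hg
  rw [← h0] at hκ
  obtain ⟨t, ht, rfl⟩ := hκ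
  rw [← hg]
  refine ⟨t, ht, ?_⟩
  change (g : SL(3, ℝ))⁻¹ * toRealSL (cartan ℤ δ) * t *
    ((g : SL(3, ℝ))⁻¹ * toRealSL (cartan ℤ δ))⁻¹ =
    ((gridPoint D hD δ k)⁻¹ * g)⁻¹ * ((gridPoint D hD δ k)⁻¹ * toRealSL (cartan ℤ δ) * t *
      ((gridPoint D hD δ k)⁻¹ * toRealSL (cartan ℤ δ))⁻¹) * ((gridPoint D hD δ k)⁻¹ * g)
  group

theorem gridTorus_eq (δ : SL(3, ℤ)) :
    gridTorus x δ = (axisTorus fun i => (x i : ℚ)).conj (toRatSL (cartan ℤ δ)) := rfl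

theorem isToralPresentation_gridTorus (hx : x ∈ primitivePoints D) {δ : SL(3, ℤ)}
    (hδ : δ.1 *ᵥ x = ehat ℤ) {g : ASL2.pts ℝ} (hg : ConjugatesToKinf x δ g) :
    IsToralPresentation (gridTorus x δ) (ASL2.ofReal g) (gridToralSet x δ g) := by
  refine isToralPresentation_axisTorus (norm_ne_zero hx) (cartan_last_row hδ) _ ?_
  rw [← hg]
  change (((torus x).pts ℝ).map (MulAut.conj (baseSL ℝ (toRatSL (cartan ℤ δ)))).toMonoidHom).map
    (MulAut.conj (g : SL(3, ℝ))⁻¹).toMonoidHom = _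
  rw [Subgroup.map_map, toReal_of_rat_int, map_mul]
  rfl

end GridTorus

/-! ### The projection of the toral set -/

/-- A real matrix and `p`-adic ones, almost all of them integral, are the components of an adelic
matrix. -/
theorem exists_adelicSL {n : ℕ} (r : SL(n, ℝ)) (f : ∀ p : Nat.Primes, SL(n, ℚ_[(p : ℕ)]))
    (hf : ∀ᶠ p : Nat.Primes in Filter.cofinite, f p ∈ integralSL n p) :
    ∃ g : SL(n, Adele), realComp g = r ∧ ∀ p, finComp p g = f p := by
  let A : Matrix (Fin n) (Fin n) Adele := Matrix.of fun i j =>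
    (r.1 i j, ⟨fun p => (f p).1 i j, hf.mono fun p hp => mem_integralSL.1 hp i j⟩)
  have h1 : (RingHom.fst ℝ FinAdele).mapMatrix A = r.1 := rfl
  have h2 : ∀ p, (atPrime p).mapMatrix A = (f p).1 := fun p => rfl
  have hA : A.det = 1 := by
    refine Prod.ext ?_ (RestrictedProduct.ext _ _ fun p => ?_)
    · exact (RingHom.map_det (RingHom.fst ℝ FinAdele) A).trans (by rw [h1, r.2]; rfl)
    · exact (RingHom.map_det (atPrime p) A).trans (by rw [h2, (f p).2]; rfl)
  exact ⟨⟨A, hA⟩, Subtype.ext h1, fun p => Subtype.ext (h2 p)⟩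

theorem mem_pts_adele {n : ℕ} (M : AlgSubgroup n) {g : SL(n, Adele)} (h1 : realComp g ∈ M.pts ℝ)
    (h2 : ∀ p : Nat.Primes, finComp p g ∈ M.pts ℚ_[(p : ℕ)]) : g ∈ M.pts Adele := by
  obtain ⟨F, hF⟩ := M.closed
  rw [hF] at h1 ⊢
  intro f hf
  refine Prod.ext ?_ (RestrictedProduct.ext _ _ fun p => ?_)
  · exact (aeval_map (RingHom.fst ℝ FinAdele) g f).symm.trans (h1 f hf)
  · exact (aeval_map (atPrime p) g f).symm.trans ((hF _ _).1 (h2 p) f hf)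

theorem mem_SO_iff_cartan {R : Type} [CommRing R] [Algebra ℚ R] {g : SL(3, R)} :
    g ∈ (SO 3).pts R ↔ cartan R g = g := by
  refine ⟨cartan_of_mem_SO, fun h => ?_⟩
  have h1 : (cartan R g)⁻¹.1 = g.1ᵀ := cartan_inv_coe g
  rw [h] at h1
  rw [mem_SO, ← h1, SL_inv_mul]

theorem cartan_mem_integralSL {p : Nat.Primes} {g : SL(3, ℚ_[(p : ℕ)])}
    (hg : g ∈ integralSL 3 p) : cartan ℚ_[(p : ℕ)] g ∈ integralSL 3 p := by
  rw [mem_integralSL]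
  exact fun i j => mem_integralSL.1 (inv_mem hg) j i

section Projection

variable {D : ℕ} {x : Fin 3 → ℤ}

theorem primitive_ehat : ∀ d : ℤ, (∀ i, d ∣ ehat ℤ i) → IsUnit d := fun _ h =>
  isUnit_of_dvd_one (h 2)

theorem isRotationToEhat_mul {k κ τ : SL(3, ℝ)} (hk : IsRotationToEhat D x k) (hκ : κ ∈ Kinf)
    (hτ : τ ∈ (torus x).pts ℝ) : IsRotationToEhat D x (κ⁻¹ * k * τ⁻¹) := by
  obtain ⟨h1, h2⟩ := mem_torus_real.1 (inv_mem hτ)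
  obtain ⟨h3, h4⟩ := mem_Kinf.1 (inv_mem hκ)
  refine ⟨mul_mem (mul_mem h3 hk.1) h1, ?_⟩
  change (κ⁻¹.1 * k.1 * τ⁻¹.1) *ᵥ _ = _
  rw [← Matrix.mulVec_mulVec, ← Matrix.mulVec_mulVec, h2, hk.2, Matrix.mulVec_smul, h4]

/-- Moving a rotation to `√D ê` along a rational rotation `ρ` with `ρ x = y`. -/
theorem isRotationToEhat_mul_inv {y : Fin 3 → ℤ} {k : SL(3, ℝ)} {ρ : SL(3, ℚ)}
    (hρ : ρ ∈ (SO 3).pts ℚ) (hxy : ρ.1 *ᵥ (fun i => (x i : ℚ)) = fun i => (y i : ℚ))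
    (hk : IsRotationToEhat D x k) : IsRotationToEhat D y (k * (baseSL ℝ ρ)⁻¹) := by
  have h1 : (baseSL ℝ ρ).1 *ᵥ toReal x = toReal y := by
    funext i
    have := congrArg (algebraMap ℚ ℝ) (congrFun hxy i)
    simpa [Matrix.mulVec, dotProduct, toReal] using this
  refine ⟨mul_mem hk.1 (inv_mem (map_mem_pts _ _ hρ)), ?_⟩
  change (k.1 * (baseSL ℝ ρ)⁻¹.1) *ᵥ _ = _
  rw [← Matrix.mulVec_mulVec, ← mulVec_eq_iff.1 h1, hk.2]

theorem inv_mul_mem_torus {k k' : SL(3, ℝ)} (hk : IsRotationToEhat D x k)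
    (hk' : IsRotationToEhat D x k') : k⁻¹ * k' ∈ (torus x).pts ℝ := by
  refine mem_torus_real.2 ⟨mul_mem (inv_mem hk.1) hk'.1, ?_⟩
  change (k⁻¹.1 * k'.1) *ᵥ _ = _
  rw [← Matrix.mulVec_mulVec, hk'.2, ← mulVec_eq_iff.1 hk.2]

/-- The real component of a point of the toral set, moved by a rational matrix, is a grid point
as soon as the rational matrix is the product of `ᶿη`, with `η` integral, and of a rotation. -/
theorem gridPoint_eq_mul (hD : 0 < D) {δ η : SL(3, ℤ)} {k κ τ : SL(3, ℝ)} {ρ γ : SL(3, ℚ)}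
    (hκ : κ ∈ Kinf) (hρ : ρ ∈ (SO 3).pts ℚ)
    (hγ : γ * toRatSL (cartan ℤ δ) = cartan ℚ (toRatSL η * ρ)) :
    gridPoint D hD η (κ⁻¹ * k * τ⁻¹ * (baseSL ℝ ρ)⁻¹) =
      baseSL ℝ γ * (toRealSL (cartan ℤ δ) * τ * (toRealSL (cartan ℤ δ))⁻¹) *
        (gridPoint D hD δ k * κ) := by
  have h1 : baseSL ℝ γ * toRealSL (cartan ℤ δ) = toRealSL (cartan ℤ η) * baseSL ℝ ρ := by
    have h2 := congrArg (baseSL ℝ) hγ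
    rw [map_mul, toReal_of_rat_int, map_mul, cartan_of_mem_SO hρ, map_mul, ← map_cartan,
      toReal_of_rat_int] at h2
    exact h2
  have h3 : (diagSL _ (gridScale_pos hD).ne')⁻¹ * κ = κ * (diagSL _ (gridScale_pos hD).ne')⁻¹ := by
    have := diagSL_commute _ (gridScale_pos hD).ne' hκ
    rw [inv_mul_eq_iff_eq_mul, ← mul_assoc, this, mul_inv_cancel_right]
  rw [gridPoint, gridPoint]
  calc _ = (toRealSL (cartan ℤ η) * baseSL ℝ ρ) * τ * k⁻¹ *
        (κ * (diagSL _ (gridScale_pos hD).ne')⁻¹) := by group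
    _ = _ := by
      rw [← h1, ← h3]
      group

/-- A rational matrix `ε` such that `ε τ_p` is integral for every prime `p`, with rotations `τ_p`,
is the product of `ᶿη`, with `η` integral, and of a rational rotation: the Gram matrix of `ᶿε` is
integral and unimodular, hence equivalent to the identity. -/
theorem exists_integral_mul_rotation {ε : SL(3, ℚ)}
    {τ : ∀ p : Nat.Primes, SL(3, ℚ_[(p : ℕ)])} (hτ : ∀ p : Nat.Primes, τ p ∈ (SO 3).pts ℚ_[(p : ℕ)])
    (h : ∀ p : Nat.Primes, baseSL ℚ_[(p : ℕ)] ε * τ p ∈ integralSL 3 p) :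
    ∃ η : SL(3, ℤ), ∃ ρ ∈ (SO 3).pts ℚ, ε = cartan ℚ (toRatSL η * ρ) := by
  obtain ⟨S, hS⟩ := exists_intSL_of_integral (γ := cartan ℚ ε * ε⁻¹) fun p => by
    have h1 : baseSL ℚ_[(p : ℕ)] (cartan ℚ ε * ε⁻¹) =
        cartan _ (baseSL ℚ_[(p : ℕ)] ε * τ p) * (baseSL ℚ_[(p : ℕ)] ε * τ p)⁻¹ := by
      rw [map_mul, map_mul, map_cartan, map_inv, cartan_of_mem_SO (hτ p)]
      group
    rw [h1]
    exact mul_mem (cartan_mem_integralSL (h p)) (inv_mem (h p))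
  have hgram : IsGram S.1 := by
    refine ⟨(baseSL ℝ (cartan ℚ ε)).1, (baseSL ℝ (cartan ℚ ε)).2, ?_⟩
    have h1 := congrArg (baseSL ℝ) hS
    rw [toReal_of_rat_int, map_mul] at h1
    have h2 : (baseSL ℝ (cartan ℚ ε)).1ᵀ = (baseSL ℝ ε⁻¹).1 := by
      rw [← cartan_inv_coe, ← map_cartan, cartan_cartan, ← map_inv]
    rw [h2]
    exact (congrArg Subtype.val h1).symm
  obtain ⟨η, hη⟩ := hgram.exists_eq_mul_transpose
  have hS' : S = η * (cartan ℤ η)⁻¹ := by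
    refine Subtype.ext (hη.trans ?_)
    rw [← cartan_inv_coe]
    rfl
  rw [hS', map_mul, map_inv, map_cartan] at hS
  have hρ : cartan ℚ (toRatSL η)⁻¹ * ε = (toRatSL η)⁻¹ * cartan ℚ ε := by
    rw [eq_inv_mul_iff_mul_eq, ← mul_assoc, map_inv, ← hS, inv_mul_cancel_right]
  refine ⟨η, (toRatSL η)⁻¹ * cartan ℚ ε, ?_, ?_⟩
  · rw [mem_SO_iff_cartan, map_mul, cartan_cartan, hρ]
  · rw [mul_inv_cancel_left, cartan_cartan]

/-- The projection of the toral set consists of the classes of the grid points of all primitive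
points of norm `√D`. -/
theorem exists_projectsTo_iff (hx : x ∈ primitivePoints D) (hD : 0 < D) {δ : SL(3, ℤ)}
    (hδ : δ.1 *ᵥ x = ehat ℤ) {g : ASL2.pts ℝ} (hg : ConjugatesToKinf x δ g)
    (b : ASL2.RealSpace) :
    (∃ a ∈ gridToralSet x δ g, ASL2.ProjectsTo a b) ↔
      ∃ y ∈ primitivePoints D, ∃ (η : SL(3, ℤ)) (hη : η.1 *ᵥ y = ehat ℤ) (k : SL(3, ℝ))
        (hk : IsRotationToEhat D y k),
        b = ASL2.realClass ⟨gridPoint D hD η k, gridPoint_mem hD hη hk⟩ := by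
  obtain ⟨k₀, hk₀⟩ := exists_isRotationToEhat hx
  obtain ⟨κ, hκ, hgκ⟩ := exists_eq_gridPoint_mul hk₀ hD hδ hg
  set q := toRatSL (cartan ℤ δ) with hq
  have hqr : baseSL ℝ q = toRealSL (cartan ℤ δ) := toReal_of_rat_int _
  have hqx : ehat ℚ ᵥ* q.1 = fun i => (x i : ℚ) := by rw [ehat_vecMul, hq, cartan_last_row hδ]
  constructor
  · rintro ⟨_, ⟨t, ht, rfl⟩, hb⟩
    obtain ⟨γ, hγ, r, hr, hint, rfl⟩ := (projectsTo_iff ASL2).1 hb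
    rw [gridTorus_eq, mem_conj] at ht
    set τ := (baseSL Adele q)⁻¹ * (t : SL(3, Adele)) * baseSL Adele q with hτ
    have htτ : (t : SL(3, Adele)) = baseSL Adele q * τ * (baseSL Adele q)⁻¹ := by
      rw [hτ]
      group
    -- `y = η⁻¹ ê = ρ x` is the primitive point attached to `t`
    obtain ⟨η, ρ, hρ, hε⟩ := exists_integral_mul_rotation (ε := γ * q)
      (τ := fun p => finComp p τ) (fun p => (map_mem_pts _ (atPrime p) ht).1) fun p => by
        have h1 := mul_mem (hint p) (baseSL_int_mem (cartan ℤ δ) p)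
        have h2 : finComp p ((t * ASL2.ofReal g : ASL2.pts Adele) : SL(3, Adele)) =
            baseSL _ q * finComp p τ * (baseSL _ q)⁻¹ := by
          change finComp p ((t : SL(3, Adele)) * (ASL2.ofReal g : SL(3, Adele))) = _
          rw [map_mul, finComp_ofReal, mul_one, htτ, map_mul, map_mul, map_inv, map_baseSL]
        rw [h2] at h1
        have h3 : baseSL ℚ_[(p : ℕ)] (γ * q) * finComp p τ = baseSL ℚ_[(p : ℕ)] γ *
            (baseSL _ q * finComp p τ * (baseSL _ q)⁻¹) * baseSL _ q := by
          rw [map_mul]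
          group
        rw [h3]
        exact h1
    have hηx : (toRatSL η).1 *ᵥ (ρ.1 *ᵥ fun i => (x i : ℚ)) = ehat ℚ := by
      rw [Matrix.mulVec_mulVec]
      refine mulVec_eq_iff.2 (?_ : _ = (toRatSL η * ρ)⁻¹.1 *ᵥ ehat ℚ)
      rw [← vecMul_cartan, ← hε]
      change _ = ehat ℚ ᵥ* (γ.1 * q.1)
      rw [← Matrix.vecMul_vecMul, mem_ASL2.1 hγ, hqx]
    set y := η⁻¹.1 *ᵥ ehat ℤ with hy
    have hxy : ρ.1 *ᵥ (fun i => (x i : ℚ)) = fun i => (y i : ℚ) := by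
      rw [mulVec_eq_iff.1 hηx, ← map_inv, ← intCast_ehat, mulVec_toRat]
    have hk := isRotationToEhat_mul_inv hρ hxy
      (isRotationToEhat_mul hk₀ hκ (map_mem_pts _ (RingHom.fst ℝ FinAdele) ht))
    have hyD : y ⬝ᵥ y = D := by
      have h1 := rotation_dotProduct hk.1 (toReal y) (toReal y)
      rw [hk.2, toReal_dotProduct, smul_dotProduct, dotProduct_smul, smul_smul,
        Real.mul_self_sqrt (Nat.cast_nonneg D)] at h1
      have h2 : ehat ℝ ⬝ᵥ ehat ℝ = 1 := by simp [ehat, dotProduct, Fin.sum_univ_three]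
      rw [h2, smul_eq_mul, mul_one] at h1
      exact_mod_cast h1.symm
    refine ⟨y, ⟨mulVec_primitive primitive_ehat η⁻¹, hyD⟩, η, ?_, _, hk, ?_⟩
    · rw [hy, Matrix.mulVec_mulVec, SL_mul_inv, Matrix.one_mulVec]
    · refine congrArg _ (Subtype.ext (hr.trans ?_))
      refine Eq.trans ?_ (gridPoint_eq_mul hD (δ := δ) hκ hρ hε).symm
      rw [← hgκ, ← hqr]
      change _ * realComp ((t : SL(3, Adele)) * (ASL2.ofReal g : SL(3, Adele))) = _
      rw [map_mul, realComp_ofReal, htτ, map_mul, map_mul, map_inv, map_baseSL]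
      simp only [mul_assoc]
  · rintro ⟨y, hy, η, hη, k, hk, rfl⟩
    choose ρ hρO hρxy hρint using exists_rat_rotation hx hy
    -- any of these rotations serves as the rational one
    obtain ⟨p₀⟩ : Nonempty Nat.Primes := ⟨⟨2, Nat.prime_two⟩⟩
    set σ := ρ p₀ with hσ
    have hσk : IsRotationToEhat D x (k * baseSL ℝ σ) := by
      have h1 := isRotationToEhat_mul_inv (inv_mem (hρO p₀)) (mulVec_eq_iff.1 (hρxy p₀)).symm hk
      rwa [map_inv, inv_inv] at h1
    have hk₀κ : IsRotationToEhat D x (κ⁻¹ * k₀) := by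
      simpa using isRotationToEhat_mul hk₀ hκ (one_mem _)
    have hτr := inv_mul_mem_torus hσk hk₀κ
    -- the adelic rotation about `x` with component `σ⁻¹ ρ_p` at each prime `p` and real component
    -- `σ⁻¹ k⁻¹ κ⁻¹ k₀`
    obtain ⟨τ, hτ1, hτ2⟩ := exists_adelicSL ((k * baseSL ℝ σ)⁻¹ * (κ⁻¹ * k₀))
      (fun p => (baseSL _ σ)⁻¹ * baseSL _ (ρ p)) (by
        filter_upwards [eventually_finComp_integral (baseSL Adele σ)] with p hp
        rw [map_baseSL] at hp
        exact mul_mem (inv_mem hp) (hρint p))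
    have hτ : τ ∈ (torus x).pts Adele := by
      refine mem_pts_adele _ (by rwa [hτ1]) fun p => ?_
      rw [hτ2, ← map_inv, ← map_mul]
      refine map_mem_pts _ _ ⟨((SO 3).pts ℚ).mul_mem (inv_mem (hρO p₀)) (hρO p), ?_⟩
      change (σ⁻¹.1 * (ρ p).1) *ᵥ (fun i => (x i : ℚ)) = fun i => (x i : ℚ)
      rw [← Matrix.mulVec_mulVec, hρxy p, ← mulVec_eq_iff.1 (hρxy p₀)]
    set γ := cartan ℚ (toRatSL η * σ) * q⁻¹ with hγ
    have hγq : γ * q = cartan ℚ (toRatSL η * σ) := by rw [hγ, inv_mul_cancel_right]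
    have hγA : γ ∈ ASL2.pts ℚ := by
      refine mem_ASL2.2 ?_
      have h1 : ehat ℚ ᵥ* (cartan ℚ (toRatSL η * σ)).1 = fun i => (x i : ℚ) := by
        rw [vecMul_cartan, ← mulVec_eq_iff.1]
        change ((toRatSL η).1 * σ.1) *ᵥ _ = _
        rw [← Matrix.mulVec_mulVec, hρxy, mulVec_toRat, hη, intCast_ehat]
      change ehat ℚ ᵥ* ((cartan ℚ (toRatSL η * σ)).1 * q⁻¹.1) = _
      rw [← Matrix.vecMul_vecMul, h1, ← hqx, Matrix.vecMul_vecMul, SL_mul_inv, Matrix.vecMul_one]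
    clear_value γ
    set t := baseSL Adele q * τ * (baseSL Adele q)⁻¹ with ht
    have htT : t ∈ (gridTorus x δ).pts Adele := by
      rw [gridTorus_eq, mem_conj, ht]
      have h1 : (baseSL Adele q)⁻¹ * (baseSL Adele q * τ * (baseSL Adele q)⁻¹) * baseSL Adele q =
          τ := by group
      rw [h1]
      exact hτ
    have htA := (isToralPresentation_gridTorus hx hδ hg).maximalTorus.1 Adele htT
    refine ⟨_, ⟨⟨t, htA⟩, htT, rfl⟩, (projectsTo_iff ASL2).2 ⟨γ, hγA, _, ?_, ?_, rfl⟩⟩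
    · have h1 := gridPoint_eq_mul (τ := (k * baseSL ℝ σ)⁻¹ * (κ⁻¹ * k₀)) (k := k₀) hD hκ
        (hρO p₀) hγq
      have h2 : κ⁻¹ * k₀ * ((k * baseSL ℝ σ)⁻¹ * (κ⁻¹ * k₀))⁻¹ * (baseSL ℝ σ)⁻¹ = k := by group
      rw [h2] at h1
      refine h1.trans ?_
      change _ = _ * realComp (t * (ASL2.ofReal g : SL(3, Adele)))
      rw [map_mul, realComp_ofReal, ht, map_mul, map_mul, map_inv, map_baseSL, hτ1, hqr, hgκ,
        mul_assoc]
    · intro p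
      change _ * finComp p (t * (ASL2.ofReal g : SL(3, Adele))) ∈ _
      rw [map_mul, finComp_ofReal, mul_one, ht, map_mul, map_mul, map_inv, map_baseSL, hτ2]
      have h1 : baseSL ℚ_[(p : ℕ)] γ * baseSL _ q =
          baseSL _ (toRatSL (cartan ℤ η)) * baseSL _ σ := by
        rw [← map_mul, hγq, map_mul, cartan_of_mem_SO (hρO p₀), ← map_cartan, map_mul]
      have h2 : baseSL ℚ_[(p : ℕ)] γ * (baseSL _ q * ((baseSL _ σ)⁻¹ * baseSL _ (ρ p)) *
          (baseSL _ q)⁻¹) = baseSL _ (toRatSL (cartan ℤ η)) * baseSL _ (ρ p) *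
            (baseSL _ q)⁻¹ := by
        calc _ = (baseSL ℚ_[(p : ℕ)] γ * baseSL _ q) * (baseSL _ σ)⁻¹ * baseSL _ (ρ p) *
              (baseSL _ q)⁻¹ := by group
          _ = _ := by
            rw [h1]
            group
      rw [h2]
      exact mul_mem (mul_mem (baseSL_int_mem _ p) (hρint p)) (inv_mem (baseSL_int_mem _ p))

/-- The projection of the toral set is the collection of grids, read in `ASL_2(ℤ)\ASL_2(ℝ)`. -/
theorem projection_gridToralSet (hx : x ∈ primitivePoints D) {δ : SL(3, ℤ)}
    (hδ : δ.1 *ᵥ x = ehat ℤ) {gInf : ASL2.pts ℝ} (hg : ConjugatesToKinf x δ gInf)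
    {k : SL(3, ℝ)} (hk : IsRotationToEhat D x k) :
    {b : ASL2.RealSpace | ∃ a ∈ gridToralSet x δ gInf, ASL2.ProjectsTo a b} =
      phi '' {C | C.1 ∈ gridCollection D x k} := by
  have hD := pos_of_primitive hx
  ext b
  rw [phi, Equiv.image_eq_preimage_symm, Equiv.symm_symm]
  refine (exists_projectsTo_iff hx hD hδ hg b).trans ?_
  change _ ↔ (cosetEquiv b).1 ∈ gridCollection D x k
  rw [gridCollection_eq hx hk]
  simp only [Set.mem_iUnion, exists_prop]
  refine exists_congr fun y => and_congr_right fun hy => ⟨?_, ?_⟩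
  · rintro ⟨η, hη, k', hk', rfl⟩
    exact ⟨k', hk', cosetOfPoint_gridPoint hD hη hk'⟩
  · rintro ⟨k', hk', h⟩
    obtain ⟨η, hη⟩ := exists_SL_mulVec_eq_ehat hy.1
    refine ⟨η, hη, k', hk', cosetEquiv.injective (Subtype.ext (h.trans ?_))⟩
    exact (cosetOfPoint_gridPoint hD hη hk').symm

end Projection

/-! ### Independence of the invariants of the presentation -/

theorem mem_SL2 {R : Type} [CommRing R] [Algebra ℚ R] {g : SL(3, R)} :
    g ∈ SL2.pts R ↔ g ∈ ASL2.pts R ∧ g.1 *ᵥ ehat R = ehat R := by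
  rw [← baseVec_ehat R]
  exact Iff.rfl

theorem linPart_mul {R : Type} [CommRing R] [Algebra ℚ R] (g h : ASL2.pts R) :
    linPart (g * h) = linPart g * linPart h := by
  have h0 : h.1.1 2 = ehat R := h.2
  refine Subtype.ext (Matrix.ext fun i j => ?_)
  change (g.1.1 * h.1.1) i.castSucc j.castSucc =
    ((linPart g).1 * (linPart h).1) i j
  rw [Matrix.mul_apply, Matrix.mul_apply, Fin.sum_univ_castSucc]
  have h1 : h.1.1 (Fin.last 2) j.castSucc = 0 := by
    change h.1.1 2 j.castSucc = 0
    rw [h0]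
    fin_cases j <;> rfl
  rw [h1, mul_zero, add_zero]
  rfl

theorem linPart_conj {R : Type} [CommRing R] [Algebra ℚ R] (g h : ASL2.pts R) :
    conjMat (linPart g) (linPart h).1 = (linPart (g * h * g⁻¹)).1 := by
  have h1 : linPart g⁻¹ = (linPart g)⁻¹ := by
    rw [eq_inv_iff_mul_eq_one, ← linPart_mul, inv_mul_cancel]
    exact map_one (MonoidHom.mk' linPart linPart_mul : ASL2.pts R →* SL(2, R))
  rw [linPart_mul, linPart_mul, h1]
  rfl

/-- The origin is the only fixed point of `-1` in the plane `ê + ê^⊥`. Hence a point `n` of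
`ASL_2(ℝ)` for which the conjugate of `-1` by `n` fixes the origin `ê` has no translation part. -/
theorem mem_SL2_of_conj_neg {n κ : SL(3, ℝ)} (hn : n ∈ ASL2.pts ℝ)
    (hκ : κ = affineSL (-1) 0 0 (-1) 0 0 (by norm_num))
    (h : (n * κ * n⁻¹).1 *ᵥ ehat ℝ = ehat ℝ) : n ∈ SL2.pts ℝ := by
  refine mem_SL2.2 ⟨hn, ?_⟩
  set u := n⁻¹.1 *ᵥ ehat ℝ with hu
  have h1 : κ.1 *ᵥ u = u := by
    have h2 : (n * (κ * n⁻¹)).1 *ᵥ ehat ℝ = ehat ℝ := by rwa [← mul_assoc]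
    change (n.1 * (κ * n⁻¹).1) *ᵥ ehat ℝ = ehat ℝ at h2
    rw [← Matrix.mulVec_mulVec] at h2
    have h3 := mulVec_eq_iff.1 h2
    change (κ.1 * n⁻¹.1) *ᵥ ehat ℝ = _ at h3
    rwa [← Matrix.mulVec_mulVec] at h3
  have h0 := congrFun h1 0
  have h1' := congrFun h1 1
  simp [hκ, affineSL, Matrix.mulVec, dotProduct, Fin.sum_univ_three] at h0 h1'
  have h2 : u 2 = 1 := by
    have := last_coord ⟨n⁻¹, inv_mem hn⟩ (ehat ℝ)
    exact this.trans rfl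
  have h3 : u = ehat ℝ := by
    funext i
    fin_cases i
    · change u 0 = 0
      linarith
    · change u 1 = 0
      linarith
    · exact h2
  exact mulVec_eq_iff.2 (h3.symm.trans hu)

/-- Conjugation by `c`, as an automorphism of the algebra `M_2(ℚ)`. -/
def conjAlgEquiv (c : SL(2, ℚ)) :
    Matrix (Fin 2) (Fin 2) ℚ ≃ₐ[ℚ] Matrix (Fin 2) (Fin 2) ℚ where
  toFun := conjMat c
  invFun := conjMat c⁻¹
  left_inv a := by rw [← conjMat_mul, inv_mul_cancel, conjMat_one]
  right_inv a := by rw [← conjMat_mul, mul_inv_cancel, conjMat_one]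
  map_add' a b := by rw [conjMat, conjMat, conjMat, Matrix.mul_add, Matrix.add_mul]
  map_mul' a b := by
    rw [conjMat, conjMat, conjMat]
    calc c.1 * (a * b) * c⁻¹.1 = c.1 * a * 1 * b * c⁻¹.1 := by
          simp only [Matrix.mul_assoc, Matrix.one_mul]
      _ = _ := by
          rw [← SL_inv_mul c]
          simp only [Matrix.mul_assoc]
  commutes' r := by
    rw [conjMat_eq_self_iff]
    exact (Algebra.commutes r c.1).symm

/-- An element of the quadratic algebra is in the order when its conjugates by the `l_p⁻¹` are
integral. -/
theorem mem_quadOrder {T : AlgSubgroup 3} {g : ASL2.pts Adele} {a : Matrix (Fin 2) (Fin 2) ℚ} :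
    a ∈ quadOrder T g ↔ a ∈ torusAlgebra T ∧ ∀ (p : Nat.Primes) (i j : Fin 2),
      conjMat (SpecialLinearGroup.map (atPrime p) (linPart g))⁻¹
        ((algebraMap ℚ ℚ_[(p : ℕ)]).mapMatrix a) i j ∈ PadicInt.subring (p : ℕ) := by
  refine and_congr_right fun _ => forall_congr' fun p => ?_
  constructor
  · rintro ⟨m, hm, h⟩ i j
    rw [conjMat_eq_iff.1 h.symm] at hm
    exact hm i j
  · intro h
    exact ⟨_, h, (conjMat_eq_iff.2 rfl).symm⟩

/-- An automorphism of `M_2(ℚ)` preserves traces of multiplications, hence discriminants. -/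
theorem HasOrderDisc.map {Λ : Subring (Matrix (Fin 2) (Fin 2) ℚ)} {d : ℤ} (h : HasOrderDisc Λ d)
    (e : Matrix (Fin 2) (Fin 2) ℚ ≃+* Matrix (Fin 2) (Fin 2) ℚ) :
    HasOrderDisc (Λ.map (e : Matrix (Fin 2) (Fin 2) ℚ →+* Matrix (Fin 2) (Fin 2) ℚ)) d := by
  obtain ⟨b, hb⟩ := h
  let f : Λ ≃+* Λ.map (e : Matrix (Fin 2) (Fin 2) ℚ →+* Matrix (Fin 2) (Fin 2) ℚ) :=
    e.subringMap
  let L : Λ ≃ₗ[ℤ] Λ.map (e : Matrix (Fin 2) (Fin 2) ℚ →+* Matrix (Fin 2) (Fin 2) ℚ) :=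
    f.toAddEquiv.toIntLinearEquiv
  refine ⟨b.map L, ?_⟩
  rw [← hb]
  congr 1
  ext i j
  change LinearMap.trace ℤ _ (LinearMap.mulLeft ℤ (f (b i) * f (b j))) =
    LinearMap.trace ℤ _ (LinearMap.mulLeft ℤ (b i * b j))
  rw [← LinearMap.trace_conj' (LinearMap.mulLeft ℤ (b i * b j)) L]
  congr 1
  refine LinearMap.ext fun z => ?_
  rw [LinearEquiv.conj_apply_apply]
  change f (b i) * f (b j) * z = f (b i * b j * f.symm z)
  rw [map_mul, map_mul, RingEquiv.apply_symm_apply]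

theorem translPart_eq {R : Type} [CommRing R] [Algebra ℚ R] (g : ASL2.pts R) (i : Fin 2) :
    translPart g i = (g.1.1 *ᵥ ehat R) i.castSucc := by
  simp [translPart, ehat, Matrix.mulVec, dotProduct, Fin.sum_univ_three]

theorem linPart_mulVec_inv {R : Type} [CommRing R] [Algebra ℚ R] (g : ASL2.pts R) :
    (linPart g).1 *ᵥ translPart g⁻¹ = -translPart g := by
  have hrow : (g⁻¹ : ASL2.pts R).1.1 2 = ehat R := (g⁻¹ : ASL2.pts R).2
  funext i
  have h1 : (g.1.1 * (g⁻¹ : ASL2.pts R).1.1) i.castSucc 2 = 0 := by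
    have h2 : g.1.1 * (g⁻¹ : ASL2.pts R).1.1 = 1 := SL_mul_inv g.1
    rw [h2]
    fin_cases i <;> rfl
  rw [Matrix.mul_apply, Fin.sum_univ_castSucc] at h1
  have h3 : (g⁻¹ : ASL2.pts R).1.1 (Fin.last 2) 2 = 1 := by
    change (g⁻¹ : ASL2.pts R).1.1 2 2 = 1
    rw [hrow]
    rfl
  rw [h3, mul_one] at h1
  exact eq_neg_of_add_eq_zero_left h1

/-- The order of the translation part `x_f` modulo `l_f ℤ̂²` is the order of `l_f⁻¹ x_f` modulo
`ℤ̂²`, and `-l⁻¹ x` is the translation part of the inverse. -/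
theorem nsmul_torsion_eq_zero_iff (g : ASL2.pts Adele) (n : ℕ) :
    n • (QuotientAddGroup.mk (fun i => (translPart g i).2) :
      (Fin 2 → FinAdele) ⧸ finLattice g) = 0 ↔
    ∀ (i : Fin 2) (p : Nat.Primes),
      (n : ℚ_[(p : ℕ)]) * (translPart g⁻¹ i).2 p ∈ PadicInt.subring (p : ℕ) := by
  set L := SpecialLinearGroup.map (RingHom.snd ℝ FinAdele) (linPart g) with hL
  set u : Fin 2 → FinAdele := fun i => (translPart g⁻¹ i).2 with hu
  have hLu : L.1 *ᵥ u = -fun i => (translPart g i).2 := by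
    have h1 := linPart_mulVec_inv g
    funext i
    have h2 := congrArg (RingHom.snd ℝ FinAdele) (congrFun h1 i)
    simp [Matrix.mulVec, dotProduct] at h2 ⊢
    exact h2
  have hcoe : ∀ i (p : Nat.Primes), (n • u) i p = (n : ℚ_[(p : ℕ)]) * (translPart g⁻¹ i).2 p := by
    intro i p
    rw [← nsmul_eq_mul]
    rfl
  rw [← QuotientAddGroup.mk_nsmul, QuotientAddGroup.eq_zero_iff]
  constructor
  · rintro ⟨z, hz, h⟩ i p
    have h1 : L.1 *ᵥ z = L.1 *ᵥ (-(n • u)) := by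
      rw [Matrix.mulVec_neg, Matrix.mulVec_smul, hLu, smul_neg, neg_neg]
      exact h
    have h2 : z = -(n • u) := by
      have h3 := congrArg (fun w => L⁻¹.1 *ᵥ w) h1
      simpa only [Matrix.mulVec_mulVec, SL_inv_mul, Matrix.one_mulVec] using h3
    have h4 := neg_mem (hz i p)
    rw [h2] at h4
    rw [← hcoe]
    convert h4 using 1
    exact (neg_neg _).symm
  · intro h
    refine ⟨-(n • u), fun i p => ?_, ?_⟩
    · have h1 := neg_mem (h i p)
      rw [← hcoe] at h1
      exact h1
    · change L.1 *ᵥ (-(n • u)) = _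
      rw [Matrix.mulVec_neg, Matrix.mulVec_smul, hLu, smul_neg, neg_neg]

section Independence

variable {T T' : AlgSubgroup 3} {g g' : ASL2.pts Adele} {ℋ : Set ASL2.AdelicSpace}

/-- The real component of the base point of a presentation with torus in `SL_2` has no translation
part, because it conjugates the element `-1` of `SO_2(ℝ)` into the torus. -/
theorem IsToralPresentation.realComp_mem_SL2 (h : IsToralPresentation T g ℋ) (hT : T ≤ SL2) :
    realComp (g : SL(3, Adele)) ∈ SL2.pts ℝ := by
  set κ : SL(3, ℝ) := affineSL (-1) 0 0 (-1) 0 0 (by norm_num) with hκ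
  have hκK : κ ∈ Kinf := by
    refine mem_Kinf.2 ⟨?_, ?_⟩
    · rw [mem_SO]
      ext i j
      fin_cases i <;> fin_cases j <;>
        simp [hκ, affineSL, Matrix.mul_apply, Fin.sum_univ_three]
    · funext i
      fin_cases i <;> simp [hκ, affineSL, ehat, Matrix.mulVec, dotProduct, Fin.sum_univ_three]
  rw [← h.invariant] at hκK
  obtain ⟨u, hu, huκ⟩ := hκK
  have h1 : realComp (g : SL(3, Adele)) * κ * (realComp (g : SL(3, Adele)))⁻¹ = u := by
    rw [← huκ]
    change _ * ((realComp (g : SL(3, Adele)))⁻¹ * u * (realComp (g : SL(3, Adele)))⁻¹⁻¹) * _ = u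
    group
  refine mem_SL2_of_conj_neg (map_mem_pts _ _ g.2) hκ ?_
  rw [h1]
  exact (mem_SL2.1 (hT ℝ hu)).2

/-- Two presentations of a homogeneous toral set, with tori in `SL_2`, differ by a rational point
`γ` of `SL_2` and an adelic point of the torus. A priori `γ` is in `ASL_2(ℚ)`; the real components
show that it has no translation part and that it conjugates one torus to the other. -/
theorem IsToralPresentation.exists_rat (h : IsToralPresentation T g ℋ)
    (h' : IsToralPresentation T' g' ℋ) (hT : T ≤ SL2) (hT' : T' ≤ SL2) :
    ∃ γ ∈ SL2.pts ℚ, ∃ t ∈ T.pts Adele,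
      (g' : SL(3, Adele)) = baseSL Adele γ * (t * (g : SL(3, Adele))) ∧
      ∀ u : SL(3, ℚ), u ∈ T.pts ℚ ↔ γ * u * γ⁻¹ ∈ T'.pts ℚ := by
  have h1 : ASL2.adelicClass g' ∈ ASL2.adelicOrbit T g := by
    rw [← h.eq_orbit, h'.eq_orbit]
    exact ⟨1, one_mem _, by rw [one_mul]⟩
  obtain ⟨t, ht, h2⟩ := h1
  obtain ⟨γ, hγ, h3⟩ := (adelicClass_eq_iff ASL2 _ _).1 h2.symm
  have h4 : realComp (g' : SL(3, Adele)) =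
      baseSL ℝ γ * (realComp (t : SL(3, Adele)) * realComp (g : SL(3, Adele))) := by
    rw [h3, map_mul, map_baseSL]
    exact congrArg _ (map_mul realComp (t : SL(3, Adele)) (g : SL(3, Adele)))
  have htr : realComp (t : SL(3, Adele)) ∈ T.pts ℝ := map_mem_pts _ _ ht
  have hγr : baseSL ℝ γ ∈ SL2.pts ℝ := by
    rw [eq_mul_inv_of_mul_eq h4.symm]
    exact mul_mem (h'.realComp_mem_SL2 hT')
      (inv_mem (mul_mem (hT ℝ htr) (h.realComp_mem_SL2 hT)))
  have hinj : Function.Injective (algebraMap ℚ ℝ) := (algebraMap ℚ ℝ).injective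
  refine ⟨γ, mem_pts_of_map SL2 _ hinj hγr, t, ht, h3, fun u => ?_⟩
  have hmem : ∀ {S : AlgSubgroup 3} {s : ASL2.pts Adele}, IsToralPresentation S s ℋ →
      ∀ w : SL(3, ℝ), w ∈ S.pts ℝ ↔
        (realComp (s : SL(3, Adele)))⁻¹ * w * realComp (s : SL(3, Adele)) ∈ Kinf := by
    intro S s hS w
    rw [← hS.invariant]
    constructor
    · intro hw
      refine ⟨w, hw, ?_⟩
      change (realComp (s : SL(3, Adele)))⁻¹ * w * (realComp (s : SL(3, Adele)))⁻¹⁻¹ = _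
      rw [inv_inv]
    · rintro ⟨w', hw', e⟩
      change (realComp (s : SL(3, Adele)))⁻¹ * w' * (realComp (s : SL(3, Adele)))⁻¹⁻¹ = _ at e
      rw [inv_inv, mul_left_inj, mul_right_inj] at e
      rwa [← e]
  have key : ∀ w : SL(3, ℝ), w ∈ T.pts ℝ ↔
      baseSL ℝ γ * w * (baseSL ℝ γ)⁻¹ ∈ T'.pts ℝ := by
    intro w
    have e : (realComp (g' : SL(3, Adele)))⁻¹ * (baseSL ℝ γ * w * (baseSL ℝ γ)⁻¹) *
        realComp (g' : SL(3, Adele)) = (realComp (g : SL(3, Adele)))⁻¹ *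
          ((realComp (t : SL(3, Adele)))⁻¹ * w * realComp (t : SL(3, Adele))) *
            realComp (g : SL(3, Adele)) := by
      rw [h4]
      group
    rw [hmem h', e, ← hmem h]
    constructor
    · exact fun hw => mul_mem (mul_mem (inv_mem htr) hw) htr
    · intro hw
      have := mul_mem (mul_mem htr hw) (inv_mem htr)
      convert this using 1
      group
  have hrat : ∀ (S : AlgSubgroup 3) (w : SL(3, ℚ)), w ∈ S.pts ℚ ↔ baseSL ℝ w ∈ S.pts ℝ :=
    fun S w => ⟨map_mem_pts _ _, mem_pts_of_map _ _ hinj⟩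
  rw [hrat, hrat, key, map_mul, map_mul, map_inv]

theorem torusAlgebra_conj (γ : ASL2.pts ℚ)
    (h : ∀ u : SL(3, ℚ), u ∈ T.pts ℚ ↔ (γ : SL(3, ℚ)) * u * (γ : SL(3, ℚ))⁻¹ ∈ T'.pts ℚ) :
    torusAlgebra T' = (torusAlgebra T).map (conjAlgEquiv (linPart γ)).toAlgHom := by
  rw [torusAlgebra, torusAlgebra, AlgHom.map_adjoin]
  congr 1
  ext a
  constructor
  · rintro ⟨u, hu, rfl⟩
    have h1 : γ * (γ⁻¹ * u * γ) * γ⁻¹ = u := by group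
    have h2 : ((γ⁻¹ * u * γ : ASL2.pts ℚ) : SL(3, ℚ)) ∈ T.pts ℚ := by
      rw [h]
      have h3 : (γ : SL(3, ℚ)) * ((γ⁻¹ * u * γ : ASL2.pts ℚ) : SL(3, ℚ)) * (γ : SL(3, ℚ))⁻¹ = u :=
        congrArg Subtype.val h1
      rwa [h3]
    refine ⟨_, ⟨γ⁻¹ * u * γ, h2, rfl⟩, ?_⟩
    refine (linPart_conj γ (γ⁻¹ * u * γ)).trans ?_
    rw [h1]
  · rintro ⟨_, ⟨u, hu, rfl⟩, rfl⟩
    have h2 : ((γ * u * γ⁻¹ : ASL2.pts ℚ) : SL(3, ℚ)) ∈ T'.pts ℚ := (h u).1 hu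
    exact ⟨γ * u * γ⁻¹, h2, linPart_conj γ u⟩

/-- Conjugation by the linear part of `γ` carries one order to the other. The adelic point of the
torus does not matter, since it commutes with the quadratic algebra. -/
theorem IsToralPresentation.hasOrderDisc (h : IsToralPresentation T g ℋ)
    (h' : IsToralPresentation T' g' ℋ) (hT : T ≤ SL2) (hT' : T' ≤ SL2) {d : ℤ}
    (hd : HasOrderDisc (quadOrder T g) d) : HasOrderDisc (quadOrder T' g') d := by
  obtain ⟨γ, hγ, t, ht, hg', hTT'⟩ := h.exists_rat h' hT hT'
  have hγA : γ ∈ ASL2.pts ℚ := hγ.1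
  have htA : t ∈ ASL2.pts Adele := (hT Adele ht).1
  set c := linPart ⟨γ, hγA⟩ with hc
  have halg := torusAlgebra_conj ⟨γ, hγA⟩ hTT'
  -- the components of `t` commute with the rational points of the torus, which generate the algebra
  have hcomm : ∀ a ∈ torusAlgebra T, ∀ p : Nat.Primes,
      conjMat (SpecialLinearGroup.map (atPrime p) (linPart ⟨t, htA⟩))
        ((algebraMap ℚ ℚ_[(p : ℕ)]).mapMatrix a) = (algebraMap ℚ ℚ_[(p : ℕ)]).mapMatrix a := by
    intro a ha p
    rw [conjMat_eq_self_iff]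
    set L := SpecialLinearGroup.map (atPrime p) (linPart ⟨t, htA⟩) with hL
    induction ha using Algebra.adjoin_induction with
    | mem a ha =>
      obtain ⟨u, hu, rfl⟩ := ha
      let tp : ASL2.pts ℚ_[(p : ℕ)] := ⟨finComp p t, map_mem_pts _ _ htA⟩
      let up : ASL2.pts ℚ_[(p : ℕ)] := ⟨baseSL _ u, map_mem_pts _ _ u.2⟩
      have h1 : tp * up = up * tp :=
        Subtype.ext (h.maximalTorus.2.1.mul_comm_of_mem (map_mem_pts _ _ ht) (map_mem_pts _ _ hu))
      have h2 := congrArg (fun w => (linPart w).1) h1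
      simp only [linPart_mul] at h2
      exact h2
    | algebraMap r =>
      have h1 : (algebraMap ℚ ℚ_[(p : ℕ)]).mapMatrix (algebraMap ℚ (Matrix (Fin 2) (Fin 2) ℚ) r) =
          algebraMap ℚ (Matrix (Fin 2) (Fin 2) ℚ_[(p : ℕ)]) r :=
        RingHom.congr_fun (Subsingleton.elim ((algebraMap ℚ ℚ_[(p : ℕ)]).mapMatrix.comp
          (algebraMap ℚ (Matrix (Fin 2) (Fin 2) ℚ))) (algebraMap ℚ _)) r
      rw [h1]
      exact (Algebra.commutes r L.1).symm
    | add a b _ _ ha hb => rw [map_add, Matrix.mul_add, Matrix.add_mul, ha, hb]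
    | mul a b _ _ ha hb =>
      rw [map_mul, ← Matrix.mul_assoc, ha, Matrix.mul_assoc, hb, Matrix.mul_assoc]
  have hlin : ∀ p : Nat.Primes, SpecialLinearGroup.map (atPrime p) (linPart g') =
      SpecialLinearGroup.map (algebraMap ℚ ℚ_[(p : ℕ)]) c *
        (SpecialLinearGroup.map (atPrime p) (linPart ⟨t, htA⟩) *
          SpecialLinearGroup.map (atPrime p) (linPart g)) := by
    intro p
    have h1 : g' = ⟨baseSL Adele γ, map_mem_pts _ _ hγA⟩ * (⟨t, htA⟩ * g) := Subtype.ext hg'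
    rw [h1, linPart_mul, linPart_mul, map_mul, map_mul]
    rfl
  have hq : quadOrder T' g' = (quadOrder T g).map
      ((conjAlgEquiv c).toRingEquiv : Matrix (Fin 2) (Fin 2) ℚ →+* Matrix (Fin 2) (Fin 2) ℚ) := by
    have key : ∀ a ∈ torusAlgebra T, ∀ p : Nat.Primes,
        conjMat (SpecialLinearGroup.map (atPrime p) (linPart g'))⁻¹
          ((algebraMap ℚ ℚ_[(p : ℕ)]).mapMatrix (conjMat c a)) =
        conjMat (SpecialLinearGroup.map (atPrime p) (linPart g))⁻¹
          ((algebraMap ℚ ℚ_[(p : ℕ)]).mapMatrix a) := by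
      intro a ha p
      refine (conjMat_eq_iff.1 ?_).symm
      rw [conjMat_map, hlin, conjMat_mul, conjMat_mul,
        ← conjMat_mul (SpecialLinearGroup.map (atPrime p) (linPart g)), mul_inv_cancel,
        conjMat_one, hcomm a ha]
    ext a
    rw [Subring.mem_map, mem_quadOrder, halg]
    constructor
    · rintro ⟨⟨b, hb, rfl⟩, h2⟩
      refine ⟨b, mem_quadOrder.2 ⟨hb, fun p i j => ?_⟩, rfl⟩
      rw [← key b hb]
      exact h2 p i j
    · rintro ⟨b, hb, rfl⟩
      obtain ⟨hb1, hb2⟩ := mem_quadOrder.1 hb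
      refine ⟨⟨b, hb1, rfl⟩, fun p i j => ?_⟩
      have h1 := hb2 p i j
      rw [← key b hb1] at h1
      exact h1
  rw [hq]
  exact hd.map _

/-- The translation parts of the inverses of the two base points agree, since the base points
differ by left multiplication by a point of `SL_2(𝔸)`. -/
theorem IsToralPresentation.torsionOrder_eq (h : IsToralPresentation T g ℋ)
    (h' : IsToralPresentation T' g' ℋ) (hT : T ≤ SL2) (hT' : T' ≤ SL2) :
    torsionOrder g' = torsionOrder g := by
  obtain ⟨γ, hγ, t, ht, hg', -⟩ := h.exists_rat h' hT hT'
  refine addOrderOf_eq_addOrderOf_iff.2 fun n => ?_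
  rw [nsmul_torsion_eq_zero_iff, nsmul_torsion_eq_zero_iff]
  have h1 : translPart g'⁻¹ = translPart g⁻¹ := by
    have h2 : (baseSL Adele γ * t)⁻¹.1 *ᵥ ehat Adele = ehat Adele :=
      (mem_SL2.1 (inv_mem (mul_mem (map_mem_pts _ _ hγ) (hT Adele ht)))).2
    have h3 : (g' : SL(3, Adele))⁻¹ = (g : SL(3, Adele))⁻¹ * (baseSL Adele γ * t)⁻¹ := by
      rw [hg', ← mul_assoc, _root_.mul_inv_rev]
    funext i
    rw [translPart_eq, translPart_eq]
    change ((g' : SL(3, Adele))⁻¹.1 *ᵥ _) _ = ((g : SL(3, Adele))⁻¹.1 *ᵥ _) _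
    rw [h3]
    change (((g : SL(3, Adele))⁻¹.1 * (baseSL Adele γ * t)⁻¹.1) *ᵥ _) _ = _
    rw [← Matrix.mulVec_mulVec, h2]
  rw [h1]

end Independence

/-! ### Orders in imaginary quadratic subalgebras of `M_2(ℚ)` -/

/-- The order with basis `1, W` has the discriminant of the characteristic polynomial of `W`. -/
theorem hasOrderDisc_of_basis {Λ : Subring (Matrix (Fin 2) (Fin 2) ℚ)}
    {W : Matrix (Fin 2) (Fin 2) ℚ} {t s : ℤ}
    (hW : W * W = (t : ℚ) • W - (s : ℚ) • 1) (hne : W 1 0 ≠ 0)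
    (hΛ : ∀ a, a ∈ Λ ↔ ∃ m n : ℤ, a = (m : ℚ) • 1 + (n : ℚ) • W) :
    HasOrderDisc Λ (t ^ 2 - 4 * s) := by
  let w : Λ := ⟨W, (hΛ W).2 ⟨0, 1, by simp⟩⟩
  have hww : w * w = (-s) • 1 + t • w := by
    refine Subtype.ext (hW.trans ?_)
    change (t : ℚ) • W - (s : ℚ) • 1 = (-s) • (1 : Matrix (Fin 2) (Fin 2) ℚ) + t • W
    rw [neg_smul, neg_add_eq_sub, Int.cast_smul_eq_zsmul, Int.cast_smul_eq_zsmul]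
  have hli : LinearIndependent ℤ ![1, w] := by
    rw [LinearIndependent.pair_iff]
    intro m n h
    have h1 : m • (1 : Matrix (Fin 2) (Fin 2) ℚ) + n • W = 0 := congrArg Subtype.val h
    rw [← Int.cast_smul_eq_zsmul ℚ m, ← Int.cast_smul_eq_zsmul ℚ n] at h1
    have h2 := congrFun (congrFun h1 1) 0
    have h3 := congrFun (congrFun h1 0) 0
    simp [hne] at h2 h3
    subst h2
    simpa using h3
  have hsp : ⊤ ≤ Submodule.span ℤ (Set.range ![1, w]) := by
    rintro ⟨a, ha⟩ -
    obtain ⟨m, n, h⟩ := (hΛ a).1 ha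
    rw [Int.cast_smul_eq_zsmul, Int.cast_smul_eq_zsmul] at h
    have h1 : (⟨a, ha⟩ : Λ) = m • 1 + n • w := Subtype.ext h
    rw [h1]
    exact add_mem (Submodule.smul_mem _ _ (Submodule.subset_span ⟨0, rfl⟩))
      (Submodule.smul_mem _ _ (Submodule.subset_span ⟨1, rfl⟩))
  let b : Module.Basis (Fin 2) ℤ Λ := Module.Basis.mk hli hsp
  have hb0 : b 0 = 1 := by simp [b]
  have hb1 : b 1 = w := by simp [b]
  have hrepr : ∀ (m n : ℤ), b.repr (m • 1 + n • w) 0 = m ∧ b.repr (m • 1 + n • w) 1 = n := by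
    intro m n
    rw [← hb0, ← hb1]
    simp [-zsmul_eq_mul]
  have htr : ∀ m n : ℤ, LinearMap.trace ℤ Λ (LinearMap.mulLeft ℤ (m • 1 + n • w)) =
      2 * m + n * t := by
    intro m n
    have h1 : (m • 1 + n • w) * w = (-(n * s)) • 1 + (m + n * t) • w := by
      rw [add_mul, smul_mul_assoc, smul_mul_assoc, one_mul, hww, smul_add, smul_smul, smul_smul,
        add_smul, mul_neg]
      abel
    rw [LinearMap.trace_eq_matrix_trace ℤ b, Matrix.trace, Fin.sum_univ_two, Matrix.diag_apply,
      Matrix.diag_apply, LinearMap.toMatrix_apply, LinearMap.toMatrix_apply, hb0, hb1,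
      LinearMap.mulLeft_apply, LinearMap.mulLeft_apply, mul_one, h1, (hrepr _ _).1, (hrepr _ _).2]
    ring
  have e00 : b 0 * b 0 = (1 : ℤ) • 1 + (0 : ℤ) • w := by rw [hb0]; simp
  have e01 : b 0 * b 1 = (0 : ℤ) • 1 + (1 : ℤ) • w := by rw [hb0, hb1]; simp
  have e10 : b 1 * b 0 = (0 : ℤ) • 1 + (1 : ℤ) • w := by rw [hb0, hb1]; simp
  have e11 : b 1 * b 1 = (-s) • 1 + t • w := by rw [hb1, hww]
  refine ⟨b, ?_⟩
  rw [Matrix.det_fin_two]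
  simp only [Matrix.of_apply]
  rw [e00, e01, e10, e11, htr, htr, htr]
  ring

/-- The matrix `J S`, with `S = (c, d; d, e)` and `J` the rotation by a right angle; its square is
`-det S`. -/
def formMat (c d e : ℤ) : Matrix (Fin 2) (Fin 2) ℚ := !![-(d : ℚ), -e; c, d]

section Forms

variable {c d e D : ℤ} {Λ : Subring (Matrix (Fin 2) (Fin 2) ℚ)}

/-- If `α + β J S` has integral entries, so do `α - β d`, `β c`, `β e` and `2 β d`. For a primitive
form `S`, a Bézout relation between `c`, `d` and `e` then shows that `2 β` is an integer. -/
theorem exists_half_coeff {a : Matrix (Fin 2) (Fin 2) ℚ} {α β : ℚ}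
    (hp : ∃ A B E : ℤ, c * A + d * B + e * E = 1)
    (ha : a = α • (1 : Matrix (Fin 2) (Fin 2) ℚ) + β • formMat c d e)
    (hint : ∀ i j, ∃ n : ℤ, a i j = n) :
    ∃ m n k l : ℤ, α - β * d = m ∧ 2 * β = n ∧ β * c = k ∧ β * e = l := by
  obtain ⟨A, B, E, hABE⟩ := hp
  obtain ⟨m, h00⟩ := hint 0 0
  obtain ⟨l, h01⟩ := hint 0 1
  obtain ⟨k, h10⟩ := hint 1 0
  obtain ⟨r, h11⟩ := hint 1 1
  simp [ha, formMat] at h00 h01 h10 h11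
  have hABE' : (c * A + d * B + e * E : ℚ) = 1 := by exact_mod_cast hABE
  refine ⟨m, 2 * k * A + (r - m) * B - 2 * l * E, k, -l, by linarith, ?_, h10, ?_⟩
  · push_cast
    linear_combination (-2 * β) * hABE' + 2 * A * h10 + B * h11 - B * h00 - 2 * E * h01
  · push_cast
    linarith

/-- If `D` is `1` or `2` modulo four, then `c` and `e` are not both even, and the order has basis
`1, J S`. -/
theorem hasOrderDisc_formMat_of_mod_four (hc : c ≠ 0) (hD : c * e - d ^ 2 = D)
    (hp : ∃ A B E : ℤ, c * A + d * B + e * E = 1) (hD4 : D % 4 = 1 ∨ D % 4 = 2)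
    (hΛ : ∀ a, a ∈ Λ ↔ (∃ α β : ℚ, a = α • (1 : Matrix (Fin 2) (Fin 2) ℚ) + β • formMat c d e) ∧
      ∀ i j, ∃ n : ℤ, a i j = n) : HasOrderDisc Λ (-4 * D) := by
  have h := hasOrderDisc_of_basis (Λ := Λ) (W := formMat c d e) (t := 0) (s := D) ?_ ?_ ?_
  · convert h using 1
    ring
  · rw [← hD]
    ext i j
    fin_cases i <;> fin_cases j <;> simp [formMat, Matrix.mul_apply] <;> ring
  · simpa [formMat] using hc
  · intro a
    rw [hΛ]
    constructor
    · rintro ⟨⟨α, β, ha⟩, hint⟩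
      obtain ⟨m, n, k, l, h1, h2, h3, h4⟩ := exists_half_coeff hp ha hint
      have hk : n * c = 2 * k := by
        have : (n * c : ℚ) = 2 * k := by rw [← h2, ← h3]; ring
        exact_mod_cast this
      have hl : n * e = 2 * l := by
        have : (n * e : ℚ) = 2 * l := by rw [← h2, ← h4]; ring
        exact_mod_cast this
      have hn : Even n := by
        by_contra hodd
        rw [Int.not_even_iff_odd] at hodd
        have hce : Even c := by
          have : Even (n * c) := ⟨k, by rw [hk]; ring⟩
          exact (Int.even_mul.1 this).resolve_left (Int.not_even_iff_odd.2 hodd)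
        have hee : Even e := by
          have : Even (n * e) := ⟨l, by rw [hl]; ring⟩
          exact (Int.even_mul.1 this).resolve_left (Int.not_even_iff_odd.2 hodd)
        obtain ⟨c', rfl⟩ := hce
        obtain ⟨e', rfl⟩ := hee
        -- `D` would be `-d²` modulo four
        have h5 : D = 4 * (c' * e') - d ^ 2 := by rw [← hD]; ring
        rcases Int.even_or_odd' d with ⟨f, rfl | rfl⟩ <;> ring_nf at h5 <;> omega
      obtain ⟨n', rfl⟩ := hn
      have hβ : β = n' := by
        push_cast at h2
        linarith
      refine ⟨m + n' * d, n', ?_⟩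
      have hα : α = m + n' * d := by rw [← hβ]; linarith
      rw [ha, hα, hβ]
      push_cast
      rfl
    · rintro ⟨m, n, rfl⟩
      refine ⟨⟨m, n, rfl⟩, fun i j => ?_⟩
      fin_cases i <;> fin_cases j
      · exact ⟨m - n * d, by simp [formMat, sub_eq_add_neg]⟩
      · exact ⟨-(n * e), by simp [formMat]⟩
      · exact ⟨n * c, by simp [formMat]⟩
      · exact ⟨m + n * d, by simp [formMat]⟩

/-- If `c` and `e` are even, the order has basis `1, (d + J S) / 2`. -/
theorem hasOrderDisc_formMat_of_even (hc : c ≠ 0) (hD : c * e - d ^ 2 = D)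
    (hp : ∃ A B E : ℤ, c * A + d * B + e * E = 1) (hce : Even c) (hee : Even e)
    (hΛ : ∀ a, a ∈ Λ ↔ (∃ α β : ℚ, a = α • (1 : Matrix (Fin 2) (Fin 2) ℚ) + β • formMat c d e) ∧
      ∀ i j, ∃ n : ℤ, a i j = n) : HasOrderDisc Λ (-D) := by
  obtain ⟨c', rfl⟩ := hce
  obtain ⟨e', rfl⟩ := hee
  have h := hasOrderDisc_of_basis (Λ := Λ) (W := !![0, -(e' : ℚ); c', d]) (t := d) (s := c' * e')
    ?_ ?_ ?_
  · convert h using 1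
    rw [← hD]
    ring
  · ext i j
    fin_cases i <;> fin_cases j <;> simp [Matrix.mul_apply] <;> ring
  · simpa using hc
  · have hW : formMat (c' + c') d (e' + e') =
        (2 : ℚ) • !![0, -(e' : ℚ); c', d] - (d : ℚ) • 1 := by
      ext i j
      fin_cases i <;> fin_cases j <;> simp [formMat] <;> ring
    intro a
    rw [hΛ]
    constructor
    · rintro ⟨⟨α, β, ha⟩, hint⟩
      obtain ⟨m, n, k, l, h1, h2, h3, h4⟩ := exists_half_coeff hp ha hint
      refine ⟨m, n, ?_⟩
      rw [ha, hW, ← h1, ← h2]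
      module
    · rintro ⟨m, n, rfl⟩
      refine ⟨⟨m + n * d / 2, n / 2, ?_⟩, fun i j => ?_⟩
      · rw [hW]
        module
      · fin_cases i <;> fin_cases j
        · exact ⟨m, by simp⟩
        · exact ⟨-(n * e'), by simp⟩
        · exact ⟨n * c', by simp⟩
        · exact ⟨m + n * d, by simp⟩

end Forms

/-! ### The quadratic algebra of a torus and its discriminant -/

section TorusAlgebra

variable {v : Fin 3 → ℚ} {q : SL(3, ℚ)}

/-- The linear part of a generator of the Lie algebra of the torus. -/
def torusGen (v : Fin 3 → ℚ) (q : SL(3, ℚ)) : Matrix (Fin 2) (Fin 2) ℚ :=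
  (conjMat q (crossMat v)).submatrix Fin.castSucc Fin.castSucc

theorem vecMul_inv_eq_ehat (hq : q.1 2 = v) : v ᵥ* q⁻¹.1 = ehat ℚ := by
  rw [← hq, ← ehat_vecMul q.1, Matrix.vecMul_vecMul, SL_mul_inv, Matrix.vecMul_one]

theorem ehat_vecMul_conj_crossMat (hq : q.1 2 = v) : ehat ℚ ᵥ* conjMat q (crossMat v) = 0 := by
  rw [conjMat, ← Matrix.vecMul_vecMul, ← Matrix.vecMul_vecMul, ehat_vecMul, hq,
    vecMul_crossMat_self, Matrix.zero_vecMul]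

/-- The linear part of the conjugate by `q` of a rotation about `v`. -/
theorem submatrix_conj_rot (hq : q.1 2 = v) (e a b : ℚ) :
    (conjMat q (rot v e a b)).submatrix Fin.castSucc Fin.castSucc =
      a • (1 : Matrix (Fin 2) (Fin 2) ℚ) + b • torusGen v q := by
  have h1 : conjMat q (rot v e a b) = a • 1 + b • conjMat q (crossMat v) +
      (e * (1 - a)) • vecMulVec (q.1 *ᵥ v) (ehat ℚ) := by
    rw [rot, conjMat, conjMat, Matrix.mul_add, Matrix.mul_add, Matrix.add_mul, Matrix.add_mul,
      Matrix.mul_smul, Matrix.mul_smul, Matrix.mul_smul, Matrix.smul_mul, Matrix.smul_mul,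
      Matrix.smul_mul, Matrix.mul_one, SL_mul_inv, Matrix.mul_vecMulVec, Matrix.vecMulVec_mul,
      vecMul_inv_eq_ehat hq]
  rw [h1]
  ext i j
  fin_cases i <;> fin_cases j <;> simp [torusGen, ehat]

theorem torusGen_mul_self (hq : q.1 2 = v) :
    torusGen v q * torusGen v q = (-(v ⬝ᵥ v)) • (1 : Matrix (Fin 2) (Fin 2) ℚ) := by
  set Z := conjMat q (crossMat v) with hZ
  have hrow : Z 2 = 0 := by rw [← ehat_vecMul Z, hZ, ehat_vecMul_conj_crossMat hq]
  have h1 : Z * Z = vecMulVec (q.1 *ᵥ v) (ehat ℚ) - (v ⬝ᵥ v) • (1 : Matrix (Fin 3) (Fin 3) ℚ) := by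
    have h2 : Z * Z = conjMat q (crossMat v * crossMat v) := by
      rw [hZ, conjMat, conjMat]
      calc _ = q.1 * crossMat v * (q⁻¹.1 * q.1) * crossMat v * q⁻¹.1 := by
            simp only [Matrix.mul_assoc]
        _ = _ := by
            rw [SL_inv_mul, Matrix.mul_one]
            simp only [Matrix.mul_assoc]
    rw [h2, crossMat_mul_self, conjMat, Matrix.mul_sub, Matrix.sub_mul, Matrix.mul_smul,
      Matrix.smul_mul, Matrix.mul_one, SL_mul_inv, Matrix.mul_vecMulVec, Matrix.vecMulVec_mul,
      vecMul_inv_eq_ehat hq]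
  ext i j
  have h2 := congrFun (congrFun h1 i.castSucc) j.castSucc
  rw [Matrix.mul_apply, Fin.sum_univ_castSucc] at h2
  have h3 : Z (Fin.last 2) j.castSucc = 0 := congrFun hrow j.castSucc
  rw [h3, mul_zero, add_zero] at h2
  rw [Matrix.mul_apply]
  refine h2.trans ?_
  fin_cases i <;> fin_cases j <;> simp [ehat]

theorem exists_linPart_eq (hv : v ⬝ᵥ v ≠ 0) (hq : q.1 2 = v) {u : ASL2.pts ℚ}
    (hu : (u : SL(3, ℚ)) ∈ ((axisTorus v).conj q).pts ℚ) :
    ∃ a b : ℚ, (linPart u).1 = a • (1 : Matrix (Fin 2) (Fin 2) ℚ) + b • torusGen v q := by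
  obtain ⟨a, b, hab, h⟩ := exists_rotSL hv (mem_conj.1 hu)
  refine ⟨a, b, ?_⟩
  rw [← submatrix_conj_rot hq (v ⬝ᵥ v)⁻¹]
  have h1 : (u : SL(3, ℚ)) = q * rotSL hv a b hab * q⁻¹ := by
    rw [← h]
    change (u : SL(3, ℚ)) = q * (q⁻¹ * u * q) * q⁻¹
    group
  change ((u : SL(3, ℚ)).1).submatrix _ _ = _
  rw [h1]
  rfl

/-- The quadratic algebra of the torus is spanned by `1` and the generator `torusGen`, whose square
is the scalar `-⟨v, v⟩`: one rational rotation of angle different from `0` and `π` suffices to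
generate it. -/
theorem mem_torusAlgebra (hv : v ⬝ᵥ v ≠ 0) (hq : q.1 2 = v) {a : Matrix (Fin 2) (Fin 2) ℚ} :
    a ∈ torusAlgebra ((axisTorus v).conj q) ↔
      ∃ α β : ℚ, a = α • (1 : Matrix (Fin 2) (Fin 2) ℚ) + β • torusGen v q := by
  constructor
  · intro ha
    induction ha using Algebra.adjoin_induction with
    | mem a ha =>
      obtain ⟨u, hu, rfl⟩ := ha
      exact exists_linPart_eq hv hq hu
    | algebraMap r => exact ⟨r, 0, by rw [zero_smul, add_zero, Algebra.algebraMap_eq_smul_one]⟩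
    | add a b _ _ ha hb =>
      obtain ⟨α, β, rfl⟩ := ha
      obtain ⟨α', β', rfl⟩ := hb
      exact ⟨α + α', β + β', by module⟩
    | mul a b _ _ ha hb =>
      obtain ⟨α, β, rfl⟩ := ha
      obtain ⟨α', β', rfl⟩ := hb
      refine ⟨α * α' - β * β' * (v ⬝ᵥ v), α * β' + β * α', ?_⟩
      rw [Matrix.add_mul, Matrix.mul_add, Matrix.mul_add, Matrix.smul_mul, Matrix.smul_mul,
        Matrix.smul_mul, Matrix.smul_mul, Matrix.mul_smul, Matrix.mul_smul, Matrix.mul_smul,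
        Matrix.mul_smul, torusGen_mul_self hq, Matrix.one_mul, Matrix.mul_one, Matrix.one_mul]
      module
  · rintro ⟨α, β, rfl⟩
    obtain ⟨a, b, hab, hb⟩ := exists_generic_rotation hv
    have h1 : q * rotSL (R := ℚ) hv a b hab * q⁻¹ ∈ ((axisTorus v).conj q).pts ℚ := by
      rw [mem_conj]
      have h2 : q⁻¹ * (q * rotSL (R := ℚ) hv a b hab * q⁻¹) * q = rotSL (R := ℚ) hv a b hab := by
        group
      change q⁻¹ * (q * rotSL (R := ℚ) hv a b hab * q⁻¹) * q ∈ _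
      rw [h2]
      exact rotSL_mem _ _ _ _
    have h2 : a • (1 : Matrix (Fin 2) (Fin 2) ℚ) + b • torusGen v q ∈
        torusAlgebra ((axisTorus v).conj q) :=
      Algebra.subset_adjoin ⟨⟨_, axisTorus_conj_le hv hq ℚ h1⟩, h1,
        (submatrix_conj_rot hq (v ⬝ᵥ v)⁻¹ a b).symm⟩
    have h3 : α • (1 : Matrix (Fin 2) (Fin 2) ℚ) + β • torusGen v q =
        (α - β * b⁻¹ * a) • (1 : Matrix (Fin 2) (Fin 2) ℚ) +
          (β * b⁻¹) • (a • (1 : Matrix (Fin 2) (Fin 2) ℚ) + b • torusGen v q) := by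
      rw [smul_add, smul_smul, smul_smul, inv_mul_cancel_right₀ hb]
      module
    rw [h3]
    exact add_mem (Subalgebra.smul_mem _ (one_mem _) _) (Subalgebra.smul_mem _ h2 _)

/-- The torus lies in `SL_2` as soon as the axis is mapped to the line of `ê`. -/
theorem axisTorus_conj_le_SL2 (hv : v ⬝ᵥ v ≠ 0) (hq : q.1 2 = v)
    (hqv : q.1 *ᵥ v = (v ⬝ᵥ v) • ehat ℚ) : (axisTorus v).conj q ≤ SL2 := by
  intro R _ _ u hu
  refine mem_SL2.2 ⟨axisTorus_conj_le hv hq R hu, ?_⟩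
  have h1 : (baseSL R q).1 *ᵥ baseVec R v = algebraMap ℚ R (v ⬝ᵥ v) • ehat R := by
    funext i
    have := congrArg (algebraMap ℚ R) (congrFun hqv i)
    rw [← baseVec_ehat]
    simpa [Matrix.mulVec, dotProduct, baseVec] using this
  have h2 := (mem_axisTorus.1 (mem_conj.1 hu)).2
  change ((baseSL R q)⁻¹.1 * u.1 * (baseSL R q).1) *ᵥ _ = _ at h2
  rw [← Matrix.mulVec_mulVec, ← Matrix.mulVec_mulVec, h1] at h2
  have h3 := mulVec_eq_iff.1 h2
  rw [inv_inv, h1, Matrix.mulVec_smul] at h3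
  have h4 := congrArg (fun w => algebraMap ℚ R (v ⬝ᵥ v)⁻¹ • w) h3
  simpa only [smul_smul, ← map_mul, inv_mul_cancel₀ hv, map_one, one_smul] using h4

end TorusAlgebra

/-! ### A presentation with torus in `SL_2` -/

/-- Conjugating the torus and translating the base point by the same rational matrix does not change
the orbit. -/
theorem adelicOrbit_conj {T : AlgSubgroup 3} {q γ : SL(3, ℚ)} (hγ : γ ∈ ASL2.pts ℚ)
    (g : ASL2.pts Adele) :
    ASL2.adelicOrbit (T.conj (γ * q)) (⟨baseSL Adele γ, map_mem_pts _ _ hγ⟩ * g) =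
      ASL2.adelicOrbit (T.conj q) g := by
  have key : ∀ t : SL(3, Adele), t ∈ (T.conj (γ * q)).pts Adele ↔
      (baseSL Adele γ)⁻¹ * t * baseSL Adele γ ∈ (T.conj q).pts Adele := by
    intro t
    rw [mem_conj, mem_conj, map_mul]
    have : (baseSL Adele γ * baseSL Adele q)⁻¹ * t * (baseSL Adele γ * baseSL Adele q) =
        (baseSL Adele q)⁻¹ * ((baseSL Adele γ)⁻¹ * t * baseSL Adele γ) * baseSL Adele q := by
      group
    rw [this]
  set c : ASL2.pts Adele := ⟨baseSL Adele γ, map_mem_pts _ _ hγ⟩ with hc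
  have hcl : ∀ h : ASL2.pts Adele, ASL2.adelicClass (c * h) = ASL2.adelicClass h := fun h =>
    ((adelicClass_eq_iff ASL2 _ _).2 ⟨γ, hγ, rfl⟩).symm
  ext a
  constructor
  · rintro ⟨t, ht, rfl⟩
    refine ⟨c⁻¹ * t * c, (key _).1 ht, ?_⟩
    rw [← hcl (c⁻¹ * t * c * g)]
    congr 1
    group
  · rintro ⟨t, ht, rfl⟩
    refine ⟨c * t * c⁻¹, (key _).2 ?_, ?_⟩
    · have : (baseSL Adele γ)⁻¹ * (baseSL Adele γ * t * (baseSL Adele γ)⁻¹) * baseSL Adele γ =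
          (t : SL(3, Adele)) := by group
      change (baseSL Adele γ)⁻¹ * (baseSL Adele γ * t * (baseSL Adele γ)⁻¹) * baseSL Adele γ ∈ _
      rwa [this]
    · rw [← hcl (t * g)]
      congr 1
      group

/-- The translation that moves the point `w / D` of the plane `ê + ê^⊥` to `ê`, for `w_2 = D`. -/
def originShift (D : ℕ) (w : Fin 3 → ℤ) : SL(3, ℚ) :=
  affineSL 1 0 0 1 (-(w 0 / D : ℚ)) (-(w 1 / D : ℚ)) (by norm_num)

theorem originShift_mem (D : ℕ) (w : Fin 3 → ℤ) : originShift D w ∈ ASL2.pts ℚ :=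
  affineSL_mem _ _ _ _ _ _ _

theorem originShift_mulVec {D : ℕ} {w : Fin 3 → ℤ} (hD : 0 < D) (hw : w 2 = D) :
    (originShift D w).1 *ᵥ (fun i => (w i : ℚ)) = (D : ℚ) • ehat ℚ := by
  have hD' : (D : ℚ) ≠ 0 := Nat.cast_ne_zero.2 hD.ne'
  have hw' : (w 2 : ℚ) = D := by exact_mod_cast hw
  funext i
  fin_cases i <;>
    simp [originShift, affineSL, Matrix.mulVec, dotProduct, Fin.sum_univ_three, ehat, hw', hD']

theorem inv_originShift (D : ℕ) (w : Fin 3 → ℤ) : (originShift D w)⁻¹ =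
    affineSL 1 0 0 1 (w 0 / D : ℚ) (w 1 / D : ℚ) (by norm_num) := by
  rw [inv_eq_iff_mul_eq_one]
  refine Subtype.ext ?_
  change (originShift D w).1 * _ = 1
  ext i j
  fin_cases i <;> fin_cases j <;>
    simp [originShift, affineSL, Matrix.mul_apply, Fin.sum_univ_three]

theorem linPart_originShift (D : ℕ) (w : Fin 3 → ℤ) :
    linPart ⟨originShift D w, originShift_mem D w⟩ = 1 := by
  refine Subtype.ext (Matrix.ext fun i j => ?_)
  fin_cases i <;> fin_cases j <;> rfl

section Presentation

variable {D : ℕ} {x : Fin 3 → ℤ} {δ : SL(3, ℤ)}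

theorem cartan_mulVec_two (hx : x ∈ primitivePoints D) (hδ : δ.1 *ᵥ x = ehat ℤ) :
    ((cartan ℤ δ).1 *ᵥ x) 2 = D := by
  have h1 := congrFun (mulVec_toRat (cartan ℤ δ) x) 2
  have h2 : ((toRatSL (cartan ℤ δ)).1 *ᵥ fun i => (x i : ℚ)) 2 =
      (toRatSL (cartan ℤ δ)).1 2 ⬝ᵥ fun i => (x i : ℚ) := rfl
  rw [h2, cartan_last_row hδ, axis_dotProduct hx] at h1
  exact_mod_cast h1.symm

/-- The conjugator of the torus of the presentation in `SL_2`. -/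
def centeredConj (D : ℕ) (x : Fin 3 → ℤ) (δ : SL(3, ℤ)) : SL(3, ℚ) :=
  originShift D ((cartan ℤ δ).1 *ᵥ x) * toRatSL (cartan ℤ δ)

theorem centeredConj_last_row (hδ : δ.1 *ᵥ x = ehat ℤ) :
    (centeredConj D x δ).1 2 = fun i => (x i : ℚ) := by
  rw [← ehat_vecMul (centeredConj D x δ).1]
  change ehat ℚ ᵥ* ((originShift D ((cartan ℤ δ).1 *ᵥ x)).1 * (toRatSL (cartan ℤ δ)).1) = _
  rw [← Matrix.vecMul_vecMul, mem_ASL2.1 (originShift_mem _ _), ehat_vecMul, cartan_last_row hδ]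

theorem centeredConj_le (hx : x ∈ primitivePoints D) (hδ : δ.1 *ᵥ x = ehat ℤ) :
    (axisTorus fun i => (x i : ℚ)).conj (centeredConj D x δ) ≤ SL2 := by
  refine axisTorus_conj_le_SL2 (norm_ne_zero hx) (centeredConj_last_row hδ) ?_
  change ((originShift D ((cartan ℤ δ).1 *ᵥ x)).1 * (toRatSL (cartan ℤ δ)).1) *ᵥ _ = _
  rw [← Matrix.mulVec_mulVec, mulVec_toRat, axis_dotProduct hx]
  exact originShift_mulVec (pos_of_primitive hx) (cartan_mulVec_two hx hδ)

/-- The adelic point of the presentation in `SL_2`. -/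
def centeredPoint (D : ℕ) (x : Fin 3 → ℤ) (δ : SL(3, ℤ)) (g : ASL2.pts ℝ) : ASL2.pts Adele :=
  ⟨baseSL Adele (originShift D ((cartan ℤ δ).1 *ᵥ x)), map_mem_pts _ _ (originShift_mem _ _)⟩ *
    ASL2.ofReal g

/-- Moving the fixed point of the torus to the origin by a rational translation presents the toral
set by a torus in `SL_2`. -/
theorem isToralPresentation_centered (hx : x ∈ primitivePoints D) (hδ : δ.1 *ᵥ x = ehat ℤ)
    {g : ASL2.pts ℝ} (hg : ConjugatesToKinf x δ g) :
    IsToralPresentation ((axisTorus fun i => (x i : ℚ)).conj (centeredConj D x δ))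
      (centeredPoint D x δ g) (gridToralSet x δ g) := by
  have h1 : ASL2.adelicOrbit ((axisTorus fun i => (x i : ℚ)).conj (centeredConj D x δ))
      (centeredPoint D x δ g) = gridToralSet x δ g :=
    adelicOrbit_conj (originShift_mem _ _) _
  rw [← h1]
  refine isToralPresentation_axisTorus (norm_ne_zero hx) (centeredConj_last_row hδ) _ ?_
  rw [← hg]
  change (((torus x).pts ℝ).map (MulAut.conj
    (baseSL ℝ (centeredConj D x δ))).toMonoidHom).map (MulAut.conj
      (realComp (baseSL Adele (originShift D ((cartan ℤ δ).1 *ᵥ x)) *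
        (ASL2.ofReal g : SL(3, Adele))))⁻¹).toMonoidHom = _
  rw [Subgroup.map_map, map_mul realComp, map_baseSL, realComp_ofReal, centeredConj,
    map_mul (baseSL ℝ), toReal_of_rat_int]
  change ((torus x).pts ℝ).map ((MulAut.conj _ * MulAut.conj _ : MulAut SL(3, ℝ))).toMonoidHom = _
  rw [← map_mul, _root_.mul_inv_rev, mul_assoc, inv_mul_cancel_left]

/-- The torsion order is the order of `w / D` modulo `ℤ²`, where `w` is a primitive vector with
last coordinate `D`. -/
theorem torsionOrder_centered (hx : x ∈ primitivePoints D) (hδ : δ.1 *ᵥ x = ehat ℤ)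
    (g : ASL2.pts ℝ) : torsionOrder (centeredPoint D x δ g) = D := by
  set w := (cartan ℤ δ).1 *ᵥ x with hw
  have hD : (D : ℚ) ≠ 0 := Nat.cast_ne_zero.2 (pos_of_primitive hx).ne'
  have hw2 : w 2 = D := cartan_mulVec_two hx hδ
  have hentry : ∀ (i : Fin 2) (p : Nat.Primes), (translPart (centeredPoint D x δ g)⁻¹ i).2 p =
      ((w i.castSucc / D : ℚ) : ℚ_[(p : ℕ)]) := by
    intro i p
    have h1 : finComp p ((centeredPoint D x δ g)⁻¹ : ASL2.pts Adele).1 =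
        baseSL ℚ_[(p : ℕ)] (originShift D w)⁻¹ := by
      change finComp p (baseSL Adele (originShift D w) * (ASL2.ofReal g : SL(3, Adele)))⁻¹ = _
      rw [map_inv, map_mul, finComp_ofReal, mul_one, map_baseSL, map_inv]
    have h2 := congrFun (congrFun (congrArg Subtype.val h1) i.castSucc) 2
    rw [inv_originShift] at h2
    refine h2.trans ?_
    fin_cases i <;> rfl
  have key : ∀ n : ℕ, n • (QuotientAddGroup.mk
      (fun i => (translPart (centeredPoint D x δ g) i).2) :
        (Fin 2 → FinAdele) ⧸ finLattice (centeredPoint D x δ g)) = 0 ↔ D ∣ n := by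
    intro n
    rw [nsmul_torsion_eq_zero_iff]
    constructor
    · intro h
      have h1 : ∀ i : Fin 2, (D : ℤ) ∣ n * w i.castSucc := by
        intro i
        obtain ⟨m, hm⟩ := exists_int_of_forall_padicInt (q := n * (w i.castSucc / D : ℚ))
          fun p => by
            have := h i p
            rw [hentry] at this
            exact_mod_cast this
        refine ⟨m, ?_⟩
        have h2 : (n * w i.castSucc : ℚ) = D * m := by
          rw [← hm]
          field_simp
        exact_mod_cast h2
      have h2 : ∀ i : Fin 3, (D : ℤ) ∣ n * w i := by
        intro i
        fin_cases i
        · exact h1 0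
        · exact h1 1
        · exact ⟨n, by change (n : ℤ) * w 2 = _; rw [hw2, mul_comm]⟩
      choose z hz using h2
      -- `n ê = n δ ᵗδ w` is divisible by `D`
      have h3 : (δ.1 * δ.1ᵀ) *ᵥ w = ehat ℤ := by
        rw [← cartan_inv_coe, hw, ← Matrix.mulVec_mulVec, ← mulVec_eq_iff.1 rfl, hδ]
      have h4 : (n : ℤ) • w = (D : ℤ) • z := funext hz
      have h5 := congrFun (congrArg (fun u => (δ.1 * δ.1ᵀ) *ᵥ u) h4) 2
      simp only [Matrix.mulVec_smul, h3] at h5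
      have h6 : (n : ℤ) = D * ((δ.1 * δ.1ᵀ) *ᵥ z) 2 := by
        refine Eq.trans ?_ h5
        simp [ehat]
      exact Int.natCast_dvd_natCast.1 ⟨_, h6⟩
    · rintro ⟨m, rfl⟩ i p
      rw [hentry]
      have h1 : ((D * m : ℕ) : ℚ_[(p : ℕ)]) * ((w i.castSucc / D : ℚ) : ℚ_[(p : ℕ)]) =
          ((m * w i.castSucc : ℤ) : ℚ_[(p : ℕ)]) := by
        have h2 : ((D * m : ℕ) : ℚ) * (w i.castSucc / D : ℚ) = ((m * w i.castSucc : ℤ) : ℚ) := by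
          push_cast
          field_simp
        have h3 := congrArg (fun r : ℚ => (r : ℚ_[(p : ℕ)])) h2
        simpa using h3
      rw [h1]
      exact intCast_mem _ _
  refine Nat.dvd_antisymm (addOrderOf_dvd_of_nsmul_eq_zero ((key D).2 dvd_rfl)) ?_
  exact (key _).1 (addOrderOf_nsmul_eq_zero _)

end Presentation

/-! ### The discriminant -/

section Discriminant

variable {D : ℕ} {x : Fin 3 → ℤ} {δ : SL(3, ℤ)}

/-- By the equivariance of the cross product, `ᶿδ (x × ·) (ᶿδ)⁻¹ = (ê × ·) δ ᵗδ`. -/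
theorem conjMat_cartan_crossMat (hδ : δ.1 *ᵥ x = ehat ℤ) :
    conjMat (toRatSL (cartan ℤ δ)) (crossMat fun i => (x i : ℚ)) =
      crossMat (ehat ℚ) * (Int.castRingHom ℚ).mapMatrix (δ.1 * δ.1ᵀ) := by
  have h1 : (toRatSL δ).1 *ᵥ (fun i => (x i : ℚ)) = ehat ℚ := by
    rw [mulVec_toRat, hδ, intCast_ehat]
  have h2 := transpose_mul_crossMat_mul (toRatSL δ).1 fun i => (x i : ℚ)
  rw [h1, (toRatSL δ).2, one_smul] at h2
  have h3 : (cartan ℚ (toRatSL δ)).1 * (toRatSL δ).1ᵀ = 1 := by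
    rw [← cartan_inv_coe, SL_mul_inv]
  rw [map_cartan, conjMat, cartan_inv_coe, ← h2, ← Matrix.mul_assoc, ← Matrix.mul_assoc, h3,
    Matrix.one_mul, Matrix.mul_assoc, map_mul]
  rfl

/-- The quadratic algebra is generated by `J S`, where `S` is the Gram matrix of the basis of
`x^⊥(ℤ)` given by the first two rows of `δ`. -/
theorem torusGen_centered (hδ : δ.1 *ᵥ x = ehat ℤ) :
    torusGen (fun i => (x i : ℚ)) (centeredConj D x δ) =
      formMat ((δ.1 * δ.1ᵀ) 0 0) ((δ.1 * δ.1ᵀ) 0 1) ((δ.1 * δ.1ᵀ) 1 1) := by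
  have hsymm : (δ.1 * δ.1ᵀ) 1 0 = (δ.1 * δ.1ᵀ) 0 1 := by
    rw [← Matrix.transpose_apply (δ.1 * δ.1ᵀ), Matrix.transpose_mul, Matrix.transpose_transpose]
  rw [torusGen, centeredConj, conjMat_mul, conjMat_cartan_crossMat hδ, conjMat, inv_originShift]
  set S := δ.1 * δ.1ᵀ
  have hJS : crossMat (ehat ℚ) * (Int.castRingHom ℚ).mapMatrix S =
      !![-(S 0 1 : ℚ), -S 1 1, -S 1 2; S 0 0, S 0 1, S 0 2; 0, 0, 0] := by
    ext i j
    rw [Matrix.mul_apply, Fin.sum_univ_three]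
    fin_cases i <;> fin_cases j <;> simp [crossMat, ehat, hsymm]
  rw [hJS]
  ext i j
  fin_cases i <;> fin_cases j <;> simp [originShift, affineSL, formMat]

/-- The form of `x^⊥(ℤ)` has determinant `D`. -/
theorem formMat_norm (hx : x ∈ primitivePoints D) (hδ : δ.1 *ᵥ x = ehat ℤ) :
    (δ.1 * δ.1ᵀ) 0 0 * (δ.1 * δ.1ᵀ) 1 1 - (δ.1 * δ.1ᵀ) 0 1 ^ 2 = D := by
  have h1 := torusGen_mul_self (centeredConj_last_row (D := D) hδ)
  rw [torusGen_centered hδ, axis_dotProduct hx] at h1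
  set S := δ.1 * δ.1ᵀ
  have h2 := congrFun (congrFun h1 0) 0
  simp [formMat, Matrix.mul_apply] at h2
  have h3 : (S 0 0 * S 1 1 - S 0 1 ^ 2 : ℚ) = D := by linear_combination -h2
  exact_mod_cast h3

/-- The form of `x^⊥(ℤ)` is primitive: its three coefficients generate the unit ideal, as the
expansion of `det (δ ᵗδ) = 1` shows. -/
theorem exists_bezout_gram (δ : SL(3, ℤ)) : ∃ A B E : ℤ,
    (δ.1 * δ.1ᵀ) 0 0 * A + (δ.1 * δ.1ᵀ) 0 1 * B + (δ.1 * δ.1ᵀ) 1 1 * E = 1 := by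
  have hdet : (δ.1 * δ.1ᵀ).det = 1 := by rw [Matrix.det_mul, Matrix.det_transpose, δ.2, one_mul]
  have hsymm : ∀ i j, (δ.1 * δ.1ᵀ) i j = (δ.1 * δ.1ᵀ) j i := fun i j => by
    rw [← Matrix.transpose_apply (δ.1 * δ.1ᵀ), Matrix.transpose_mul, Matrix.transpose_transpose]
  set S := δ.1 * δ.1ᵀ
  rw [Matrix.det_fin_three, hsymm 1 0, hsymm 2 0, hsymm 2 1] at hdet
  exact ⟨S 1 1 * S 2 2 - S 1 2 ^ 2, 2 * S 0 2 * S 1 2 - S 0 1 * S 2 2, -S 0 2 ^ 2, by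
    linear_combination hdet⟩

/-- Squares are `0` or `1` modulo four. -/
theorem odd_of_norm_mod_four (hx : x ∈ primitivePoints D) (hD : D % 4 = 3) (i : Fin 3) :
    Odd (x i) := by
  have h1 : x 0 * x 0 + x 1 * x 1 + x 2 * x 2 = D := by
    rw [← hx.2, dotProduct, Fin.sum_univ_three]
  have hsq : ∀ a : ℤ, (Even a ∧ a * a % 4 = 0) ∨ (Odd a ∧ a * a % 4 = 1) := by
    intro a
    rcases Int.even_or_odd' a with ⟨k, rfl | rfl⟩
    · refine Or.inl ⟨even_two_mul k, ?_⟩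
      ring_nf
      omega
    · refine Or.inr ⟨odd_two_mul_add_one k, ?_⟩
      ring_nf
      omega
  have hall : Odd (x 0) ∧ Odd (x 1) ∧ Odd (x 2) := by
    rcases hsq (x 0) with ⟨-, h⟩ | ⟨h0, h⟩ <;> rcases hsq (x 1) with ⟨-, h'⟩ | ⟨h1', h'⟩ <;>
      rcases hsq (x 2) with ⟨-, h''⟩ | ⟨h2', h''⟩ <;> first | exact ⟨h0, h1', h2'⟩ | omega
  fin_cases i
  exacts [hall.1, hall.2.1, hall.2.2]

/-- An integral vector orthogonal to a vector with odd coordinates has even norm. -/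
theorem even_norm_of_orthogonal {u : Fin 3 → ℤ} (hx : ∀ i, Odd (x i)) (hu : u ⬝ᵥ x = 0) :
    Even (u ⬝ᵥ u) := by
  have h1 : u ⬝ᵥ u = ∑ i, u i * (u i - x i) := by
    have : u ⬝ᵥ u = u ⬝ᵥ (u - x) := by rw [dotProduct_sub, hu, sub_zero]
    exact this
  rw [h1]
  refine Finset.even_sum _ fun i _ => ?_
  rcases Int.even_or_odd (u i) with h | h
  · exact h.mul_right _
  · exact (h.sub_odd (hx i)).mul_left _

/-- The linear part of the base point is one at all primes, so that the order consists of the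
integral matrices of the quadratic algebra. -/
theorem mem_quadOrder_centered (hx : x ∈ primitivePoints D) (hδ : δ.1 *ᵥ x = ehat ℤ)
    (g : ASL2.pts ℝ) (a : Matrix (Fin 2) (Fin 2) ℚ) :
    a ∈ quadOrder ((axisTorus fun i => (x i : ℚ)).conj (centeredConj D x δ))
      (centeredPoint D x δ g) ↔
    (∃ α β : ℚ, a = α • (1 : Matrix (Fin 2) (Fin 2) ℚ) +
      β • formMat ((δ.1 * δ.1ᵀ) 0 0) ((δ.1 * δ.1ᵀ) 0 1) ((δ.1 * δ.1ᵀ) 1 1)) ∧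
      ∀ i j, ∃ n : ℤ, a i j = n := by
  have hlin : ∀ p : Nat.Primes, SpecialLinearGroup.map (atPrime p)
      (linPart (centeredPoint D x δ g)) = 1 := by
    intro p
    have h1 : SpecialLinearGroup.map (atPrime p) (linPart (ASL2.ofReal g)) = 1 := by
      refine Subtype.ext (Matrix.ext fun i j => ?_)
      have h2 := congrFun (congrFun (congrArg Subtype.val (finComp_ofReal ASL2 g p))
        i.castSucc) j.castSucc
      refine h2.trans ?_
      fin_cases i <;> fin_cases j <;> rfl
    have h2 : SpecialLinearGroup.map (atPrime p) (linPart
        ⟨baseSL Adele (originShift D ((cartan ℤ δ).1 *ᵥ x)),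
          map_mem_pts _ _ (originShift_mem _ _)⟩) =
        SpecialLinearGroup.map (algebraMap ℚ ℚ_[(p : ℕ)]) (linPart
          ⟨originShift D ((cartan ℤ δ).1 *ᵥ x), originShift_mem _ _⟩) := rfl
    rw [centeredPoint, linPart_mul, map_mul, h1, h2, linPart_originShift, map_one, mul_one]
  rw [mem_quadOrder, mem_torusAlgebra (norm_ne_zero hx) (centeredConj_last_row hδ),
    torusGen_centered hδ]
  refine and_congr_right fun _ => ?_
  simp only [hlin, inv_one, conjMat_one]
  constructor
  · exact fun h i j => exists_int_of_forall_padicInt fun p => h p i j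
  · intro h p i j
    obtain ⟨n, hn⟩ := h i j
    change ((a i j : ℚ) : ℚ_[(p : ℕ)]) ∈ _
    rw [hn, Rat.cast_intCast]
    exact intCast_mem _ _

/-- If `D` is `3` modulo four, the coordinates of `x` are odd and all vectors of `x^⊥(ℤ)` have even
norm. -/
theorem hasOrderDisc_centered (hx : x ∈ primitivePoints D) (hδ : δ.1 *ᵥ x = ehat ℤ)
    (g : ASL2.pts ℝ) :
    (D % 4 = 1 ∨ D % 4 = 2 →
      HasOrderDisc (quadOrder ((axisTorus fun i => (x i : ℚ)).conj (centeredConj D x δ))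
        (centeredPoint D x δ g)) (-4 * (D : ℤ))) ∧
    (D % 4 = 3 →
      HasOrderDisc (quadOrder ((axisTorus fun i => (x i : ℚ)).conj (centeredConj D x δ))
        (centeredPoint D x δ g)) (-(D : ℤ))) := by
  have hnorm := formMat_norm hx hδ
  have hc : (δ.1 * δ.1ᵀ) 0 0 ≠ 0 := by
    intro h
    rw [h] at hnorm
    have hD : (0 : ℤ) < D := Nat.cast_pos.2 (pos_of_primitive hx)
    nlinarith [sq_nonneg ((δ.1 * δ.1ᵀ) 0 1)]
  constructor
  · intro hD
    exact hasOrderDisc_formMat_of_mod_four hc hnorm (exists_bezout_gram δ) (by omega)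
      (mem_quadOrder_centered hx hδ g)
  · intro hD
    have hodd := odd_of_norm_mod_four hx hD
    exact hasOrderDisc_formMat_of_even hc hnorm (exists_bezout_gram δ)
      (even_norm_of_orthogonal hodd (congrFun hδ 0)) (even_norm_of_orthogonal hodd (congrFun hδ 1))
      (mem_quadOrder_centered hx hδ g)

end Discriminant

section Invariants

variable {D : ℕ} {x : Fin 3 → ℤ} {δ : SL(3, ℤ)}

theorem hasDiscriminant_gridToralSet (hx : x ∈ primitivePoints D) (hδ : δ.1 *ᵥ x = ehat ℤ)
    {g : ASL2.pts ℝ} (hg : ConjugatesToKinf x δ g) {d : ℤ}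
    (hd : HasOrderDisc (quadOrder ((axisTorus fun i => (x i : ℚ)).conj (centeredConj D x δ))
      (centeredPoint D x δ g)) d) : HasDiscriminant (gridToralSet x δ g) d :=
  ⟨⟨_, _, centeredConj_le hx hδ, isToralPresentation_centered hx hδ hg⟩, fun _ _ hT h =>
    (isToralPresentation_centered hx hδ hg).hasOrderDisc h (centeredConj_le hx hδ) hT hd⟩

theorem hasTorsionOrder_gridToralSet (hx : x ∈ primitivePoints D) (hδ : δ.1 *ᵥ x = ehat ℤ)
    {g : ASL2.pts ℝ} (hg : ConjugatesToKinf x δ g) : HasTorsionOrder (gridToralSet x δ g) D :=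
  ⟨⟨_, _, centeredConj_le hx hδ, isToralPresentation_centered hx hδ hg⟩, fun _ _ hT h =>
    ((isToralPresentation_centered hx hδ hg).torsionOrder_eq h (centeredConj_le hx hδ) hT).trans
      (torsionOrder_centered hx hδ g)⟩

end Invariants

end ToralGrids

end

theorem mainTheorem8 (D : ℕ) (x : Fin 3 → ℤ) (hx : x ∈ ToralGrids.primitivePoints D) :
    -- the choices of a rotation `g` and of a matrix `δ` exist
    (∃ g : SL(3, ℝ), ToralGrids.IsRotationToEhat D x g) ∧
    (∃ δ : SL(3, ℤ), δ.1 *ᵥ x = ToralGrids.ehat ℤ) ∧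
    -- the projection of `[ASL_2(𝔸)]` to `ASL_2(ℤ)\ASL_2(ℝ)` is a well-defined map
    (∀ a : ToralGrids.ASL2.AdelicSpace, ∃! b : ToralGrids.ASL2.RealSpace,
      ToralGrids.ASL2.ProjectsTo a b) ∧
    -- the collection built from the intersection of the two orbits is the collection of the
    -- orthogonal grids of all primitive points of norm `√D`
    (∀ g : SL(3, ℝ), ToralGrids.IsRotationToEhat D x g →
      ToralGrids.gridCollection D x g ⊆ ToralGrids.UnimodularCosets ∧
      ToralGrids.gridCollection D x g =
        ⋃ y ∈ ToralGrids.primitivePoints D, ToralGrids.grid D y) ∧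
    ∀ δ : SL(3, ℤ), δ.1 *ᵥ x = ToralGrids.ehat ℤ →
      (∃ gInf : ToralGrids.ASL2.pts ℝ, ToralGrids.ConjugatesToKinf x δ gInf) ∧
      ∀ gInf : ToralGrids.ASL2.pts ℝ, ToralGrids.ConjugatesToKinf x δ gInf →
        -- a `K_∞`-invariant homogeneous toral set
        ToralGrids.IsToralPresentation (ToralGrids.gridTorus x δ)
          (ToralGrids.ASL2.ofReal gInf) (ToralGrids.gridToralSet x δ gInf) ∧
        -- its projection
        (∀ g : SL(3, ℝ), ToralGrids.IsRotationToEhat D x g →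
          {b : ToralGrids.ASL2.RealSpace | ∃ a ∈ ToralGrids.gridToralSet x δ gInf,
            ToralGrids.ASL2.ProjectsTo a b} =
          ToralGrids.phi '' {C | C.1 ∈ ToralGrids.gridCollection D x g}) ∧
        -- its discriminant
        (D % 4 = 1 ∨ D % 4 = 2 →
          ToralGrids.HasDiscriminant (ToralGrids.gridToralSet x δ gInf) (-4 * (D : ℤ))) ∧
        (D % 4 = 3 →
          ToralGrids.HasDiscriminant (ToralGrids.gridToralSet x δ gInf) (-(D : ℤ))) ∧
        -- its torsion order
        ToralGrids.HasTorsionOrder (ToralGrids.gridToralSet x δ gInf) D := by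
  open ToralGrids in
  exact ⟨exists_isRotationToEhat hx, exists_SL_mulVec_eq_ehat hx.1, existsUnique_projectsTo,
    fun _ hg => ⟨gridCollection_subset hx hg, gridCollection_eq hx hg⟩, fun δ hδ =>
      ⟨(exists_isRotationToEhat hx).elim fun _ hk =>
        ⟨_, gridPoint_conjugates hk (pos_of_primitive hx) hδ⟩, fun gInf hg =>
        ⟨isToralPresentation_gridTorus hx hδ hg, fun _ hk => projection_gridToralSet hx hδ hg hk,
          fun hD => hasDiscriminant_gridToralSet hx hδ hg ((hasOrderDisc_centered hx hδ gInf).1 hD),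
          fun hD => hasDiscriminant_gridToralSet hx hδ hg ((hasOrderDisc_centered hx hδ gInf).2 hD),
          hasTorsionOrder_gridToralSet hx hδ hg⟩⟩⟩
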